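/- **Notation.** For measurable $\Omega\subset\mathbb R^2$ let $P(\Omega)$ be its (De Giorgi) perimeter and $\partial^*\Omega$ its reduced boundary, and let $\mathcal A_\pi$ be the class of measurable sets $\Omega\subset\mathbb R^2$ with $|\Omega|=\pi$ and $P(\Omega)<\infty$. For $\lambda,\alpha>0$ and $\Omega\in\mathcal A_\pi$ put $$F_{\lambda,\alpha}(\Omega)=P(\Omega)-\frac{\lambda^2}{4\pi}\int_\Omega\int_{\mathbb R^2\setminus\Omega}\frac{e^{-\lambda\alpha|x-y|}}{|x-y|}\,dy\,dx .$$ A set is *regular* if it is bounded and open with boundary of class $C^\infty$ (locally the set lies on one side of its boundary). The boundary of a regular set is the union of the images of finitely many pairwise disjoint smooth Jordan curves, parametrized as $1$-periodic curves with constant non-zero speed; such a finite family is called a *decomposition of $\Omega$ into its boundary curves*. $H^2(\mathbb S^1;\mathbb R^2)$ is the set of (continuous representatives of) $1$-periodic functions in $H^2_{\rm loc}(\mathbb R;\mathbb R^2)$; $\gamma$ in it is a regular curve if $\gamma'(t)\neq0$ for all $t$. Write $y^\perp=(-y_2,y_1)$, $L(\gamma)=\int_0^1|\gamma'|\,dt$,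 $\kappa=\frac{(\gamma')^\perp\cdot\gamma''}{|\gamma'|^3}$ for the curvature, and $\mathcal I(\gamma,x)=\frac1{2\pi}\int_0^1\frac{(\gamma(t)-x)^\perp\cdot\gamma'(t)}{|\gamma(t)-x|^2}\,dt$ for the winding number around $x\notin\gamma([0,1])$. For a finite family $\gamma=\{\gamma_i\}_{i\in I}$ of regular curves in $H^2(\mathbb S^1;\mathbb R^2)$ with curvatures $\kappa_i$, let $\Gamma=\bigcup_i\gamma_i([0,1])$, $$\hat F_{\infty,\sigma}(\gamma)=\sum_{i\in I}\Big(\sigma L(\gamma_i)+\frac\pi2\int_0^1\kappa_i^2|\gamma_i'|\,dt\Big),\qquad A^o_\gamma=\Big\{x\in\mathbb R^2\setminus\Gamma:\ \sum_{i\in I}\mathcal I(\gamma_i,x)\equiv1\ (\mathrm{mod}\ 2)\Big\}.$$ For a set $\Omega$ of finite perimeter let $\Omega^*=\{x:\exists r>0,\ |B_r(x)\setminus\Omega|=0\}$, and let $G(\Omega)$ be the set of all finite families $\gamma$ of regular, constant speed curves in $H^2(\mathbb S^1;\mathbb R^2)$ with $\partial^*\Omega\subset\Gamma$ and $\Omega^*=\operatorname{int}(A_\gamma^o\cup\Gamma)$.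 **Proposition.** Let $\lambda_n\to\infty$ and $\alpha_n>\frac1{\sqrt{2\pi}}$ be sequences such that $\sigma_n:=\lambda_n^2\big(1-\frac1{2\pi\alpha_n^2}\big)\to\sigma$ for some $\sigma>0$. Let $\Omega_n\in\mathcal A_\pi$, $n\in\mathbb N$, be regular sets such that $\chi_{\Omega_n}\to\chi_{\Omega_\infty}$ in $L^1(\mathbb R^2)$ for some $\Omega_\infty\in\mathcal A_\pi$, and such that $\limsup_{n\to\infty}\lambda_n^2F_{\lambda_n,\alpha_n}(\Omega_n)<\infty$. Let $I\subset\mathbb N$ be finite and $\gamma_\infty=\{\gamma_{\infty,i}\}_{i\in I}\in G(\Omega_\infty)$. For every $n$ let $\{\gamma_{n,i}\}_{i\in I}$ be a sub-collection (with distinct curves for distinct $i\in I$) of a decomposition of $\Omega_n$ into its boundary curves, such that $\gamma_{n,i}\to\gamma_{\infty,i}$ in $H^1(\mathbb S^1;\mathbb R^2)$ as $n\to\infty$ for all $i\in I$. Then $$\hat F_{\infty,\sigma}(\gamma_\infty)\le\liminf_{n\to\infty}\lambda_n^2F_{\lambda_n,\alpha_n}(\Omega_n).$$ -/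

import Mathlib

open Set Filter Topology MeasureTheory
open scoped ContDiff

noncomputable section

namespace NonlocalIso

/-- The Euclidean plane `ℝ²`. -/
abbrev Plane : Type := EuclideanSpace ℝ (Fin 2)

/-- Counter-clockwise rotation by 90 degrees, `y^⊥ = (-y₂, y₁)`. -/
def perp (y : Plane) : Plane := !₂[-(y 1), y 0]

/-! ### Perimeter, reduced boundary, regular sets -/

/-- The divergence of a vector field. -/
def divergence (φ : Plane → Plane) (x : Plane) : ℝ :=
  ∑ i : Fin 2, (fderiv ℝ φ x (EuclideanSpace.single i 1)) i

/-- Vector fields of class `C¹` with compact support. -/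
def IsTestField (φ : Plane → Plane) : Prop :=
  ContDiff ℝ 1 φ ∧ HasCompactSupport φ

/-- The (De Giorgi) perimeter
`P(Ω) = sup { ∫_Ω div φ : φ ∈ C¹_c(ℝ²; ℝ²), |φ| ≤ 1 } ∈ [0, ∞]`. -/
def perimeter (Ω : Set Plane) : ENNReal :=
  ⨆ (φ : Plane → Plane) (_ : IsTestField φ) (_ : ∀ x, ‖φ x‖ ≤ 1),
    ENNReal.ofReal (∫ x in Ω, divergence φ x)

/-- `μ = |Dχ_Ω|` and `ν` is the (measure theoretic) outward unit normal: the polar decomposition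
of the distributional gradient of `χ_Ω`. The pair is unique (`ν` up to `μ`-null sets), and it
exists for every set of finite perimeter. -/
def IsGaussGreen (Ω : Set Plane) (μ : Measure Plane) (ν : Plane → Plane) : Prop :=
  IsLocallyFiniteMeasure μ ∧ Measurable ν ∧ (∀ᵐ x ∂μ, ‖ν x‖ = 1) ∧
    ∀ φ : Plane → Plane, IsTestField φ →
      ∫ x in Ω, divergence φ x = ∫ x, inner ℝ (φ x) (ν x) ∂μ

/-- The reduced boundary `∂*Ω`: the points of the support of `|Dχ_Ω|` at which the averages of
the normal over small balls converge to a unit vector. -/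
def reducedBoundary (Ω : Set Plane) : Set Plane :=
  {x | ∃ (μ : Measure Plane) (ν : Plane → Plane), IsGaussGreen Ω μ ν ∧
    (∀ r > 0, 0 < μ (Metric.ball x r)) ∧
    ∃ n : Plane, ‖n‖ = 1 ∧
      Tendsto (fun r : ℝ => ⨍ y in Metric.ball x r, ν y ∂μ) (𝓝[>] 0) (𝓝 n)}

/-- The admissible class `𝒜_m`: (Lebesgue) measurable sets of area `m` and finite perimeter. -/
def Admissible (m : ℝ) (Ω : Set Plane) : Prop :=
  NullMeasurableSet Ω ∧ volume Ω = ENNReal.ofReal m ∧ perimeter Ω < ⊤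

/-- A regular set: a bounded open set with boundary of class `C^∞`, that is, near every boundary
point it is the sublevel set of a smooth function with non-vanishing differential. -/
def IsRegularSet (Ω : Set Plane) : Prop :=
  Bornology.IsBounded Ω ∧ IsOpen Ω ∧
    ∀ p ∈ frontier Ω, ∃ (U : Set Plane) (ρ : Plane → ℝ), IsOpen U ∧ p ∈ U ∧
      ContDiffOn ℝ ∞ ρ U ∧ fderiv ℝ ρ p ≠ 0 ∧ Ω ∩ U = {x ∈ U | ρ x < 0}

/-- The energy
`F_{λ,α}(Ω) = P(Ω) - λ²/(4π) ∫_Ω ∫_{Ωᶜ} e^{-λα|x-y|} / |x-y| dy dx`.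
For `λ, α > 0` and `Ω` admissible, both terms are finite. -/
def energy (lam α : ℝ) (Ω : Set Plane) : ℝ :=
  (perimeter Ω).toReal - lam ^ 2 / (4 * Real.pi) *
    ∫ x in Ω, ∫ y in Ωᶜ, Real.exp (-(lam * α * ‖x - y‖)) / ‖x - y‖

/-! ### Closed curves -/

/-- `g` is the weak derivative of `f` on `ℝ`. -/
def HasWeakDeriv (f g : ℝ → Plane) : Prop :=
  LocallyIntegrable f ∧ LocallyIntegrable g ∧
    ∀ φ : ℝ → ℝ, ContDiff ℝ ∞ φ → HasCompactSupport φ →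
      ∫ t, deriv φ t • f t = -∫ t, φ t • g t

open Classical in
/-- The weak derivative of `f` (unique up to null sets), if there is one. -/
def weakDeriv (f : ℝ → Plane) : ℝ → Plane :=
  if h : ∃ g, HasWeakDeriv f g then h.choose else 0

/-- `f ∈ L²_loc(ℝ; ℝ²)`. -/
def MemL2Loc (f : ℝ → Plane) : Prop :=
  ∀ K : Set ℝ, IsCompact K → MemLp f 2 (volume.restrict K)

/-- `γ ∈ H²(𝕊¹; ℝ²)`: the continuous representative of a `1`-periodic function in
`H²_loc(ℝ; ℝ²)`. Such a `γ` is of class `C¹`. -/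
def IsH2Curve (γ : ℝ → Plane) : Prop :=
  Continuous γ ∧ Function.Periodic γ 1 ∧
    ∃ g h : ℝ → Plane, MemL2Loc g ∧ MemL2Loc h ∧ HasWeakDeriv γ g ∧ HasWeakDeriv g h

/-- The length `L(γ) = ∫₀¹ |γ'|`. -/
def curveLength (γ : ℝ → Plane) : ℝ := ∫ t in (0 : ℝ)..1, ‖deriv γ t‖

/-- A regular curve: `γ'` vanishes nowhere. -/
def IsRegularCurve (γ : ℝ → Plane) : Prop := ∀ t, deriv γ t ≠ 0

/-- Parametrization by constant speed. -/
def HasConstantSpeed (γ : ℝ → Plane) : Prop := ∀ t, ‖deriv γ t‖ = curveLength γ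

/-- The curvature `κ = (γ')^⊥ · γ'' / |γ'|³`, where `γ''` is the weak derivative of `γ'`. -/
def curvature (γ : ℝ → Plane) (t : ℝ) : ℝ :=
  inner ℝ (perp (deriv γ t)) (weakDeriv (deriv γ) t) / ‖deriv γ t‖ ^ 3

/-- The winding number of `γ` around `x`. -/
def winding (γ : ℝ → Plane) (x : Plane) : ℝ :=
  1 / (2 * Real.pi) *
    ∫ t in (0 : ℝ)..1, inner ℝ (perp (γ t - x)) (deriv γ t) / ‖γ t - x‖ ^ 2

/-- The squared `H¹(𝕊¹; ℝ²)` distance of two curves. -/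
def h1DistSq (γ η : ℝ → Plane) : ENNReal :=
  ∫⁻ t in Icc (0 : ℝ) 1, (‖γ t - η t‖ₑ ^ 2 + ‖deriv γ t - deriv η t‖ₑ ^ 2)

/-! ### Systems of curves -/

/-- The union `Γ` of the images of a system of curves. -/
def trace {ι : Type*} (γ : ι → ℝ → Plane) : Set Plane := ⋃ i, γ i '' Icc 0 1

/-- The set `A_γ^o` of points off `Γ` with odd total winding number. -/
def oddInterior {ι : Type*} [Fintype ι] (γ : ι → ℝ → Plane) : Set Plane :=
  {x | x ∉ trace γ ∧ ∃ k : ℤ, ∑ i, winding (γ i) x = 2 * (k : ℝ) + 1}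

/-- The open set `Ω^* = {x : |B_r(x) \ Ω| = 0 for some r > 0}`. -/
def starSet (Ω : Set Plane) : Set Plane :=
  {x | ∃ r > 0, volume (Metric.ball x r \ Ω) = 0}

/-- `γ ∈ G(Ω)`: `γ` is a finite system of `H²` boundary curves of `Ω`. -/
def IsBoundarySystem (Ω : Set Plane) {ι : Type*} [Fintype ι] (γ : ι → ℝ → Plane) : Prop :=
  (∀ i, IsH2Curve (γ i) ∧ IsRegularCurve (γ i) ∧ HasConstantSpeed (γ i)) ∧
    reducedBoundary Ω ⊆ trace γ ∧
    starSet Ω = interior (oddInterior γ ∪ trace γ)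

/-- The limit energy of a system of curves,
`∑ᵢ (σ L(γᵢ) + π/2 ∫₀¹ κᵢ² |γᵢ'| dt)`. -/
def limitEnergy (σ : ℝ) {ι : Type*} [Fintype ι] (γ : ι → ℝ → Plane) : ℝ :=
  ∑ i, (σ * curveLength (γ i) +
    Real.pi / 2 * ∫ t in (0 : ℝ)..1, curvature (γ i) t ^ 2 * ‖deriv (γ i) t‖)

/-- A smooth Jordan curve, parametrized on `[0, 1]` with constant (non-zero) speed. -/
def IsSmoothJordanCurve (γ : ℝ → Plane) : Prop :=
  ContDiff ℝ ∞ γ ∧ Function.Periodic γ 1 ∧ InjOn γ (Ico 0 1) ∧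
    IsRegularCurve γ ∧ HasConstantSpeed γ

/-- A decomposition of `∂Ω` into boundary curves: finitely many disjoint smooth Jordan curves
of constant speed whose images make up `∂Ω` (either orientation of each curve is allowed). -/
def IsBoundaryDecomposition (Ω : Set Plane) {N : ℕ} (c : Fin N → ℝ → Plane) : Prop :=
  (∀ j, IsSmoothJordanCurve (c j)) ∧
    Pairwise (fun j k => Disjoint (c j '' Icc 0 1) (c k '' Icc 0 1)) ∧
    trace c = frontier Ω

end NonlocalIso

end

open scoped ContDiff

noncomputable section

namespace NonlocalIso

/-! ### Counting the boundary crossings of a segment -/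

/-! The proof is integral-geometric. Describe a segment of length `r` by its base point and its
direction. By Crofton's formula the boundary crossings of all such segments have total measure `4 r
P(Ω)`, and a segment has exactly one end point in `Ω` when its number of crossings is odd. Hence
`oddMeasure Ω r` falls short of `4 r P(Ω)` by at least twice the measure `totalDefect Ω r` of the
pairs of crossings (`oddMeasure_add_totalDefect_le`, with `oddMeasure_le` for the upper bound by the
perimeter). In polar coordinates the nonlocal term is half the integral of `exp (-λ α r)` against
`oddMeasure Ω r` (`lintegral_kernel`). So `λ² F` is at least `λ² (1 - 1/(2πα²)) P(Ω)` plus `λ⁴/(4π)`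
times the integral of `exp (-λ α r)` against `totalDefect Ω r` (`le_energy`).

The first coefficient tends to `σ`, and `P(Ω)` bounds the length of the selected curves
(`sum_curveLength_le`); this gives the length part of the limit energy.

In the second term substitute `r = s/λ` and apply Fatou's lemma. What remains is a cubic lower bound
for the defect: asymptotically each curve contributes at least `r³/12` times the integral of its
squared curvature with respect to arc length (`eventually_le_arcDefect_curve`). The reason is that
the parallel segments of direction `φ` that meet an arc in superfluous pairs are measured by the
total minus the net variation of the height of the arc over that direction. Averaged over `φ` this
is length minus chord, about `κ² r³/24` on a piece of length `r`. As `∫ s³ exp (-s/√(2π)) ds =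
24π²`, the final constant is `24π² / (4π · 12) = π/2`.

Two difficulties come from having only `H¹` convergence. The curvatures of the approximating curves
are not controlled, so the loss of length in a window is bounded below by a functional that is
linear in the tangent and depends on a smooth test field `ψ` (`le_windowGap`); it passes to the
limit, and `ψ` is optimized only there. Moreover the tangents may deviate from their limit on small
sets. Either the defect is already large, or it forces the misaligned times to have measure `O(r²)`
(`volume_misaligned_le`), which is negligible. A variant of the rising sun lemma
(`volume_compl_futureMinTimes_le`) then shows that after most times the arc advances steadily, as
the sharp bound `sharp_le_arcDefect` needs. -/

/-- The unit vector of angle `φ`. -/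
def dir (φ : ℝ) : Plane := !₂[Real.cos φ, Real.sin φ]

open Classical in
/-- `1` if exactly one of the two points lies in `Ω`, and `0` otherwise. -/
def chg (Ω : Set Plane) (x y : Plane) : ℕ := if (x ∈ Ω ↔ y ∈ Ω) then 0 else 1

/-- The number of changes of the indicator function of `Ω` along the subdivision of the segment
`[x, x + z]` into `k` equal parts. -/
def flips (Ω : Set Plane) (k : ℕ) (x z : Plane) : ℕ :=
  ∑ j ∈ Finset.range k, chg Ω (x + ((j : ℝ) / k) • z) (x + (((j + 1 : ℕ) : ℝ) / k) • z)

/-- The number of pairs of boundary crossings on the segment `[x, x + z]`. -/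
def defect (Ω : Set Plane) (x z : Plane) : ENNReal :=
  -- The lower limit suits Fatou's lemma, so convergence along the subdivisions is never needed; `k
  -- + 1` avoids a division into zero parts.
  liminf (fun k : ℕ => ((flips Ω (k + 1) x z / 2 : ℕ) : ENNReal)) atTop

/-- The number of boundary crossings on the segment `[x, x + z]`. -/
def crossCount (Ω : Set Plane) (x z : Plane) : ENNReal :=
  liminf (fun k : ℕ => ((flips Ω (k + 1) x z : ℕ) : ENNReal)) atTop

/-- The measure of the segments of length `r` with exactly one end point in `Ω`. -/
def oddMeasure (Ω : Set Plane) (r : ℝ) : ENNReal :=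
  ∫⁻ φ in Ioc (-Real.pi) Real.pi, ∫⁻ x, (chg Ω x (x + r • dir φ) : ENNReal)

/-- The integral of the number of pairs of boundary crossings over all segments of length `r`. -/
def totalDefect (Ω : Set Plane) (r : ℝ) : ENNReal :=
  ∫⁻ φ in Ioc (-Real.pi) Real.pi, ∫⁻ x, defect Ω x (r • dir φ)

lemma chg_le_one (Ω : Set Plane) (x y : Plane) : chg Ω x y ≤ 1 := by
  unfold chg; split_ifs <;> simp

/-- Each change toggles membership in `Ω`, so only the two end points matter modulo two. -/
lemma sum_chg_mod_two (Ω : Set Plane) (p : ℕ → Plane) (m : ℕ) :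
    (∑ j ∈ Finset.range m, chg Ω (p j) (p (j + 1))) % 2 = chg Ω (p 0) (p m) % 2 := by
  induction m with
  | zero => simp [chg]
  | succ m ih =>
    rw [Finset.sum_range_succ, Nat.add_mod, ih]
    unfold chg
    by_cases h0 : p 0 ∈ Ω <;> by_cases h1 : p m ∈ Ω <;> by_cases h2 : p (m + 1) ∈ Ω <;>
      simp [h0, h1, h2]

/-- By parity, all changes beyond the one seen by the end points come in pairs. Integrated over
segments, this identity separates `oddMeasure` from twice the defect. -/
lemma flips_eq (Ω : Set Plane) (k : ℕ) (x z : Plane) :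
    flips Ω (k + 1) x z = chg Ω x (x + z) + 2 * (flips Ω (k + 1) x z / 2) := by
  have h := sum_chg_mod_two Ω (fun j => x + ((j : ℝ) / ((k + 1 : ℕ) : ℝ)) • z) (k + 1)
  have h2 := chg_le_one Ω x (x + z)
  have hk : ((k + 1 : ℕ) : ℝ) ≠ 0 := by positivity
  simp only [Nat.cast_zero, zero_div, zero_smul, add_zero, div_self hk, one_smul] at h
  change flips Ω (k + 1) x z % 2 = _ at h
  omega

lemma measurable_chg {α : Type*} [MeasurableSpace α] {Ω : Set Plane} (hΩ : MeasurableSet Ω)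
    {f g : α → Plane} (hf : Measurable f) (hg : Measurable g) :
    Measurable (fun a => chg Ω (f a) (g a)) := by
  unfold chg
  refine Measurable.ite ?_ measurable_const measurable_const
  have h1 : MeasurableSet {a | f a ∈ Ω} := hf hΩ
  have h2 : MeasurableSet {a | g a ∈ Ω} := hg hΩ
  have : {a | f a ∈ Ω ↔ g a ∈ Ω} =
      ({a | f a ∈ Ω} ∩ {a | g a ∈ Ω}) ∪ ({a | f a ∈ Ω}ᶜ ∩ {a | g a ∈ Ω}ᶜ) := by
    ext a; simp only [mem_ofPred_eq, mem_union, mem_inter_iff, mem_compl_iff]; tauto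
  rw [this]
  exact (h1.inter h2).union (h1.compl.inter h2.compl)

lemma measurable_flips {α : Type*} [MeasurableSpace α] {Ω : Set Plane} (hΩ : MeasurableSet Ω)
    (k : ℕ) {f g : α → Plane} (hf : Measurable f) (hg : Measurable g) :
    Measurable (fun a => flips Ω k (f a) (g a)) := by
  unfold flips
  refine Finset.measurable_sum _ fun j _ => measurable_chg hΩ ?_ ?_
  · fun_prop
  · fun_prop

lemma measurable_natCast_comp {α : Type*} [MeasurableSpace α] {f : α → ℕ} (hf : Measurable f) :
    Measurable (fun a => (f a : ENNReal)) :=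
  (measurable_from_top (f := fun n : ℕ => (n : ENNReal))).comp hf

lemma measurable_defect {α : Type*} [MeasurableSpace α] {Ω : Set Plane} (hΩ : MeasurableSet Ω)
    {f g : α → Plane} (hf : Measurable f) (hg : Measurable g) :
    Measurable (fun a => defect Ω (f a) (g a)) := by
  unfold defect
  refine Measurable.liminf fun k => ?_
  exact (measurable_from_top (f := fun n : ℕ => ((n / 2 : ℕ) : ENNReal))).comp
    (measurable_flips hΩ _ hf hg)

lemma continuous_dir : Continuous dir := by
  unfold dir; fun_prop

lemma measurable_dir : Measurable dir := continuous_dir.measurable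

lemma norm_dir (φ : ℝ) : ‖dir φ‖ = 1 := by
  rw [EuclideanSpace.norm_eq]; simp [dir]

/-- Translation invariance: the `k + 1` parts of a segment differ only by a shift of the base point.
-/
lemma lintegral_flips {Ω : Set Plane} (hΩ : MeasurableSet Ω) (k : ℕ) (z : Plane) :
    ∫⁻ x, (flips Ω (k + 1) x z : ENNReal) =
      (k + 1 : ℕ) * ∫⁻ x, (chg Ω x (x + (1 / ((k + 1 : ℕ) : ℝ)) • z) : ENNReal) := by
  have hk : ((k + 1 : ℕ) : ℝ) ≠ 0 := by positivity
  unfold flips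
  simp only [Nat.cast_sum]
  rw [lintegral_finsetSum]
  · have : ∀ j ∈ Finset.range (k + 1), ∫⁻ x, (chg Ω (x + ((j : ℝ) / ((k + 1 : ℕ) : ℝ)) • z)
        (x + (((j + 1 : ℕ) : ℝ) / ((k + 1 : ℕ) : ℝ)) • z) : ENNReal) =
        ∫⁻ x, (chg Ω x (x + (1 / ((k + 1 : ℕ) : ℝ)) • z) : ENNReal) := by
      intro j _
      rw [← lintegral_add_right_eq_self (fun x => (chg Ω x (x + (1 / ((k + 1 : ℕ) : ℝ)) • z) : ENNReal))
        (((j : ℝ) / ((k + 1 : ℕ) : ℝ)) • z)]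
      refine lintegral_congr fun x => ?_
      congr 2
      rw [add_assoc, ← add_smul, ← add_div]
      push_cast; rfl
    rw [Finset.sum_congr rfl this]
    simp
  · intro j _
    exact measurable_natCast_comp
      (measurable_chg hΩ (measurable_id.add_const _) (measurable_id.add_const _))

lemma oddMeasure_subdivide {Ω : Set Plane} (hΩ : MeasurableSet Ω) (k : ℕ) (r : ℝ) :
    ∫⁻ φ in Ioc (-Real.pi) Real.pi, ∫⁻ x, (flips Ω (k + 1) x (r • dir φ) : ENNReal) =
      (k + 1 : ℕ) * oddMeasure Ω (r / (k + 1 : ℕ)) := by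
  unfold oddMeasure
  rw [← lintegral_const_mul']
  · refine lintegral_congr fun φ => ?_
    rw [lintegral_flips hΩ, smul_smul]
    congr! 5
    ring_nf
  · simp

/-- Integral geometric bound for the number of boundary crossings. -/
lemma lintegral_crossCount_le {Ω : Set Plane} (hΩ : MeasurableSet Ω) {P : ENNReal}
    (hP : ∀ r : ℝ, 0 ≤ r → oddMeasure Ω r ≤ ENNReal.ofReal (4 * r) * P) {r : ℝ} (hr : 0 ≤ r) :
    ∫⁻ φ in Ioc (-Real.pi) Real.pi, ∫⁻ x, crossCount Ω x (r • dir φ) ≤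
      ENNReal.ofReal (4 * r) * P := by
  have hm : ∀ k, Measurable (fun p : ℝ × Plane => (flips Ω (k + 1) p.2 (r • dir p.1) : ENNReal)) :=
    fun k => measurable_natCast_comp (measurable_flips hΩ _ measurable_snd
      (by have := measurable_dir; fun_prop))
  -- Fatou in `x`, then in `φ`. The integral of the subdivided count is at most `(k + 1) * (4 r / (k
  -- + 1)) * P`, which does not depend on `k`.
  calc _ ≤ ∫⁻ φ in Ioc (-Real.pi) Real.pi, liminf (fun k : ℕ =>
            ∫⁻ x, (flips Ω (k + 1) x (r • dir φ) : ENNReal)) atTop := by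
        refine lintegral_mono fun φ => ?_
        exact lintegral_liminf_le fun k => measurable_natCast_comp
          (measurable_flips hΩ _ measurable_id measurable_const)
    _ ≤ liminf (fun k : ℕ => ∫⁻ φ in Ioc (-Real.pi) Real.pi,
            ∫⁻ x, (flips Ω (k + 1) x (r • dir φ) : ENNReal)) atTop :=
        lintegral_liminf_le fun k => Measurable.lintegral_prod_right (f := fun φ x =>
          (flips Ω (k + 1) x (r • dir φ) : ENNReal)) (hm k)
    _ ≤ liminf (fun _ : ℕ => ENNReal.ofReal (4 * r) * P) atTop := by
        refine liminf_le_liminf (Eventually.of_forall fun k => ?_)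
        rw [oddMeasure_subdivide hΩ]
        have hk : (0 : ℝ) < ((k + 1 : ℕ) : ℝ) := by positivity
        refine (mul_le_mul_right (hP _ (by positivity)) _).trans ?_
        rw [← mul_assoc, ← ENNReal.ofReal_natCast, ← ENNReal.ofReal_mul (by positivity)]
        refine le_of_eq ?_
        congr 2
        field_simp
    _ = _ := by simp

/-- Integral geometric bound for the pairs of boundary crossings. -/
lemma oddMeasure_add_totalDefect_le {Ω : Set Plane} (hΩ : MeasurableSet Ω) {P : ENNReal}
    (hP : ∀ r : ℝ, 0 ≤ r → oddMeasure Ω r ≤ ENNReal.ofReal (4 * r) * P) {r : ℝ} (hr : 0 ≤ r) :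
    oddMeasure Ω r + 2 * totalDefect Ω r ≤ ENNReal.ofReal (4 * r) * P := by
  have hchg : Measurable (fun p : ℝ × Plane => (chg Ω p.2 (p.2 + r • dir p.1) : ENNReal)) :=
    measurable_natCast_comp (measurable_chg hΩ measurable_snd
      (by have := measurable_dir; fun_prop))
  have hdef : Measurable (fun p : ℝ × Plane => defect Ω p.2 (r • dir p.1)) :=
    measurable_defect hΩ measurable_snd (by have := measurable_dir; fun_prop)
  refine le_trans (le_of_eq ?_) (lintegral_crossCount_le hΩ hP hr)
  unfold oddMeasure totalDefect
  rw [← lintegral_const_mul _ (Measurable.lintegral_prod_right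
      (f := fun φ x => defect Ω x (r • dir φ)) hdef),
    ← lintegral_add_left (Measurable.lintegral_prod_right
      (f := fun φ x => (chg Ω x (x + r • dir φ) : ENNReal)) hchg)]
  refine lintegral_congr fun φ => ?_
  have h1 : Measurable fun x => (chg Ω x (x + r • dir φ) : ENNReal) :=
    measurable_natCast_comp (measurable_chg hΩ measurable_id (measurable_id.add_const _))
  have h2 : Measurable fun x => defect Ω x (r • dir φ) :=
    measurable_defect hΩ measurable_id measurable_const
  rw [← lintegral_const_mul _ h2, ← lintegral_add_left h1]
  refine lintegral_congr fun x => ?_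
  unfold crossCount defect
  -- The end point term does not depend on `k`, so it leaves the lower limit.
  have : ∀ k : ℕ, (flips Ω (k + 1) x (r • dir φ) : ENNReal) =
      chg Ω x (x + r • dir φ) + 2 * ((flips Ω (k + 1) x (r • dir φ) / 2 : ℕ) : ENNReal) := by
    intro k
    conv_lhs => rw [flips_eq]
    push_cast; rfl
  simp_rw [this]
  rw [← ENNReal.liminf_const_mul_of_ne_top (by simp)]
  exact (liminf_const_add atTop _ _ (by isBoundedDefault) (by isBoundedDefault)).symm

/-! ### Transversal intersections of boundary curves with segments -/

/-- The supremum of the cardinalities of the finite subsets of `S`. -/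
def fullCount (S : Set ℝ) : ENNReal := ⨆ F : {F : Finset ℝ // ↑F ⊆ S}, (F.1.card : ENNReal)

/-- Half the number of elements of `S`, rounded down. -/
def halfCount (S : Set ℝ) : ENNReal :=
  ⨆ F : {F : Finset ℝ // ↑F ⊆ S}, ((F.1.card / 2 : ℕ) : ENNReal)

/-- The times in `(a, b)` at which `γ` crosses the segment `[x, x + z]` transversally. -/
def crossTimes (γ : ℝ → Plane) (a b : ℝ) (x z : Plane) : Set ℝ :=
  {t | t ∈ Ioo a b ∧ (∃ s ∈ Ioo (0 : ℝ) 1, γ t = x + s • z) ∧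
    inner ℝ (perp z) (deriv γ t) ≠ 0}

lemma inner_perp (z v : Plane) : inner ℝ (perp z) v = z 0 * v 1 - z 1 * v 0 := by
  simp [perp, PiLp.inner_apply, Fin.sum_univ_two]; ring

/-- The indicator function of `Ω` changes at the parameter `s` along the line `s ↦ x + s z`. -/
def ChangesAt (Ω : Set Plane) (x z : Plane) (s : ℝ) : Prop :=
  ∀ᶠ ε in 𝓝[>] (0 : ℝ), ∀ ε₁ ∈ Ioo 0 ε, ∀ ε₂ ∈ Ioo 0 ε,
    ¬ (x + (s - ε₁) • z ∈ Ω ↔ x + (s + ε₂) • z ∈ Ω)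

/-- A zero with non-zero derivative is a change of sign. Multiplying the slope by `d` treats both
signs of `d` at once. -/
lemma changesAt_of_sign {Ω : Set Plane} {x z : Plane} {s : ℝ} {g : ℝ → ℝ} {d : ℝ}
    (hg : HasDerivAt g d s) (hs : g s = 0) (hd : d ≠ 0)
    (hΩ : ∀ᶠ τ in 𝓝 s, (x + τ • z ∈ Ω ↔ g τ < 0)) : ChangesAt Ω x z s := by
  have h1 := hasDerivAt_iff_tendsto_slope.1 hg
  have h2 : ∀ᶠ τ in 𝓝[≠] s, 0 < d * slope g s τ := by
    have : Tendsto (fun τ => d * slope g s τ) (𝓝[≠] s) (𝓝 (d * d)) := h1.const_mul d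
    exact this.eventually (lt_mem_nhds (mul_self_pos.2 hd))
  have h3 := (eventually_nhdsWithin_iff.1 h2).and hΩ
  obtain ⟨ε, hε, hball⟩ := Metric.eventually_nhds_iff.1 h3
  filter_upwards [Ioo_mem_nhdsGT hε] with ε' hε' ε₁ h₁ ε₂ h₂
  have ha := @hball (s - ε₁) (by rw [Real.dist_eq]; rw [abs_lt]; constructor <;> linarith [h₁.1, h₁.2, hε'.2])
  have hb := @hball (s + ε₂) (by rw [Real.dist_eq]; rw [abs_lt]; constructor <;> linarith [h₂.1, h₂.2, hε'.2])
  have ha1 := ha.1 (by simp [h₁.1.ne'])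
  have hb1 := hb.1 (by simp [h₂.1.ne'])
  rw [ha.2, hb.2]
  rw [slope_def_field, hs, sub_zero] at ha1 hb1
  have e1 : s - ε₁ - s = -ε₁ := by ring
  have e2 : s + ε₂ - s = ε₂ := by ring
  rw [e1, div_neg, mul_neg, ← mul_div_assoc, Left.neg_pos_iff] at ha1
  rw [e2, ← mul_div_assoc] at hb1
  have ha2 : d * g (s - ε₁) < 0 := by
    by_contra hc; exact absurd ha1 (not_lt.2 (div_nonneg (not_lt.1 hc) h₁.1.le))
  have hb2 : 0 < d * g (s + ε₂) := by
    by_contra hc; exact absurd hb1 (not_lt.2 (div_nonpos_of_nonpos_of_nonneg (not_lt.1 hc) h₂.1.le))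
  rcases lt_or_gt_of_ne hd with hd | hd
  · have := pos_of_mul_neg_right ha2 hd.le
    have := neg_of_mul_pos_right hb2 hd.le
    intro h; exact absurd (h.2 this) (not_lt.2 (by assumption : 0 < g (s - ε₁)).le)
  · have h5 := neg_of_mul_neg_right ha2 hd.le
    have h6 := pos_of_mul_pos_right hb2 hd.le
    intro h; exact absurd (h.1 h5) (not_lt.2 h6.le)

/-- An open set misses its frontier, so `ρ q` is not negative; if it were positive, `Ω` would stay
away from a neighbourhood of `q`. -/
lemma frontier_level {Ω U : Set Plane} {ρ : Plane → ℝ} (hΩ : IsOpen Ω) (hU : IsOpen U)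
    (hρ : ContinuousOn ρ U) (h : Ω ∩ U = {x ∈ U | ρ x < 0}) {q : Plane} (hq : q ∈ frontier Ω)
    (hqU : q ∈ U) : ρ q = 0 := by
  have hqΩ : q ∉ Ω := by
    have := hΩ.frontier_eq ▸ hq
    exact this.2
  apply le_antisymm
  · by_contra hpos
    push Not at hpos
    have hcont := (hρ.continuousAt (hU.mem_nhds hqU)).eventually (lt_mem_nhds hpos)
    have hcl := mem_closure_iff_frequently.1 (frontier_subset_closure hq)
    obtain ⟨y, hy1, hy2, hy3⟩ := (hcl.and_eventually (hcont.and (hU.mem_nhds hqU))).exists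
    have : y ∈ Ω ∩ U := ⟨hy1, hy3⟩
    rw [h] at this
    exact absurd this.2 (not_lt.2 hy2.le)
  · by_contra hneg
    push Not at hneg
    have : q ∈ Ω ∩ U := by rw [h]; exact ⟨hqU, hneg⟩
    exact hqΩ this.1

/-- The defining function `ρ` vanishes along `γ`, so its differential annihilates the tangent `v`.
It cannot annihilate `z` as well, since `v` and `z` span the plane; hence `ρ` has a simple zero
along the line. -/
lemma changesAt_of_cross {Ω : Set Plane} (hΩ : IsRegularSet Ω) {γ : ℝ → Plane} {v : Plane} {t : ℝ}
    (hγ : HasDerivAt γ v t) (hfr : ∀ᶠ τ in 𝓝 t, γ τ ∈ frontier Ω) {x z : Plane} {s : ℝ}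
    (hs : γ t = x + s • z) (htr : inner ℝ (perp z) v ≠ 0) : ChangesAt Ω x z s := by
  obtain ⟨-, hopen, hloc⟩ := hΩ
  obtain ⟨U, ρ, hU, hpU, hρ, hd, hset⟩ := hloc (γ t) hfr.self_of_nhds
  have hρd : HasFDerivAt ρ (fderiv ℝ ρ (γ t)) (γ t) :=
    ((hρ.contDiffAt (hU.mem_nhds hpU)).differentiableAt (by simp)).hasFDerivAt
  have hlev : ∀ᶠ τ in 𝓝 t, ρ (γ τ) = 0 := by
    filter_upwards [hfr, hγ.continuousAt.eventually (hU.mem_nhds hpU)] with τ h1 h2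
    exact frontier_level hopen hU hρ.continuousOn hset h1 h2
  have hv : fderiv ℝ ρ (γ t) v = 0 := by
    have h1 : HasDerivAt (ρ ∘ γ) (fderiv ℝ ρ (γ t) v) t := hρd.comp_hasDerivAt t hγ
    have h2 : HasDerivAt (ρ ∘ γ) 0 t :=
      (hasDerivAt_const t (0 : ℝ)).congr_of_eventuallyEq hlev
    exact h1.unique h2
  have hz : fderiv ℝ ρ (γ t) z ≠ 0 := by
    intro hz
    apply hd
    ext y
    -- Cramer's rule for `y` in the basis `z`, `v`, cleared of the determinant.
    have key : (inner ℝ (perp z) v : ℝ) • y = (inner ℝ (perp y) v : ℝ) • z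
        + (inner ℝ (perp z) y : ℝ) • v := by
      simp only [inner_perp]
      ext i; fin_cases i <;> simp <;> ring
    have := congrArg (fderiv ℝ ρ (γ t)) key
    rw [map_smul, map_add, map_smul, map_smul, hz, hv] at this
    simp only [smul_eq_mul, mul_zero, add_zero, mul_eq_zero] at this
    simpa using this.resolve_left htr
  have hline : HasDerivAt (fun τ : ℝ => x + τ • z) z s := by
    simpa using ((hasDerivAt_id s).smul_const z).const_add x
  have hg : HasDerivAt (fun τ : ℝ => ρ (x + τ • z)) (fderiv ℝ ρ (γ t) z) s := by
    have : HasFDerivAt ρ (fderiv ℝ ρ (γ t)) (x + s • z) := hs ▸ hρd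
    exact this.comp_hasDerivAt s hline
  refine changesAt_of_sign hg ?_ hz ?_
  · rw [← hs]; exact hlev.self_of_nhds
  · have : ∀ᶠ τ in 𝓝 s, x + τ • z ∈ U :=
      hline.continuousAt.eventually (hU.mem_nhds (by rw [hs] at hpU; exact hpU))
    filter_upwards [this] with τ hτ
    constructor
    · intro h
      have : x + τ • z ∈ Ω ∩ U := ⟨h, hτ⟩
      rw [hset] at this; exact this.2
    · intro h
      have : x + τ • z ∈ Ω ∩ U := by rw [hset]; exact ⟨hτ, h⟩
      exact this.1

/-- On a sufficiently fine grid every point of change forces a flip in a grid cell of its own. Since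
the point may lie on the grid, two consecutive cells are inspected. -/
lemma eventually_card_le_flips {Ω : Set Plane} {x z : Plane} (T : Finset ℝ)
    (hT : ∀ s ∈ T, s ∈ Ioo (0 : ℝ) 1 ∧ ChangesAt Ω x z s) :
    ∀ᶠ k : ℕ in atTop, T.card ≤ flips Ω (k + 1) x z := by
  have h1 : ∀ᶠ ε in 𝓝[>] (0 : ℝ), 0 < ε ∧ (∀ s ∈ T, ε < s ∧ s + ε < 1 ∧ (∀ ε₁ ∈ Ioo 0 ε, ∀ ε₂ ∈ Ioo 0 ε,
      ¬ (x + (s - ε₁) • z ∈ Ω ↔ x + (s + ε₂) • z ∈ Ω)) ∧ ∀ s' ∈ T, s ≠ s' → 2 * ε < |s - s'|) := by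
    refine eventually_mem_nhdsWithin.and ((Finset.eventually_all T).2 fun s hs => ?_)
    have hs' := hT s hs
    have e1 : ∀ᶠ ε in 𝓝[>] (0 : ℝ), ε < s := by
      filter_upwards [Ioo_mem_nhdsGT hs'.1.1] with ε hε using hε.2
    have e2 : ∀ᶠ ε in 𝓝[>] (0 : ℝ), s + ε < 1 := by
      filter_upwards [Ioo_mem_nhdsGT (sub_pos.2 hs'.1.2)] with ε hε using by linarith [hε.2]
    refine e1.and (e2.and (hs'.2.and ((Finset.eventually_all T).2 fun s' _ => ?_)))
    by_cases hne : s = s'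
    · simp [hne]
    · have : 0 < |s - s'| / 2 := by have := abs_pos.2 (sub_ne_zero.2 hne); positivity
      filter_upwards [Ioo_mem_nhdsGT this] with ε hε _ using by linarith [hε.2]
  obtain ⟨ε, hε, hall⟩ := h1.exists
  have hK : ∀ᶠ k : ℕ in atTop, 2 / ε < ((k + 1 : ℕ) : ℝ) :=
    ((tendsto_natCast_atTop_atTop (R := ℝ)).comp (tendsto_add_atTop_nat 1)).eventually_gt_atTop _
  filter_upwards [hK] with k hk
  set K : ℝ := ((k + 1 : ℕ) : ℝ) with hKdef
  have hKpos : 0 < K := by positivity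
  have hK2 : 2 / K < ε := by rw [div_lt_iff₀ hKpos]; rw [div_lt_iff₀ hε] at hk; linarith
  have hidx : ∀ s ∈ T, ∃ j : ℕ, j < k + 1 ∧ |(j : ℝ) / K - s| < ε ∧
      chg Ω (x + ((j : ℝ) / K) • z) (x + (((j + 1 : ℕ) : ℝ) / K) • z) = 1 := by
    intro s hs
    obtain ⟨hs1, hs2, hs3, -⟩ := hall s hs
    have hsK : 0 < s * K := mul_pos (hε.trans hs1) hKpos
    -- Here `a / K < s ≤ (a + 1) / K`, so `a / K` and `(a + 2) / K` lie strictly on opposite sides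
    -- of `s`, closer than `ε`. Membership differs there, and one of the cells `a`, `a + 1` contains
    -- a flip.
    obtain ⟨a, ha⟩ : ∃ a : ℕ, ⌈s * K⌉₊ = a + 1 :=
      Nat.exists_eq_succ_of_ne_zero (Nat.ceil_pos.2 hsK).ne'
    have ha1 : s * K ≤ a + 1 := by have := Nat.le_ceil (s * K); rw [ha] at this; exact_mod_cast this
    have ha2 : (a : ℝ) < s * K := by
      have := Nat.ceil_lt_add_one hsK.le; rw [ha] at this; push_cast at this; linarith
    have b1 : (a : ℝ) / K < s := by rwa [div_lt_iff₀ hKpos]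
    have b2 : s ≤ (a : ℝ) / K + 1 / K := by rw [← add_div, le_div_iff₀ hKpos]; exact ha1
    have b3 : 2 / K = 1 / K + 1 / K := by ring
    have b0 : 0 < 1 / K := by positivity
    have c1 : (((a + 1 : ℕ) : ℝ)) / K = (a : ℝ) / K + 1 / K := by push_cast; ring
    have c2 : (((a + 1 + 1 : ℕ) : ℝ)) / K = (a : ℝ) / K + 2 / K := by push_cast; ring
    have hflip := hs3 (s - a / K) ⟨by linarith, by linarith⟩ (a / K + 2 / K - s)
      ⟨by linarith, by linarith⟩
    rw [sub_sub_cancel, add_sub_cancel] at hflip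
    have hlt : a + 1 < k + 1 := by
      have : (((a + 1 + 1 : ℕ) : ℝ)) / K < 1 := by rw [c2]; linarith
      rw [div_lt_one hKpos, hKdef] at this
      have : a + 1 + 1 < k + 1 := by exact_mod_cast this
      omega
    by_cases hc : chg Ω (x + ((a : ℝ) / K) • z) (x + (((a + 1 : ℕ) : ℝ) / K) • z) = 1
    · exact ⟨a, by omega, by rw [abs_lt]; constructor <;> linarith, hc⟩
    · refine ⟨a + 1, hlt, ?_, ?_⟩
      · rw [c1, abs_lt]; constructor <;> linarith
      · unfold chg at hc ⊢
        rw [c2]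
        have hiff : x + ((a : ℝ) / K) • z ∈ Ω ↔ x + (((a + 1 : ℕ) : ℝ) / K) • z ∈ Ω := by
          by_contra h; exact hc (if_neg h)
        rw [if_neg]
        rw [← hiff]; exact hflip
  choose! j hj1 hj2 hj3 using hidx
  -- Points of `T` are more than `2 * ε` apart while every selected grid point is within `ε` of its
  -- own, so no cell serves twice.
  have hinj : Set.InjOn j T := by
    intro s hs s' hs' heq
    by_contra hne
    have h4 := (hall s hs).2.2.2 s' hs' hne
    have a1 := hj2 s hs
    have a2 := hj2 s' hs'
    rw [heq] at a1
    rw [abs_lt] at a1 a2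
    rcases abs_cases (s - s') with ⟨h, _⟩ | ⟨h, _⟩ <;> rw [h] at h4 <;> linarith [a1.1, a1.2, a2.1, a2.2]
  rw [← Finset.card_image_of_injOn hinj, Finset.card_eq_sum_ones]
  unfold flips
  calc ∑ i ∈ T.image j, 1 ≤ ∑ i ∈ T.image j,
        chg Ω (x + ((i : ℝ) / K) • z) (x + (((i + 1 : ℕ) : ℝ) / K) • z) := by
        refine Finset.sum_le_sum fun i hi => ?_
        obtain ⟨s, hs, rfl⟩ := Finset.mem_image.1 hi
        rw [hj3 s hs]
    _ ≤ _ := by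
        refine Finset.sum_le_sum_of_subset fun i hi => ?_
        obtain ⟨s, hs, rfl⟩ := Finset.mem_image.1 hi
        exact Finset.mem_range.2 (hj1 s hs)

/-- The finite subsets are directed under union and `g` is monotone, so the sum of the suprema is a
supremum over simultaneous choices. -/
lemma sum_iSup_finset_le {ι : Type*} [Fintype ι] (S : ι → Set ℝ) (g : ℕ → ENNReal)
    (hg : Monotone g) {B : ENNReal}
    (h : ∀ F : ι → Finset ℝ, (∀ i, ↑(F i) ⊆ S i) → ∑ i, g (F i).card ≤ B) :
    ∑ i, (⨆ F : {F : Finset ℝ // ↑F ⊆ S i}, g F.1.card) ≤ B := by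
  have h1 : ∀ i, (⨆ F : {F : Finset ℝ // ↑F ⊆ S i}, g F.1.card) ≤
      ⨆ F : (∀ i, {F : Finset ℝ // ↑F ⊆ S i}), g (F i).1.card := by
    intro i
    refine iSup_le fun F => ?_
    classical
    let F' : ∀ i, {F : Finset ℝ // ↑F ⊆ S i} := Function.update (fun _ => ⟨∅, by simp⟩) i F
    have : g F.1.card = g (F' i).1.card := by simp [F']
    rw [this]
    exact le_iSup (fun F : (∀ i, {F : Finset ℝ // ↑F ⊆ S i}) => g (F i).1.card) F'
  refine (Finset.sum_le_sum fun i _ => h1 i).trans ?_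
  rw [ENNReal.finsetSum_iSup]
  · exact iSup_le fun F => h (fun i => (F i).1) fun i => (F i).2
  · intro F F'
    classical
    refine ⟨fun i => ⟨(F i).1 ∪ (F' i).1, ?_⟩, fun i => ⟨hg ?_, hg ?_⟩⟩
    · simpa using ⟨(F i).2, (F' i).2⟩
    · exact Finset.card_le_card Finset.subset_union_left
    · exact Finset.card_le_card Finset.subset_union_right

/-- A finite family of non-overlapping arcs of the curves of a boundary decomposition. -/
structure ArcFamily {N : ℕ} (ι : Type*) (q : ι → Fin N) (a b : ι → ℝ) : Prop where
  nonneg : ∀ i, 0 ≤ a i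
  le_one : ∀ i, b i ≤ 1
  disj : ∀ i j, i ≠ j → q i = q j → Disjoint (Ioo (a i) (b i)) (Ioo (a j) (b j))

/-- The curves are simple and pairwise disjoint and the arcs do not overlap. Different crossing
times therefore give different parameters on the segment, and all can be counted together. -/
lemma eventually_sum_card_le_flips {Ω : Set Plane} (hΩ : IsRegularSet Ω) {N : ℕ}
    {c : Fin N → ℝ → Plane} (hc : IsBoundaryDecomposition Ω c) {ι : Type*} [Fintype ι]
    {q : ι → Fin N} {a b : ι → ℝ} (hA : ArcFamily ι q a b) (x z : Plane) (F : ι → Finset ℝ)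
    (hF : ∀ i, ↑(F i) ⊆ crossTimes (c (q i)) (a i) (b i) x z) :
    ∀ᶠ k : ℕ in atTop, ∑ i, (F i).card ≤ flips Ω (k + 1) x z := by
  have hs : ∀ p : (_ : ι) × ℝ, p ∈ Finset.univ.sigma F →
      ∃ s ∈ Ioo (0 : ℝ) 1, c (q p.1) p.2 = x + s • z := by
    intro p hp
    exact (hF p.1 (Finset.mem_sigma.1 hp).2).2.1
  choose! s hs1 hs2 using hs
  have hinj : Set.InjOn s (Finset.univ.sigma F : Finset ((_ : ι) × ℝ)) := by
    rintro ⟨i, t⟩ hp ⟨j, t'⟩ hp' heq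
    have e1 := hs2 _ hp
    have e2 := hs2 _ hp'
    rw [heq, ← e2] at e1
    dsimp only at e1
    have ht := (hF i (Finset.mem_sigma.1 hp).2).1
    have ht' := (hF j (Finset.mem_sigma.1 hp').2).1
    dsimp only at ht ht'
    have r1 : t ∈ Ico (0 : ℝ) 1 := ⟨(hA.nonneg i).trans ht.1.le, ht.2.trans_le (hA.le_one i)⟩
    have r2 : t' ∈ Ico (0 : ℝ) 1 := ⟨(hA.nonneg j).trans ht'.1.le, ht'.2.trans_le (hA.le_one j)⟩
    have hq : q i = q j := by
      by_contra hne
      exact (Set.disjoint_left.1 (hc.2.1 hne)) ⟨t, ⟨r1.1, r1.2.le⟩, rfl⟩ ⟨t', ⟨r2.1, r2.2.le⟩, e1.symm⟩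
    have htt : t = t' := by
      rw [hq] at e1
      exact (hc.1 (q j)).2.2.1 r1 r2 e1
    subst htt
    have hij : i = j := by
      by_contra hne
      exact Set.disjoint_left.1 (hA.disj i j hne hq) ht ht'
    subst hij; rfl
  have hcard : ∑ i, (F i).card = ((Finset.univ.sigma F).image s).card := by
    rw [Finset.card_image_of_injOn hinj, Finset.card_sigma]
  rw [hcard]
  refine eventually_card_le_flips _ fun σ hσ => ?_
  obtain ⟨⟨i, t⟩, hp, rfl⟩ := Finset.mem_image.1 hσ
  refine ⟨hs1 _ hp, ?_⟩
  have ht := hF i (Finset.mem_sigma.1 hp).2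
  have hsm := (hc.1 (q i)).1
  refine changesAt_of_cross hΩ (hsm.differentiable (by simp) t).hasDerivAt
    (Eventually.of_forall fun τ => ?_) (hs2 _ hp) ht.2.2
  rw [← hc.2.2]
  obtain ⟨y, hy, hyτ⟩ := (hc.1 (q i)).2.1.exists_mem_Ico₀ one_pos τ
  exact mem_iUnion.2 ⟨q i, y, ⟨hy.1, hy.2.le⟩, hyτ.symm⟩

lemma sum_fullCount_le {Ω : Set Plane} (hΩ : IsRegularSet Ω) {N : ℕ}
    {c : Fin N → ℝ → Plane} (hc : IsBoundaryDecomposition Ω c) {ι : Type*} [Fintype ι]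
    {q : ι → Fin N} {a b : ι → ℝ} (hA : ArcFamily ι q a b) (x z : Plane) :
    ∑ i, fullCount (crossTimes (c (q i)) (a i) (b i) x z) ≤ crossCount Ω x z := by
  refine sum_iSup_finset_le _ (fun n => (n : ENNReal)) Nat.mono_cast fun F hF => ?_
  refine le_liminf_of_le (by isBoundedDefault) ?_
  filter_upwards [eventually_sum_card_le_flips hΩ hc hA x z F hF] with k hk
  exact_mod_cast hk

lemma sum_halfCount_le {Ω : Set Plane} (hΩ : IsRegularSet Ω) {N : ℕ}
    {c : Fin N → ℝ → Plane} (hc : IsBoundaryDecomposition Ω c) {ι : Type*} [Fintype ι]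
    {q : ι → Fin N} {a b : ι → ℝ} (hA : ArcFamily ι q a b) (x z : Plane) :
    ∑ i, halfCount (crossTimes (c (q i)) (a i) (b i) x z) ≤ defect Ω x z := by
  refine sum_iSup_finset_le _ (fun n => ((n / 2 : ℕ) : ENNReal))
    (fun m n hmn => Nat.cast_le.2 (Nat.div_le_div_right hmn)) fun F hF => ?_
  refine le_liminf_of_le (by isBoundedDefault) ?_
  filter_upwards [eventually_sum_card_le_flips hΩ hc hA x z F hF] with k hk
  -- Rounding down is superadditive: pairs formed on separate arcs are pairs on the whole boundary.
  have h1 : ∀ s : Finset ι, ∑ i ∈ s, (F i).card / 2 ≤ (∑ i ∈ s, (F i).card) / 2 := by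
    classical
    intro s
    induction s using Finset.induction_on with
    | empty => simp
    | insert i s his ih => rw [Finset.sum_insert his, Finset.sum_insert his]; omega
  exact_mod_cast (h1 _).trans (Nat.div_le_div_right hk)

/-! ### Level sets of functions of one variable -/

/-- The transversal preimages of `η` under `w` in the interval `(a, b)`. -/
def levelTimes (w : ℝ → ℝ) (a b η : ℝ) : Set ℝ := {t | t ∈ Ioo a b ∧ w t = η ∧ deriv w t ≠ 0}

open Classical in
/-- The number of the first `m` intervals between consecutive terms of `p` that contain `η`. -/
def straddle (p : ℕ → ℝ) (m : ℕ) (η : ℝ) : ℕ :=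
  ∑ j ∈ Finset.range m, if η ∈ uIoo (p j) (p (j + 1)) then 1 else 0

-- The parity argument again, now for the position of `p j` relative to `η`. Values equal to `η`
-- must be excluded because the intervals are open.
open Classical in
lemma straddle_mod_two (p : ℕ → ℝ) (m : ℕ) (η : ℝ) (hη : ∀ j, p j ≠ η) :
    straddle p m η % 2 = if η ∈ uIoo (p 0) (p m) then 1 else 0 := by
  unfold straddle
  induction m with
  | zero => simp
  | succ m ih =>
    rw [Finset.sum_range_succ, Nat.add_mod, ih]
    have h0 := hη 0
    have h1 := hη m
    have h2 := hη (m + 1)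
    have key : ∀ a b : ℝ, a ≠ η → b ≠ η → (η ∈ uIoo a b ↔ ¬ (a < η ↔ b < η)) := by
      intro a b ha hb
      rcases lt_or_gt_of_ne ha with ha | ha <;> rcases lt_or_gt_of_ne hb with hb | hb <;>
        simp only [uIoo, mem_Ioo, inf_lt_iff, lt_sup_iff] <;>
        simp [ha, hb, ha.not_gt, hb.not_gt]
    simp only [key _ _ h0 h1, key _ _ h1 h2, key _ _ h0 h2]
    by_cases a0 : p 0 < η <;> by_cases a1 : p m < η <;> by_cases a2 : p (m + 1) < η <;>
      simp [a0, a1, a2]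

lemma measurableSet_uIoo {a b : ℝ} : MeasurableSet (uIoo a b) := measurableSet_Ioo

open Classical in
lemma lintegral_ite_uIoo (a b : ℝ) :
    ∫⁻ η, (((if η ∈ uIoo a b then 1 else 0 : ℕ)) : ENNReal) = ENNReal.ofReal |b - a| := by
  have : (fun η => (((if η ∈ uIoo a b then 1 else 0 : ℕ)) : ENNReal)) =
      (uIoo a b).indicator 1 := by
    ext η; simp [indicator]
  rw [this, lintegral_indicator_one measurableSet_uIoo]
  simp only [uIoo, Real.volume_Ioo]
  rw [max_sub_min_eq_abs]

lemma lintegral_straddle (p : ℕ → ℝ) (m : ℕ) :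
    ∫⁻ η, (straddle p m η : ENNReal) = ENNReal.ofReal (∑ j ∈ Finset.range m, |p (j + 1) - p j|) := by
  unfold straddle
  simp only [Nat.cast_sum]
  rw [lintegral_finsetSum, ENNReal.ofReal_sum_of_nonneg (fun _ _ => abs_nonneg _)]
  · exact Finset.sum_congr rfl fun j _ => lintegral_ite_uIoo _ _
  · intro j _
    exact measurable_natCast_comp (Measurable.ite measurableSet_uIoo measurable_const measurable_const)

/-- Sard's theorem in dimension one. It makes almost every level transversal, as the counted
crossings have to be. -/
lemma ae_regular_value {w : ℝ → ℝ} (hw : Differentiable ℝ w) :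
    ∀ᵐ η : ℝ, ∀ t, w t = η → deriv w t ≠ 0 := by
  have h := addHaar_image_eq_zero_of_det_fderivWithin_eq_zero (volume : Measure ℝ)
    (s := {t | deriv w t = 0}) (f := w) (f' := fun t => fderiv ℝ w t)
    (fun t _ => (hw t).hasFDerivAt.hasFDerivWithinAt) (fun t ht => by
      have : fderiv ℝ w t = ContinuousLinearMap.toSpanSingleton ℝ (deriv w t) := by
        ext; simp
      rw [this, show deriv w t = 0 from ht]
      simp)
  filter_upwards [measure_eq_zero_iff_ae_notMem.1 h] with η hη t ht hd
  exact hη ⟨t, hd, ht⟩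

/-- The intermediate value theorem gives a preimage inside each partition interval whose end values
straddle `η`; these open intervals are disjoint, so the preimages are distinct. -/
lemma exists_finset_levelTimes {w : ℝ → ℝ} (hw : Continuous w) {s : ℕ → ℝ} (hs : Monotone s)
    (m : ℕ) {η : ℝ} (hη : ∀ t, w t = η → deriv w t ≠ 0) :
    ∃ F : Finset ℝ, ↑F ⊆ levelTimes w (s 0) (s m) η ∧
      F.card = straddle (fun j => w (s j)) m η := by
  classical
  have h1 : ∀ j, η ∈ uIoo (w (s j)) (w (s (j + 1))) → ∃ t ∈ Ioo (s j) (s (j + 1)), w t = η := by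
    intro j hj
    have hle := hs (Nat.le_succ j)
    rcases le_total (w (s j)) (w (s (j + 1))) with hc | hc
    · rw [uIoo_of_le hc] at hj
      exact intermediate_value_Ioo hle hw.continuousOn hj
    · rw [uIoo_of_ge hc] at hj
      exact intermediate_value_Ioo' hle hw.continuousOn hj
  choose! t ht1 ht2 using h1
  set J := (Finset.range m).filter (fun j => η ∈ uIoo (w (s j)) (w (s (j + 1)))) with hJ
  refine ⟨J.image t, ?_, ?_⟩
  · intro x hx
    simp only [Finset.coe_image, mem_image, Finset.mem_coe] at hx
    obtain ⟨j, hj, rfl⟩ := hx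
    rw [hJ, Finset.mem_filter, Finset.mem_range] at hj
    have := ht1 j hj.2
    exact ⟨⟨(hs (Nat.zero_le j)).trans_lt this.1, this.2.trans_le (hs hj.1)⟩, ht2 j hj.2,
      hη _ (ht2 j hj.2)⟩
  · rw [Finset.card_image_of_injOn]
    · rw [hJ, Finset.card_filter]; rfl
    · intro i hi j hj hij
      rw [hJ, Finset.mem_coe, Finset.mem_filter] at hi hj
      have a1 := ht1 i hi.2
      have a2 := ht1 j hj.2
      rw [hij] at a1
      by_contra hne
      rcases lt_or_gt_of_ne hne with h | h
      · exact absurd (a1.2.trans_le (hs h)) (not_lt.2 a2.1.le)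
      · exact absurd (a2.2.trans_le (hs h)) (not_lt.2 a1.1.le)

lemma sum_abs_le_lintegral_fullCount {w : ℝ → ℝ} (hw : Differentiable ℝ w) {s : ℕ → ℝ}
    (hs : Monotone s) (m : ℕ) :
    ENNReal.ofReal (∑ j ∈ Finset.range m, |w (s (j + 1)) - w (s j)|) ≤
      ∫⁻ η, fullCount (levelTimes w (s 0) (s m) η) := by
  rw [← lintegral_straddle (fun j => w (s j))]
  refine lintegral_mono_ae ?_
  filter_upwards [ae_regular_value hw] with η hη
  obtain ⟨F, hF, hcard⟩ := exists_finset_levelTimes hw.continuous hs m hη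
  rw [← hcard]
  exact le_iSup (fun F : {F : Finset ℝ // ↑F ⊆ levelTimes w (s 0) (s m) η} =>
    (F.1.card : ENNReal)) ⟨F, hF⟩

-- By parity the number of straddling intervals is the indicator of the interval between the end
-- values plus twice the number of pairs; integrate this over `η`.
open Classical in
lemma sum_abs_le_lintegral_halfCount {w : ℝ → ℝ} (hw : Differentiable ℝ w) {s : ℕ → ℝ}
    (hs : Monotone s) (m : ℕ) :
    ENNReal.ofReal (∑ j ∈ Finset.range m, |w (s (j + 1)) - w (s j)|) ≤
      ENNReal.ofReal |w (s m) - w (s 0)| +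
        2 * ∫⁻ η, halfCount (levelTimes w (s 0) (s m) η) := by
  have hmeas : Measurable fun η : ℝ =>
      (((if η ∈ uIoo (w (s 0)) (w (s m)) then 1 else 0 : ℕ)) : ENNReal) :=
    measurable_natCast_comp (Measurable.ite measurableSet_uIoo measurable_const measurable_const)
  rw [← lintegral_straddle (fun j => w (s j)), ← lintegral_ite_uIoo,
    ← lintegral_const_mul' _ _ (by simp), ← lintegral_add_left hmeas]
  refine lintegral_mono_ae ?_
  have hae : ∀ᵐ η : ℝ, ∀ j, w (s j) ≠ η := by
    rw [ae_all_iff]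
    intro j
    filter_upwards [(measure_eq_zero_iff_ae_notMem.1 (measure_singleton (μ := volume) (w (s j))))]
      with η hη h
    exact hη h.symm
  filter_upwards [ae_regular_value hw, hae] with η hη hne
  obtain ⟨F, hF, hcard⟩ := exists_finset_levelTimes hw.continuous hs m hη
  have h1 := straddle_mod_two (fun j => w (s j)) m η hne
  have h2 : ((F.card / 2 : ℕ) : ENNReal) ≤ halfCount (levelTimes w (s 0) (s m) η) :=
    le_iSup (fun F : {F : Finset ℝ // ↑F ⊆ levelTimes w (s 0) (s m) η} =>
      ((F.1.card / 2 : ℕ) : ENNReal)) ⟨F, hF⟩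
  have h3 : straddle (fun j => w (s j)) m η =
      (if η ∈ uIoo (w (s 0)) (w (s m)) then 1 else 0) + 2 * (F.card / 2) := by
    rw [hcard, ← h1]; omega
  calc (straddle (fun j => w (s j)) m η : ENNReal)
      = ((if η ∈ uIoo (w (s 0)) (w (s m)) then 1 else 0 : ℕ) : ENNReal)
        + 2 * ((F.card / 2 : ℕ) : ENNReal) := by rw [h3]; push_cast; rfl
    _ ≤ _ := by gcongr

lemma exists_partition_integral_abs_le {w : ℝ → ℝ} (hw : ContDiff ℝ 1 w) {a b : ℝ} (hab : a ≤ b)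
    {ε : ℝ} (hε : 0 < ε) : ∃ (s : ℕ → ℝ) (m : ℕ), Monotone s ∧ s 0 = a ∧ s m = b ∧
      ∫ t in a..b, |deriv w t| ≤ ∑ j ∈ Finset.range m, |w (s (j + 1)) - w (s j)| + ε := by
  have hdc : Continuous (deriv w) := hw.continuous_deriv le_rfl
  have hdiff : Differentiable ℝ w := hw.differentiable one_ne_zero
  -- Each cell of width `h` will cost `2 * ε' * h`, hence `2 * ε' * (b - a)` in total. The `+ 1` in
  -- the witness covers `a = b`.
  obtain ⟨ε', hε', hεε⟩ : ∃ ε' > 0, 2 * ε' * (b - a) ≤ ε :=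
    ⟨ε / (2 * (b - a) + 1), by have := sub_nonneg.2 hab; positivity, by
      have := sub_nonneg.2 hab
      rw [mul_assoc, mul_comm, mul_assoc, div_mul_eq_mul_div, div_le_iff₀ (by positivity)]
      nlinarith⟩
  have huc := (isCompact_Icc (a := a) (b := b)).uniformContinuousOn_of_continuous hdc.continuousOn
  rw [Metric.uniformContinuousOn_iff] at huc
  obtain ⟨d, hd, hdd⟩ := huc ε' hε'
  obtain ⟨m, hm⟩ := exists_nat_gt ((b - a) / d)
  have hm0 : (0 : ℝ) < m := lt_of_le_of_lt (div_nonneg (sub_nonneg.2 hab) hd.le) hm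
  set h : ℝ := (b - a) / m with hh
  have hh0 : 0 ≤ h := div_nonneg (sub_nonneg.2 hab) hm0.le
  have hhd : h < d := by rw [hh, div_lt_iff₀ hm0]; rw [div_lt_iff₀ hd] at hm; linarith
  have hmh : (m : ℝ) * h = b - a := by rw [hh]; field_simp
  set s : ℕ → ℝ := fun j => a + j * h with hs
  have hmono : Monotone s := fun i j hij => by
    simp only [hs]; gcongr
  refine ⟨s, m, hmono, by simp [hs], by simp only [hs]; linarith, ?_⟩
  have hsm : s m = b := by simp only [hs]; linarith
  have hs0 : s 0 = a := by simp [hs]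
  have hInt : ∀ x y : ℝ, IntervalIntegrable (fun t => |deriv w t|) volume x y :=
    fun x y => (hdc.abs).intervalIntegrable x y
  have hsum : ∑ j ∈ Finset.range m, ∫ t in s j..s (j + 1), |deriv w t| = ∫ t in a..b, |deriv w t| := by
    rw [intervalIntegral.sum_integral_adjacent_intervals fun k _ => hInt _ _, hs0, hsm]
  rw [← hsum]
  have hpiece : ∀ j ∈ Finset.range m, ∫ t in s j..s (j + 1), |deriv w t| ≤
      |w (s (j + 1)) - w (s j)| + 2 * ε' * h := by
    intro j hj
    have hj1 : s (j + 1) - s j = h := by simp only [hs]; push_cast; ring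
    have hle : s j ≤ s (j + 1) := hmono (Nat.le_succ j)
    have hclose : ∀ t ∈ Icc (s j) (s (j + 1)), |deriv w t - deriv w (s j)| ≤ ε' := by
      intro t ht
      have e1 : a ≤ s j := hs0 ▸ hmono (Nat.zero_le j)
      have e2 : s (j + 1) ≤ b := hsm ▸ hmono (Finset.mem_range.1 hj)
      refine (hdd t ⟨e1.trans ht.1, ht.2.trans e2⟩ (s j) ⟨e1, hle.trans e2⟩ ?_).le
      rw [Real.dist_eq, abs_of_nonneg (by linarith [ht.1])]
      linarith [ht.2]
    have hA : ∫ t in s j..s (j + 1), |deriv w t| ≤ (|deriv w (s j)| + ε') * h := by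
      have : ∫ t in s j..s (j + 1), |deriv w t| ≤ ∫ _t in s j..s (j + 1), (|deriv w (s j)| + ε') := by
        refine intervalIntegral.integral_mono_on hle (hInt _ _) (by simp) fun t ht => ?_
        have := hclose t ht
        have h2 := abs_sub_abs_le_abs_sub (deriv w t) (deriv w (s j))
        linarith
      rw [intervalIntegral.integral_const, hj1, smul_eq_mul] at this
      linarith
    have hB : |deriv w (s j)| * h - ε' * h ≤ |w (s (j + 1)) - w (s j)| := by
      have e : w (s (j + 1)) - w (s j) = ∫ t in s j..s (j + 1), deriv w t :=
        (intervalIntegral.integral_deriv_eq_sub (fun t _ => hdiff t) (hdc.intervalIntegrable _ _)).symm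
      have e2 : ∫ t in s j..s (j + 1), (deriv w t - deriv w (s j)) =
          (w (s (j + 1)) - w (s j)) - h * deriv w (s j) := by
        rw [intervalIntegral.integral_sub (hdc.intervalIntegrable _ _) (by simp), ← e,
          intervalIntegral.integral_const, hj1, smul_eq_mul]
      have e3 : |∫ t in s j..s (j + 1), (deriv w t - deriv w (s j))| ≤ ε' * |s (j + 1) - s j| := by
        rw [← Real.norm_eq_abs]
        refine intervalIntegral.norm_integral_le_of_norm_le_const fun t ht => ?_
        rw [uIoc_of_le hle] at ht
        exact hclose t ⟨ht.1.le, ht.2⟩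
      rw [e2, hj1, abs_of_nonneg hh0] at e3
      have e4 := abs_sub_abs_le_abs_sub (h * deriv w (s j)) (w (s (j + 1)) - w (s j))
      rw [abs_mul, abs_of_nonneg hh0, abs_sub_comm (h * deriv w (s j))] at e4
      linarith
    nlinarith
  calc ∑ j ∈ Finset.range m, ∫ t in s j..s (j + 1), |deriv w t|
      ≤ ∑ j ∈ Finset.range m, (|w (s (j + 1)) - w (s j)| + 2 * ε' * h) := Finset.sum_le_sum hpiece
    _ = ∑ j ∈ Finset.range m, |w (s (j + 1)) - w (s j)| + 2 * ε' * (b - a) := by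
        rw [Finset.sum_add_distrib, Finset.sum_const, Finset.card_range, nsmul_eq_mul, ← hmh]; ring
    _ ≤ _ := by linarith

/-- The integral of the number of preimages is at least the total variation. -/
lemma le_lintegral_fullCount {w : ℝ → ℝ} (hw : ContDiff ℝ 1 w) {a b : ℝ} (hab : a ≤ b) :
    ENNReal.ofReal (∫ t in a..b, |deriv w t|) ≤ ∫⁻ η, fullCount (levelTimes w a b η) := by
  refine ENNReal.le_of_forall_pos_le_add fun ε hε _ => ?_
  obtain ⟨s, m, hs, h0, hm, h⟩ := exists_partition_integral_abs_le hw hab (ε := ε) (by exact_mod_cast hε)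
  have h1 := sum_abs_le_lintegral_fullCount (hw.differentiable one_ne_zero) hs m
  rw [h0, hm] at h1
  calc _ ≤ ENNReal.ofReal (∑ j ∈ Finset.range m, |w (s (j + 1)) - w (s j)| + ε) :=
        ENNReal.ofReal_le_ofReal h
    _ ≤ _ := by
        rw [ENNReal.ofReal_add (Finset.sum_nonneg fun _ _ => abs_nonneg _) (by positivity)]
        simp only [ENNReal.ofReal_coe_nnreal]
        gcongr

/-- The integral of the number of pairs of preimages is at least half the difference of the total
variation and the net variation. -/
lemma le_lintegral_halfCount {w : ℝ → ℝ} (hw : ContDiff ℝ 1 w) {a b : ℝ} (hab : a ≤ b) :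
    ENNReal.ofReal ((∫ t in a..b, |deriv w t|) - |w b - w a|) ≤
      2 * ∫⁻ η, halfCount (levelTimes w a b η) := by
  refine ENNReal.le_of_forall_pos_le_add fun ε hε _ => ?_
  obtain ⟨s, m, hs, h0, hm, h⟩ := exists_partition_integral_abs_le hw hab (ε := ε) (by exact_mod_cast hε)
  have h1 := sum_abs_le_lintegral_halfCount (hw.differentiable one_ne_zero) hs m
  rw [h0, hm] at h1
  rw [ENNReal.ofReal_sub _ (abs_nonneg _), tsub_le_iff_left]
  calc _ ≤ ENNReal.ofReal (∑ j ∈ Finset.range m, |w (s (j + 1)) - w (s j)| + ε) :=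
        ENNReal.ofReal_le_ofReal h
    _ ≤ _ := by
        rw [ENNReal.ofReal_add (Finset.sum_nonneg fun _ _ => abs_nonneg _) (by positivity),
          ← add_assoc]
        simp only [ENNReal.ofReal_coe_nnreal]
        gcongr

/-! ### Rotated coordinates and averages over directions -/

/-- The unit normal to `dir φ`. -/
def nrm (φ : ℝ) : Plane := perp (dir φ)

lemma inner_dir (v : Plane) (φ : ℝ) : inner ℝ v (dir φ) = v 0 * Real.cos φ + v 1 * Real.sin φ := by
  simp [dir, PiLp.inner_apply, Fin.sum_univ_two]; ring

lemma inner_nrm (v : Plane) (φ : ℝ) : inner ℝ v (nrm φ) = v 1 * Real.cos φ - v 0 * Real.sin φ := by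
  simp [nrm, perp, dir, PiLp.inner_apply, Fin.sum_univ_two]; ring

lemma continuous_nrm : Continuous nrm := by
  unfold nrm perp dir; fun_prop

lemma norm_nrm (φ : ℝ) : ‖nrm φ‖ = 1 := by
  rw [EuclideanSpace.norm_eq]; simp [nrm, perp, dir]

/-- The identification of `ℝ × ℝ` with the plane. -/
def pairPlane (p : ℝ × ℝ) : Plane := !₂[p.1, p.2]

lemma measurePreserving_pairPlane : MeasurePreserving pairPlane := by
  have h1 := (volume_preserving_finTwoArrow ℝ).symm
  have h2 := PiLp.volume_preserving_toLp (Fin 2)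
  have h3 : pairPlane = WithLp.toLp 2 ∘ ⇑(MeasurableEquiv.finTwoArrow (α := ℝ)).symm := by
    ext p i; fin_cases i <;> rfl
  rw [h3]
  exact h2.comp h1

lemma measurableEmbedding_pairPlane : MeasurableEmbedding pairPlane := by
  have h1 := (MeasurableEquiv.finTwoArrow (α := ℝ)).symm.measurableEmbedding
  have h2 := (MeasurableEquiv.toLp 2 (Fin 2 → ℝ)).measurableEmbedding
  have h3 : pairPlane = ⇑(MeasurableEquiv.toLp 2 (Fin 2 → ℝ)) ∘
      ⇑(MeasurableEquiv.finTwoArrow (α := ℝ)).symm := by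
    ext p i; fin_cases i <;> rfl
  rw [h3]
  exact h2.comp h1

/-- The rotation that maps the standard frame to `(dir φ, nrm φ)`. -/
def rot (φ : ℝ) : Plane ≃ₗᵢ[ℝ] Plane :=
  LinearIsometry.toLinearIsometryEquiv
    { toFun := fun x => x 0 • dir φ + x 1 • nrm φ
      map_add' := fun x y => by simp only [PiLp.add_apply, add_smul]; abel
      map_smul' := fun c x => by
        simp only [PiLp.smul_apply, smul_eq_mul, mul_smul, smul_add, RingHom.id_apply]
      norm_map' := fun x => by
        simp only [LinearMap.coe_mk, AddHom.coe_mk, EuclideanSpace.norm_eq, Fin.sum_univ_two]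
        congr 1
        simp only [PiLp.add_apply, PiLp.smul_apply, dir, nrm, perp, smul_eq_mul, Real.norm_eq_abs,
          sq_abs]
        simp
        nlinarith [Real.sin_sq_add_cos_sq φ] } rfl

lemma lintegral_rot (φ : ℝ) {f : Plane → ENNReal} (hf : Measurable f) :
    ∫⁻ x, f x = ∫⁻ X : ℝ, ∫⁻ η : ℝ, f (X • dir φ + η • nrm φ) := by
  rw [← (rot φ).measurePreserving.lintegral_comp hf,
    ← measurePreserving_pairPlane.lintegral_comp_emb measurableEmbedding_pairPlane]
  rw [Measure.volume_eq_prod, lintegral_prod]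
  · rfl
  · exact ((hf.comp (rot φ).continuous.measurable).comp
      measurableEmbedding_pairPlane.measurable).aemeasurable

lemma exists_eq_norm_smul_dir (v : Plane) : ∃ β : ℝ, v = ‖v‖ • dir β := by
  refine ⟨Complex.arg ⟨v 0, v 1⟩, ?_⟩
  have hn : ‖(⟨v 0, v 1⟩ : ℂ)‖ = ‖v‖ := by
    rw [EuclideanSpace.norm_eq, Complex.norm_eq_sqrt_sq_add_sq]; simp
  have h := Complex.norm_mul_cos_add_sin_mul_I (⟨v 0, v 1⟩ : ℂ)
  rw [hn] at h
  have h0 := congrArg Complex.re h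
  have h1 := congrArg Complex.im h
  simp [← Complex.ofReal_cos, ← Complex.ofReal_sin] at h0 h1
  ext i; fin_cases i
  · simp [dir, h0]
  · simp [dir, h1]

lemma inner_dir_nrm (β φ : ℝ) : inner ℝ (dir β) (nrm φ) = Real.sin (β - φ) := by
  rw [inner_nrm, Real.sin_sub]; simp [dir]

lemma inner_dir_dir (β φ : ℝ) : inner ℝ (dir β) (dir φ) = Real.cos (β - φ) := by
  rw [inner_dir, Real.cos_sub]; simp [dir]

/-- With `β` the angle of `v` the integrand is `‖v‖ |sin (φ - β)|`, and `|sin|` has integral `2`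
over a period `π`. -/
lemma integral_abs_inner_nrm (v : Plane) (a : ℝ) :
    ∫ φ in a..(a + Real.pi), |(inner ℝ v (nrm φ) : ℝ)| = 2 * ‖v‖ := by
  obtain ⟨β, hβ⟩ := exists_eq_norm_smul_dir v
  have h1 : ∀ φ, |(inner ℝ v (nrm φ) : ℝ)| = ‖v‖ * |Real.sin (φ - β)| := by
    intro φ
    conv_lhs => rw [hβ]
    rw [inner_smul_left, inner_dir_nrm, abs_mul, ← neg_sub, Real.sin_neg, abs_neg]
    simp
  simp_rw [h1]
  rw [intervalIntegral.integral_const_mul,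
    intervalIntegral.integral_comp_sub_right (fun x => |Real.sin x|)]
  have hper : Function.Periodic (fun x => |Real.sin x|) Real.pi := fun x => by simp
  have h2 := hper.intervalIntegral_add_eq (a - β) 0
  rw [show a + Real.pi - β = a - β + Real.pi by ring, h2, zero_add]
  have : ∫ x in (0 : ℝ)..Real.pi, |Real.sin x| = ∫ x in (0 : ℝ)..Real.pi, Real.sin x := by
    refine intervalIntegral.integral_congr fun x hx => ?_
    rw [uIcc_of_le Real.pi_pos.le] at hx
    exact abs_of_nonneg (Real.sin_nonneg_of_nonneg_of_le_pi hx.1 hx.2)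
  rw [this, integral_sin]; simp; ring

lemma integral_integral_abs_inner_nrm {μ : Measure ℝ} [IsFiniteMeasure μ] {u : ℝ → Plane}
    (hu : Measurable u) {C : ℝ} (hC : ∀ t, ‖u t‖ ≤ C) (a : ℝ) :
    ∫ φ in a..(a + Real.pi), ∫ t, |(inner ℝ (u t) (nrm φ) : ℝ)| ∂μ = 2 * ∫ t, ‖u t‖ ∂μ := by
  have : IsFiniteMeasure (volume.restrict (uIoc a (a + Real.pi))) :=
    ⟨by simp [uIoc]⟩
  rw [intervalIntegral_integral_swap]
  · simp_rw [integral_abs_inner_nrm]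
    rw [integral_const_mul]
  · refine Integrable.of_bound (C := C) ?_ (Eventually.of_forall fun p => ?_)
    · have := continuous_nrm.measurable
      refine Measurable.aestronglyMeasurable ?_
      simp only [Function.uncurry_def]
      fun_prop
    · simp only [Function.uncurry_def, Real.norm_eq_abs, abs_abs]
      refine (abs_real_inner_le_norm _ _).trans ?_
      rw [norm_nrm, mul_one]; exact hC _

/-! ### The contribution of an arc -/

/-- The integral over all segments of length `r` of the number of pairs of crossings with an arc. -/
def arcDefect (γ : ℝ → Plane) (a b r : ℝ) : ENNReal :=
  ∫⁻ φ in Ioc (-Real.pi) Real.pi, ∫⁻ X : ℝ, ∫⁻ η : ℝ,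
    halfCount (crossTimes γ a b (X • dir φ + η • nrm φ) (r • dir φ))

/-- The integral over all segments of length `r` of the number of crossings with an arc. -/
def arcCount (γ : ℝ → Plane) (a b r : ℝ) : ENNReal :=
  ∫⁻ φ in Ioc (-Real.pi) Real.pi, ∫⁻ X : ℝ, ∫⁻ η : ℝ,
    fullCount (crossTimes γ a b (X • dir φ + η • nrm φ) (r • dir φ))

lemma sum_lintegral_le {α ι : Type*} [MeasurableSpace α] (μ : Measure α) (s : Finset ι)
    (f : ι → α → ENNReal) : ∑ i ∈ s, ∫⁻ x, f i x ∂μ ≤ ∫⁻ x, ∑ i ∈ s, f i x ∂μ := by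
  classical
  induction s using Finset.induction_on with
  | empty => simp
  | insert i s his ih =>
    simp only [Finset.sum_insert his]
    refine le_trans ?_ (le_lintegral_add _ _)
    gcongr

lemma sum_arcDefect_le {Ω : Set Plane} (hΩ : IsRegularSet Ω) {N : ℕ}
    {c : Fin N → ℝ → Plane} (hc : IsBoundaryDecomposition Ω c) {ι : Type*} [Fintype ι]
    {q : ι → Fin N} {a b : ι → ℝ} (hA : ArcFamily ι q a b) (r : ℝ) :
    ∑ i, arcDefect (c (q i)) (a i) (b i) r ≤ totalDefect Ω r := by
  unfold arcDefect totalDefect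
  refine (sum_lintegral_le _ _ _).trans (lintegral_mono fun φ => ?_)
  have hm : Measurable fun x => defect Ω x (r • dir φ) :=
    measurable_defect hΩ.2.1.measurableSet measurable_id measurable_const
  rw [lintegral_rot φ hm]
  refine (sum_lintegral_le _ _ _).trans (lintegral_mono fun X => ?_)
  refine (sum_lintegral_le _ _ _).trans (lintegral_mono fun η => ?_)
  exact sum_halfCount_le hΩ hc hA _ _

lemma sum_arcCount_le {Ω : Set Plane} (hΩ : IsRegularSet Ω) {N : ℕ}
    {c : Fin N → ℝ → Plane} (hc : IsBoundaryDecomposition Ω c) {ι : Type*} [Fintype ι]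
    {q : ι → Fin N} {a b : ι → ℝ} (hA : ArcFamily ι q a b) (r : ℝ) :
    ∑ i, arcCount (c (q i)) (a i) (b i) r ≤
      ∫⁻ φ in Ioc (-Real.pi) Real.pi, ∫⁻ x, crossCount Ω x (r • dir φ) := by
  unfold arcCount
  refine (sum_lintegral_le _ _ _).trans (lintegral_mono fun φ => ?_)
  have hm : Measurable fun x => crossCount Ω x (r • dir φ) := by
    unfold crossCount
    exact Measurable.liminf fun k => measurable_natCast_comp
      (measurable_flips hΩ.2.1.measurableSet _ measurable_id measurable_const)
  rw [lintegral_rot φ hm]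
  refine (sum_lintegral_le _ _ _).trans (lintegral_mono fun X => ?_)
  refine (sum_lintegral_le _ _ _).trans (lintegral_mono fun η => ?_)
  exact sum_fullCount_le hΩ hc hA _ _

lemma halfCount_mono {S T : Set ℝ} (h : S ⊆ T) : halfCount S ≤ halfCount T :=
  iSup_le fun F => le_iSup (fun F : {F : Finset ℝ // ↑F ⊆ T} => ((F.1.card / 2 : ℕ) : ENNReal))
    ⟨F.1, F.2.trans h⟩

lemma fullCount_mono {S T : Set ℝ} (h : S ⊆ T) : fullCount S ≤ fullCount T :=
  iSup_le fun F => le_iSup (fun F : {F : Finset ℝ // ↑F ⊆ T} => (F.1.card : ENNReal))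
    ⟨F.1, F.2.trans h⟩

lemma eq_inner_dir_add_inner_nrm (v : Plane) (φ : ℝ) :
    v = (inner ℝ v (dir φ) : ℝ) • dir φ + (inner ℝ v (nrm φ) : ℝ) • nrm φ := by
  rw [inner_dir, inner_nrm]
  have h := Real.sin_sq_add_cos_sq φ
  ext i; fin_cases i
  · simp [dir, nrm, perp]; linear_combination (-v 0) * h
  · simp [dir, nrm, perp]; linear_combination (-v 1) * h

lemma deriv_inner_nrm {γ : ℝ → Plane} (hγ : ContDiff ℝ 1 γ) (φ t : ℝ) :
    deriv (fun t => (inner ℝ (γ t) (nrm φ) : ℝ)) t = inner ℝ (deriv γ t) (nrm φ) := by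
  have h := (hγ.differentiable one_ne_zero t).hasDerivAt
  have := h.inner ℝ (hasDerivAt_const t (nrm φ))
  simpa using this.deriv

/-- In the frame `(dir φ, nrm φ)` the segment sits at height `η` over the abscissae between `X` and
`X + r`. As long as the arc stays over this range, reaching height `η` means meeting the segment,
transversally if the height has non-zero derivative. -/
lemma levelTimes_subset_crossTimes {γ : ℝ → Plane} (hγ : ContDiff ℝ 1 γ) {a b a' b' X r φ η : ℝ}
    (hr : 0 < r) (hsub : Ioo a' b' ⊆ Ioo a b)
    (hX : ∀ t ∈ Ioo a' b', inner ℝ (γ t) (dir φ) ∈ Ioo X (X + r)) :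
    levelTimes (fun t => inner ℝ (γ t) (nrm φ)) a' b' η ⊆
      crossTimes γ a b (X • dir φ + η • nrm φ) (r • dir φ) := by
  rintro t ⟨ht, hη, hd⟩
  have hXt := hX t ht
  refine ⟨hsub ht, ⟨(inner ℝ (γ t) (dir φ) - X) / r, ⟨div_pos (by linarith [hXt.1]) hr, ?_⟩, ?_⟩, ?_⟩
  · rw [div_lt_one hr]; linarith [hXt.2]
  · rw [smul_smul, div_mul_cancel₀ _ hr.ne', ← hη]
    conv_lhs => rw [eq_inner_dir_add_inner_nrm (γ t) φ]
    rw [sub_smul]; abel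
  · rw [deriv_inner_nrm hγ] at hd
    have : perp (r • dir φ) = r • nrm φ := by
      ext i; fin_cases i <;> simp [perp, nrm]
    rw [this, inner_smul_left, real_inner_comm]
    simpa using ⟨hr.ne', hd⟩

/-- The variation excess of the height of an arc over lines of direction `dir φ`. -/
def excess (γ : ℝ → Plane) (a b φ : ℝ) : ℝ :=
  (∫ t in a..b, |(inner ℝ (deriv γ t) (nrm φ) : ℝ)|) - |(inner ℝ (γ b - γ a) (nrm φ) : ℝ)|

lemma contDiff_inner_nrm {γ : ℝ → Plane} (hγ : ContDiff ℝ 1 γ) (φ : ℝ) :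
    ContDiff ℝ 1 (fun t => (inner ℝ (γ t) (nrm φ) : ℝ)) := hγ.inner ℝ contDiff_const

lemma excess_le_lintegral {γ : ℝ → Plane} (hγ : ContDiff ℝ 1 γ) {a b a' b' X r φ : ℝ}
    (hr : 0 < r) (hab : a' ≤ b') (hsub : Ioo a' b' ⊆ Ioo a b)
    (hX : ∀ t ∈ Ioo a' b', inner ℝ (γ t) (dir φ) ∈ Ioo X (X + r)) :
    ENNReal.ofReal (excess γ a' b' φ) ≤
      2 * ∫⁻ η : ℝ, halfCount (crossTimes γ a b (X • dir φ + η • nrm φ) (r • dir φ)) := by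
  have h := le_lintegral_halfCount (contDiff_inner_nrm hγ φ) hab
  simp_rw [deriv_inner_nrm hγ] at h
  rw [← inner_sub_left] at h
  refine h.trans ?_
  gcongr with η
  exact halfCount_mono (levelTimes_subset_crossTimes hγ hr hsub hX)

lemma variation_le_lintegral {γ : ℝ → Plane} (hγ : ContDiff ℝ 1 γ) {a b a' b' X r φ : ℝ}
    (hr : 0 < r) (hab : a' ≤ b') (hsub : Ioo a' b' ⊆ Ioo a b)
    (hX : ∀ t ∈ Ioo a' b', inner ℝ (γ t) (dir φ) ∈ Ioo X (X + r)) :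
    ENNReal.ofReal (∫ t in a'..b', |(inner ℝ (deriv γ t) (nrm φ) : ℝ)|) ≤
      ∫⁻ η : ℝ, fullCount (crossTimes γ a b (X • dir φ + η • nrm φ) (r • dir φ)) := by
  have h := le_lintegral_fullCount (contDiff_inner_nrm hγ φ) hab
  simp_rw [deriv_inner_nrm hγ] at h
  refine h.trans ?_
  gcongr with η
  exact fullCount_mono (levelTimes_subset_crossTimes hγ hr hsub hX)

/-! ### Short arcs: the defect controls the excess of the length over the chord -/

lemma two_mul_ofReal (x : ℝ) : 2 * ENNReal.ofReal x = ENNReal.ofReal (2 * x) := by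
  rw [ENNReal.ofReal_mul (by norm_num), ENNReal.ofReal_ofNat]

lemma norm_sub_le_of_speed {γ : ℝ → Plane} (hγ : ContDiff ℝ 1 γ) {L : ℝ}
    (hL : ∀ t, ‖deriv γ t‖ = L) (s t : ℝ) : ‖γ t - γ s‖ ≤ L * |t - s| := by
  have := Convex.norm_image_sub_le_of_norm_deriv_le (𝕜 := ℝ) (f := γ) (C := L) (s := univ) (x := s)
    (y := t) (fun x _ => hγ.differentiable one_ne_zero x) (fun x _ => (hL x).le) convex_univ
    (mem_univ _) (mem_univ _)
  simpa [Real.norm_eq_abs] using this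

lemma abs_inner_dir_le (v : Plane) (φ : ℝ) : |(inner ℝ v (dir φ) : ℝ)| ≤ ‖v‖ := by
  have := abs_real_inner_le_norm v (dir φ); rwa [norm_dir, mul_one] at this

lemma abs_inner_nrm_le (v : Plane) (φ : ℝ) : |(inner ℝ v (nrm φ) : ℝ)| ≤ ‖v‖ := by
  have := abs_real_inner_le_norm v (nrm φ); rwa [norm_nrm, mul_one] at this

lemma exists_slab {γ : ℝ → Plane} (hγ : ContDiff ℝ 1 γ) {L : ℝ} (hL : ∀ t, ‖deriv γ t‖ = L)
    {a b : ℝ} (hab : a ≤ b) (φ : ℝ) :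
    ∃ c : ℝ, ∀ t ∈ Icc a b, c ≤ inner ℝ (γ t) (dir φ) ∧ inner ℝ (γ t) (dir φ) ≤ c + L * (b - a) := by
  have hL0 : 0 ≤ L := hL 0 ▸ norm_nonneg _
  have hcont : Continuous fun t => (inner ℝ (γ t) (dir φ) : ℝ) :=
    hγ.continuous.inner continuous_const
  obtain ⟨s, hs, hmin⟩ := (isCompact_Icc (a := a) (b := b)).exists_isMinOn ⟨a, left_mem_Icc.2 hab⟩
    hcont.continuousOn
  refine ⟨inner ℝ (γ s) (dir φ), fun t ht => ⟨hmin ht, ?_⟩⟩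
  have h1 := (abs_le.1 ((abs_inner_dir_le (γ t - γ s) φ).trans (norm_sub_le_of_speed hγ hL s t))).2
  rw [inner_sub_left] at h1
  have h2 : L * |t - s| ≤ L * (b - a) := by
    gcongr
    rw [abs_le]; constructor <;> linarith [hs.1, hs.2, ht.1, ht.2]
  linarith

lemma continuous_variation {γ : ℝ → Plane} (hγ : ContDiff ℝ 1 γ) (a b : ℝ) :
    Continuous fun φ => ∫ t in a..b, |(inner ℝ (deriv γ t) (nrm φ) : ℝ)| := by
  have := hγ.continuous_deriv le_rfl
  have h2 := continuous_nrm
  refine intervalIntegral.continuous_parametric_intervalIntegral_of_continuous' ?_ a b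
  simp only [Function.uncurry_def]
  fun_prop

lemma continuous_excess {γ : ℝ → Plane} (hγ : ContDiff ℝ 1 γ) (a b : ℝ) :
    Continuous (excess γ a b) := by
  have h2 := continuous_nrm
  have := continuous_variation hγ a b
  unfold excess
  fun_prop

lemma excess_nonneg {γ : ℝ → Plane} (hγ : ContDiff ℝ 1 γ) {a b : ℝ} (hab : a ≤ b) (φ : ℝ) :
    0 ≤ excess γ a b φ := by
  have hw := contDiff_inner_nrm hγ φ
  have h1 : ∫ t in a..b, deriv (fun t => (inner ℝ (γ t) (nrm φ) : ℝ)) t =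
      inner ℝ (γ b) (nrm φ) - inner ℝ (γ a) (nrm φ) :=
    intervalIntegral.integral_deriv_eq_sub (fun t _ => hw.differentiable one_ne_zero t)
      ((hw.continuous_deriv le_rfl).intervalIntegrable _ _)
  simp_rw [deriv_inner_nrm hγ] at h1
  unfold excess
  rw [inner_sub_left, ← h1, sub_nonneg]
  exact intervalIntegral.abs_integral_le_integral_abs hab

lemma integral_variation {γ : ℝ → Plane} (hγ : ContDiff ℝ 1 γ) {L : ℝ}
    (hL : ∀ t, ‖deriv γ t‖ = L) {a b : ℝ} (hab : a ≤ b) :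
    ∫ φ in (-Real.pi)..Real.pi, ∫ t in a..b, |(inner ℝ (deriv γ t) (nrm φ) : ℝ)| =
      4 * (L * (b - a)) := by
  have hm := (hγ.continuous_deriv le_rfl).measurable
  have key : ∀ x : ℝ, ∫ φ in x..(x + Real.pi), ∫ t in a..b, |(inner ℝ (deriv γ t) (nrm φ) : ℝ)| =
      2 * (L * (b - a)) := by
    intro x
    simp_rw [intervalIntegral.integral_of_le hab]
    rw [integral_integral_abs_inner_nrm hm (fun t => (hL t).le)]
    simp_rw [hL]
    rw [setIntegral_const]
    simp [Measure.real, hab, mul_comm]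
  have hc := continuous_variation hγ a b
  rw [← intervalIntegral.integral_add_adjacent_intervals (b := 0) (hc.intervalIntegrable _ _)
    (hc.intervalIntegrable _ _)]
  have k1 := key (-Real.pi)
  have k2 := key 0
  rw [neg_add_cancel] at k1
  rw [zero_add] at k2
  rw [k1, k2]; ring

lemma integral_abs_inner_nrm_circle (v : Plane) :
    ∫ φ in (-Real.pi)..Real.pi, |(inner ℝ v (nrm φ) : ℝ)| = 4 * ‖v‖ := by
  have h2 := continuous_nrm
  have hc : Continuous fun φ => |(inner ℝ v (nrm φ) : ℝ)| := by fun_prop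
  rw [← intervalIntegral.integral_add_adjacent_intervals (b := 0) (hc.intervalIntegrable _ _)
    (hc.intervalIntegrable _ _)]
  have k1 := integral_abs_inner_nrm v (-Real.pi)
  have k2 := integral_abs_inner_nrm v 0
  rw [neg_add_cancel] at k1
  rw [zero_add] at k2
  rw [k1, k2]; ring

lemma lintegral_ofReal_circle {f : ℝ → ℝ} (hf : Continuous f) (h0 : ∀ φ, 0 ≤ f φ) :
    ∫⁻ φ in Ioc (-Real.pi) Real.pi, ENNReal.ofReal (f φ) =
      ENNReal.ofReal (∫ φ in (-Real.pi)..Real.pi, f φ) := by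
  rw [intervalIntegral.integral_of_le (by linarith [Real.pi_pos]),
    ofReal_integral_eq_lintegral_ofReal]
  · exact (hf.integrableOn_Icc).mono_set Ioc_subset_Icc_self
  · exact Eventually.of_forall h0

/-- A short arc whose length exceeds its chord is crossed at least twice by many segments. -/
lemma le_arcDefect {γ : ℝ → Plane} (hγ : ContDiff ℝ 1 γ) {L : ℝ} (hL : ∀ t, ‖deriv γ t‖ = L)
    {a b r : ℝ} (hab : a ≤ b) (hr : 0 < r) (hle : L * (b - a) ≤ r) :
    ENNReal.ofReal (2 * (r - L * (b - a)) * (L * (b - a) - ‖γ b - γ a‖)) ≤ arcDefect γ a b r := by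
  have h1 : ∀ φ, ENNReal.ofReal (r - L * (b - a)) * ENNReal.ofReal (excess γ a b φ) ≤
      2 * ∫⁻ X : ℝ, ∫⁻ η : ℝ, halfCount (crossTimes γ a b (X • dir φ + η • nrm φ) (r • dir φ)) := by
    intro φ
    obtain ⟨c, hc⟩ := exists_slab hγ hL hab φ
    rw [← lintegral_const_mul' _ _ (by simp)]
    -- For each of these `X`, a range of length `r - L * (b - a)`, the whole arc lies strictly over
    -- the segments that start at abscissa `X`.
    calc _ = ∫⁻ _ in Ioo (c + L * (b - a) - r) c, ENNReal.ofReal (excess γ a b φ) := by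
          rw [setLIntegral_const, Real.volume_Ioo, mul_comm]; congr 2; ring
      _ ≤ ∫⁻ X in Ioo (c + L * (b - a) - r) c, 2 * ∫⁻ η : ℝ,
            halfCount (crossTimes γ a b (X • dir φ + η • nrm φ) (r • dir φ)) := by
          refine setLIntegral_mono' measurableSet_Ioo fun X hX => ?_
          refine excess_le_lintegral hγ hr hab subset_rfl fun t ht => ?_
          have := hc t ⟨ht.1.le, ht.2.le⟩
          exact ⟨by linarith [hX.2], by linarith [hX.1]⟩
      _ ≤ _ := setLIntegral_le_lintegral _ _
  have h2 : ENNReal.ofReal (r - L * (b - a)) * ENNReal.ofReal (4 * (L * (b - a) - ‖γ b - γ a‖)) ≤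
      2 * arcDefect γ a b r := by
    -- Over the full circle the total variation of the height has integral four times the length,
    -- and the net variation four times the chord.
    have e : 4 * (L * (b - a) - ‖γ b - γ a‖) = ∫ φ in (-Real.pi)..Real.pi, excess γ a b φ := by
      unfold excess
      have h2 := continuous_nrm
      rw [intervalIntegral.integral_sub ((continuous_variation hγ a b).intervalIntegrable _ _)
        (Continuous.intervalIntegrable (by fun_prop) _ _), integral_variation hγ hL hab,
        integral_abs_inner_nrm_circle]
      ring
    rw [e, ← lintegral_ofReal_circle (continuous_excess hγ a b) (excess_nonneg hγ hab),
      ← lintegral_const_mul' _ _ (by simp)]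
    unfold arcDefect
    rw [← lintegral_const_mul' _ _ (by simp)]
    exact lintegral_mono fun φ => h1 φ
  rw [← ENNReal.ofReal_mul (by linarith)] at h2
  have h3 : ENNReal.ofReal ((r - L * (b - a)) * (4 * (L * (b - a) - ‖γ b - γ a‖))) =
      2 * ENNReal.ofReal (2 * (r - L * (b - a)) * (L * (b - a) - ‖γ b - γ a‖)) := by
    rw [two_mul_ofReal]; congr 1; ring
  rw [h3] at h2
  exact (ENNReal.mul_le_mul_iff_right (by norm_num) (by norm_num)).1 h2

/-- The segments that cross a short arc measure its length. -/
lemma le_arcCount {γ : ℝ → Plane} (hγ : ContDiff ℝ 1 γ) {L : ℝ} (hL : ∀ t, ‖deriv γ t‖ = L)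
    {a b r : ℝ} (hab : a ≤ b) (hr : 0 < r) (hle : L * (b - a) ≤ r) :
    ENNReal.ofReal ((r - L * (b - a)) * (4 * (L * (b - a)))) ≤ arcCount γ a b r := by
  have h1 : ∀ φ, ENNReal.ofReal (r - L * (b - a)) *
      ENNReal.ofReal (∫ t in a..b, |(inner ℝ (deriv γ t) (nrm φ) : ℝ)|) ≤
      ∫⁻ X : ℝ, ∫⁻ η : ℝ, fullCount (crossTimes γ a b (X • dir φ + η • nrm φ) (r • dir φ)) := by
    intro φ
    obtain ⟨c, hc⟩ := exists_slab hγ hL hab φ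
    calc _ = ∫⁻ _ in Ioo (c + L * (b - a) - r) c,
            ENNReal.ofReal (∫ t in a..b, |(inner ℝ (deriv γ t) (nrm φ) : ℝ)|) := by
          rw [setLIntegral_const, Real.volume_Ioo, mul_comm]; congr 2; ring
      _ ≤ ∫⁻ X in Ioo (c + L * (b - a) - r) c, ∫⁻ η : ℝ,
            fullCount (crossTimes γ a b (X • dir φ + η • nrm φ) (r • dir φ)) := by
          refine setLIntegral_mono' measurableSet_Ioo fun X hX => ?_
          refine variation_le_lintegral hγ hr hab subset_rfl fun t ht => ?_
          have := hc t ⟨ht.1.le, ht.2.le⟩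
          exact ⟨by linarith [hX.2], by linarith [hX.1]⟩
      _ ≤ _ := setLIntegral_le_lintegral _ _
  rw [ENNReal.ofReal_mul (by linarith), ← integral_variation hγ hL hab,
    ← lintegral_ofReal_circle (continuous_variation hγ a b)
      (fun φ => intervalIntegral.integral_nonneg hab fun _ _ => abs_nonneg _),
    ← lintegral_const_mul' _ _ (by simp)]
  exact lintegral_mono fun φ => h1 φ

/-! ### Nearly straight arcs: a sharp lower bound for the defect -/

lemma setLIntegral_Ioc_periodic {f : ℝ → ENNReal} {T : ℝ} (hT : 0 < T)
    (hf : Function.Periodic f T) (a b : ℝ) :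
    ∫⁻ x in Ioc a (a + T), f x = ∫⁻ x in Ioc b (b + T), f x := by
  have : Fact (0 < T) := ⟨hT⟩
  have h1 := AddCircle.lintegral_preimage T a hf.lift
  have h2 := AddCircle.lintegral_preimage T b hf.lift
  simp only [Function.Periodic.lift_coe] at h1 h2
  rw [h1, h2]

lemma crossTimes_reverse (γ : ℝ → Plane) (a b : ℝ) (x z : Plane) :
    crossTimes γ a b x (-z) = crossTimes γ a b (x - z) z := by
  ext t
  simp only [crossTimes, mem_ofPred_eq]
  refine and_congr Iff.rfl (and_congr ⟨?_, ?_⟩ ?_)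
  · rintro ⟨s, hs, h⟩
    refine ⟨1 - s, ⟨by linarith [hs.2], by linarith [hs.1]⟩, ?_⟩
    rw [h, sub_smul, one_smul, smul_neg]; abel
  · rintro ⟨s, hs, h⟩
    refine ⟨1 - s, ⟨by linarith [hs.2], by linarith [hs.1]⟩, ?_⟩
    rw [h, sub_smul, one_smul, smul_neg]; abel
  · have : perp (-z) = -perp z := by ext i; fin_cases i <;> simp [perp]
    rw [this, inner_neg_left, neg_ne_zero]

lemma dir_add_pi (φ : ℝ) : dir (φ + Real.pi) = -dir φ := by
  ext i; fin_cases i <;> simp [dir]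

lemma nrm_add_pi (φ : ℝ) : nrm (φ + Real.pi) = -nrm φ := by
  ext i; fin_cases i <;> simp [nrm, perp, dir]

/-- The contribution of the direction `dir φ` to the defect of an arc. -/
def dirDefect (γ : ℝ → Plane) (a b r φ : ℝ) : ENNReal :=
  ∫⁻ X : ℝ, ∫⁻ η : ℝ, halfCount (crossTimes γ a b (X • dir φ + η • nrm φ) (r • dir φ))

/-- A segment traversed backwards has the opposite direction. The substitutions `X ↦ -r - X` and `η
↦ -η` match the base points. -/
lemma dirDefect_periodic (γ : ℝ → Plane) (a b r : ℝ) :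
    Function.Periodic (dirDefect γ a b r) Real.pi := by
  intro φ
  unfold dirDefect
  rw [← lintegral_sub_left_eq_self _ (-r)]
  refine lintegral_congr fun X => ?_
  rw [← lintegral_neg_eq_self]
  refine lintegral_congr fun η => ?_
  rw [dir_add_pi, nrm_add_pi, smul_neg r, crossTimes_reverse]
  congr 2
  simp only [smul_neg, neg_smul, sub_smul]; abel

/-- By periodicity both half circles may be replaced by the one centred at `φ₀`, so that the
directions near that of the arc lie in its interior. -/
lemma arcDefect_eq (γ : ℝ → Plane) (a b r φ₀ : ℝ) :
    arcDefect γ a b r =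
      2 * ∫⁻ φ in Ioc (φ₀ - Real.pi / 2) (φ₀ + Real.pi / 2), dirDefect γ a b r φ := by
  have hp := Real.pi_pos
  have hper := dirDefect_periodic γ a b r
  have h1 := setLIntegral_Ioc_periodic hp hper (-Real.pi) (φ₀ - Real.pi / 2)
  have h2 := setLIntegral_Ioc_periodic hp hper 0 (φ₀ - Real.pi / 2)
  have e : φ₀ - Real.pi / 2 + Real.pi = φ₀ + Real.pi / 2 := by ring
  rw [e, neg_add_cancel] at h1
  rw [e, zero_add] at h2
  have h3 : arcDefect γ a b r = ∫⁻ φ in Ioc (-Real.pi) Real.pi, dirDefect γ a b r φ := rfl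
  rw [h3, ← Ioc_union_Ioc_eq_Ioc (b := 0) (by linarith) hp.le,
    lintegral_union measurableSet_Ioc (by
      rw [Set.disjoint_left]; intro x hx hx'; exact absurd hx.2 (not_le.2 hx'.1)), h1, h2, two_mul]

lemma inner_nrm_add (v : Plane) (φ₀ ψ : ℝ) : inner ℝ v (nrm (φ₀ + ψ)) =
    inner ℝ v (nrm φ₀) * Real.cos ψ - inner ℝ v (dir φ₀) * Real.sin ψ := by
  simp only [inner_nrm, inner_dir, Real.cos_add, Real.sin_add]; ring

lemma inner_dir_add (v : Plane) (φ₀ ψ : ℝ) : inner ℝ v (dir (φ₀ + ψ)) =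
    inner ℝ v (dir φ₀) * Real.cos ψ + inner ℝ v (nrm φ₀) * Real.sin ψ := by
  simp only [inner_nrm, inner_dir, Real.cos_add, Real.sin_add]; ring

lemma inner_dir_sq_add_inner_nrm_sq (v : Plane) (φ : ℝ) :
    (inner ℝ v (dir φ) : ℝ) ^ 2 + (inner ℝ v (nrm φ) : ℝ) ^ 2 = ‖v‖ ^ 2 := by
  rw [EuclideanSpace.norm_eq, Real.sq_sqrt (by positivity), inner_dir, inner_nrm, Fin.sum_univ_two]
  simp only [Real.norm_eq_abs, sq_abs]
  linear_combination (v 0 ^ 2 + v 1 ^ 2) * Real.sin_sq_add_cos_sq φ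

lemma abs_inner_nrm_le_sin {v : Plane} {φ₀ δ : ℝ} (hv : ‖v‖ = 1) (hδ : 0 ≤ δ) (hδ2 : δ ≤ Real.pi / 2)
    (h : Real.cos δ < inner ℝ v (dir φ₀)) : |(inner ℝ v (nrm φ₀) : ℝ)| ≤ Real.sin δ := by
  have h1 := inner_dir_sq_add_inner_nrm_sq v φ₀
  have hc : 0 ≤ Real.cos δ := Real.cos_nonneg_of_neg_pi_div_two_le_of_le (by linarith [Real.pi_pos]) hδ2
  have hs : 0 ≤ Real.sin δ := Real.sin_nonneg_of_nonneg_of_le_pi hδ (by linarith [Real.pi_pos])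
  refine abs_le_of_sq_le_sq ?_ hs
  rw [hv] at h1
  nlinarith [Real.sin_sq_add_cos_sq δ]

/-- A vector within angle `δ` of `dir φ₀` lies on a fixed side of every line whose angle to `dir φ₀`
is between `δ` and `π / 2`. For such directions a nearly straight arc has monotone height. -/
lemma inner_nrm_nonpos {v : Plane} {φ₀ δ ψ : ℝ} (hv : ‖v‖ = 1) (hδ : 0 ≤ δ)
    (h : Real.cos δ < inner ℝ v (dir φ₀)) (h1 : δ ≤ ψ) (h2 : ψ ≤ Real.pi / 2) :
    (inner ℝ v (nrm (φ₀ + ψ)) : ℝ) ≤ 0 := by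
  have hp := Real.pi_pos
  rw [inner_nrm_add]
  have hq := (abs_le.1 (abs_inner_nrm_le_sin hv hδ (h1.trans h2) h)).2
  have hc : 0 ≤ Real.cos ψ := Real.cos_nonneg_of_neg_pi_div_two_le_of_le (by linarith) h2
  have hs : 0 ≤ Real.sin ψ := Real.sin_nonneg_of_nonneg_of_le_pi (by linarith) (by linarith)
  have h4 : Real.sin (δ - ψ) ≤ 0 := Real.sin_nonpos_of_nonpos_of_neg_pi_le (by linarith) (by linarith)
  rw [Real.sin_sub] at h4
  nlinarith

lemma inner_nrm_nonneg {v : Plane} {φ₀ δ ψ : ℝ} (hv : ‖v‖ = 1) (hδ : 0 ≤ δ)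
    (h : Real.cos δ < inner ℝ v (dir φ₀)) (h1 : δ ≤ ψ) (h2 : ψ ≤ Real.pi / 2) :
    0 ≤ (inner ℝ v (nrm (φ₀ - ψ)) : ℝ) := by
  have hp := Real.pi_pos
  rw [sub_eq_add_neg, inner_nrm_add, Real.cos_neg, Real.sin_neg]
  have hq := (abs_le.1 (abs_inner_nrm_le_sin hv hδ (h1.trans h2) h)).1
  have hc : 0 ≤ Real.cos ψ := Real.cos_nonneg_of_neg_pi_div_two_le_of_le (by linarith) h2
  have hs : 0 ≤ Real.sin ψ := Real.sin_nonneg_of_nonneg_of_le_pi (by linarith) (by linarith)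
  have h4 : Real.sin (δ - ψ) ≤ 0 := Real.sin_nonpos_of_nonpos_of_neg_pi_le (by linarith) (by linarith)
  rw [Real.sin_sub] at h4
  nlinarith

lemma integral_inner_nrm {μ : Measure ℝ} [IsFiniteMeasure μ] {u : ℝ → Plane}
    (hu : Integrable u μ) (φ : ℝ) :
    ∫ t, (inner ℝ (u t) (nrm φ) : ℝ) ∂μ = inner ℝ (∫ t, u t ∂μ) (nrm φ) := by
  rw [real_inner_comm, ← integral_inner (𝕜 := ℝ) hu (nrm φ)]
  exact integral_congr_ae (Eventually.of_forall fun t => real_inner_comm _ _)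

/-- The excess of the total over the net variation of a family of nearly parallel unit vectors,
integrated over the directions close to them. -/
lemma integral_excess_unit {μ : Measure ℝ} [IsFiniteMeasure μ] {u : ℝ → Plane}
    (hu : Measurable u) (h1 : ∀ t, ‖u t‖ = 1) {φ₀ δ : ℝ} (hδ : 0 ≤ δ) (hδ2 : δ ≤ Real.pi / 2)
    (hμ : ∀ᵐ t ∂μ, Real.cos δ < inner ℝ (u t) (dir φ₀)) :
    ∫ φ in (φ₀ - δ)..(φ₀ + δ), ((∫ t, |(inner ℝ (u t) (nrm φ) : ℝ)| ∂μ)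
      - |(inner ℝ (∫ t, u t ∂μ) (nrm φ) : ℝ)|) = 2 * (μ.real univ - ‖∫ t, u t ∂μ‖) := by
  have hInt : Integrable u μ := Integrable.of_bound hu.aestronglyMeasurable 1
    (Eventually.of_forall fun t => (h1 t).le)
  set f : ℝ → ℝ := fun φ => (∫ t, |(inner ℝ (u t) (nrm φ) : ℝ)| ∂μ)
      - |(inner ℝ (∫ t, u t ∂μ) (nrm φ) : ℝ)| with hf
  have hcn := continuous_nrm
  have hcont1 : Continuous fun φ => ∫ t, |(inner ℝ (u t) (nrm φ) : ℝ)| ∂μ := by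
    refine continuous_of_dominated (bound := fun _ => 1) ?_ ?_ (integrable_const _) ?_
    · intro φ
      exact (hu.inner measurable_const).abs.aestronglyMeasurable
    · refine fun φ => Eventually.of_forall fun t => ?_
      rw [Real.norm_eq_abs, abs_abs]
      exact (abs_inner_nrm_le _ _).trans (h1 t).le
    · refine Eventually.of_forall fun t => ?_
      fun_prop
  have hcont2 : Continuous fun φ => |(inner ℝ (∫ t, u t ∂μ) (nrm φ) : ℝ)| := by fun_prop
  have hcont : Continuous f := hcont1.sub hcont2
  -- Without a change of sign there is no cancellation, so total and net variation agree. The excess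
  -- thus lives on `|φ - φ₀| ≤ δ`, and its integral can be extended to a half circle, where it is
  -- explicit.
  have hzero_of_sign : ∀ φ, ((∀ᵐ t ∂μ, (inner ℝ (u t) (nrm φ) : ℝ) ≤ 0) ∨
      (∀ᵐ t ∂μ, 0 ≤ (inner ℝ (u t) (nrm φ) : ℝ))) → f φ = 0 := by
    intro φ h
    simp only [hf]
    rw [← integral_inner_nrm hInt]
    rcases h with h | h
    · rw [abs_of_nonpos (integral_nonpos_of_ae h), ← integral_neg, sub_eq_zero]
      refine integral_congr_ae ?_
      filter_upwards [h] with t ht using abs_of_nonpos ht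
    · rw [abs_of_nonneg (integral_nonneg_of_ae h), sub_eq_zero]
      refine integral_congr_ae ?_
      filter_upwards [h] with t ht using abs_of_nonneg ht
  have hz1 : ∫ φ in (φ₀ - Real.pi / 2)..(φ₀ - δ), f φ = 0 := by
    rw [intervalIntegral.integral_congr (g := fun _ => (0 : ℝ))]
    · simp
    · intro φ hφ
      rw [uIcc_of_le (by linarith)] at hφ
      refine hzero_of_sign φ (Or.inr ?_)
      filter_upwards [hμ] with t ht
      have := inner_nrm_nonneg (h1 t) hδ ht (ψ := φ₀ - φ) (by linarith [hφ.2]) (by linarith [hφ.1])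
      simpa using this
  have hz2 : ∫ φ in (φ₀ + δ)..(φ₀ + Real.pi / 2), f φ = 0 := by
    rw [intervalIntegral.integral_congr (g := fun _ => (0 : ℝ))]
    · simp
    · intro φ hφ
      rw [uIcc_of_le (by linarith)] at hφ
      refine hzero_of_sign φ (Or.inl ?_)
      filter_upwards [hμ] with t ht
      have := inner_nrm_nonpos (h1 t) hδ ht (ψ := φ - φ₀) (by linarith [hφ.1]) (by linarith [hφ.2])
      simpa using this
  have hi : ∀ x y, IntervalIntegrable f volume x y := fun x y => hcont.intervalIntegrable x y
  have hsplit : ∫ φ in (φ₀ - Real.pi / 2)..(φ₀ + Real.pi / 2), f φ =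
      ∫ φ in (φ₀ - δ)..(φ₀ + δ), f φ := by
    rw [← intervalIntegral.integral_add_adjacent_intervals (hi _ (φ₀ - δ)) (hi _ _),
      ← intervalIntegral.integral_add_adjacent_intervals (hi _ (φ₀ + δ)) (hi _ (φ₀ + Real.pi / 2)),
      hz1, hz2]
    ring
  rw [← hsplit]
  have e : φ₀ + Real.pi / 2 = φ₀ - Real.pi / 2 + Real.pi := by ring
  rw [hf, e, intervalIntegral.integral_sub (hcont1.intervalIntegrable _ _)
    (hcont2.intervalIntegrable _ _), integral_abs_inner_nrm,
    integral_integral_abs_inner_nrm hu (fun t => (h1 t).le)]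
  simp_rw [h1]
  simp
  ring

/-- Removing a part of the domain changes the net variation by no more than the total variation of
that part. This permits discarding the misaligned times of a window. -/
lemma setIntegral_abs_sub_abs_mono {f : ℝ → ℝ} {S W : Set ℝ} (hS : MeasurableSet S)
    (hSW : S ⊆ W) (hf : IntegrableOn f W) :
    (∫ t in S, |f t|) - |∫ t in S, f t| ≤ (∫ t in W, |f t|) - |∫ t in W, f t| := by
  have hd := setIntegral_sdiff hS hf hSW
  have hd' := setIntegral_sdiff hS hf.abs hSW
  have h1 : |∫ t in W \ S, f t| ≤ ∫ t in W \ S, |f t| := abs_integral_le_integral_abs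
  rw [hd, hd'] at h1
  have := abs_sub_abs_le_abs_sub (∫ t in W, f t) (∫ t in S, f t)
  linarith

/-- The times at which the tangent of `γ` makes an angle less than `δ` with `dir φ₀`. -/
def alignedTimes (γ : ℝ → Plane) (L φ₀ δ : ℝ) : Set ℝ :=
  {t | L * Real.cos δ < inner ℝ (deriv γ t) (dir φ₀)}

lemma measurableSet_alignedTimes {γ : ℝ → Plane} (hγ : ContDiff ℝ 1 γ) (L φ₀ δ : ℝ) :
    MeasurableSet (alignedTimes γ L φ₀ δ) := by
  have hc := hγ.continuous_deriv le_rfl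
  exact (isOpen_lt continuous_const (hc.inner continuous_const)).measurableSet

/-- The difference of the measure of the aligned times in the window `(τ, τ + h]` and the norm of
the integral of the unit tangent over them. -/
def windowGap (γ : ℝ → Plane) (L φ₀ δ h τ : ℝ) : ℝ :=
  volume.real (Ioc τ (τ + h) ∩ alignedTimes γ L φ₀ δ) -
    ‖∫ t in Ioc τ (τ + h) ∩ alignedTimes γ L φ₀ δ, L⁻¹ • deriv γ t‖

lemma inner_sub_nrm_eq_integral {γ : ℝ → Plane} (hγ : ContDiff ℝ 1 γ) (a b φ : ℝ) :
    inner ℝ (γ b - γ a) (nrm φ) = ∫ t in a..b, (inner ℝ (deriv γ t) (nrm φ) : ℝ) := by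
  have hw := contDiff_inner_nrm hγ φ
  have h1 : ∫ t in a..b, deriv (fun t => (inner ℝ (γ t) (nrm φ) : ℝ)) t =
      inner ℝ (γ b) (nrm φ) - inner ℝ (γ a) (nrm φ) :=
    intervalIntegral.integral_deriv_eq_sub (fun t _ => hw.differentiable one_ne_zero t)
      ((hw.continuous_deriv le_rfl).intervalIntegrable _ _)
  simp_rw [deriv_inner_nrm hγ] at h1
  rw [h1, inner_sub_left]

/-- Restrict the window to the aligned times, which can only lower the excess, and apply
`integral_excess_unit` to the unit tangents there. -/
lemma windowGap_le_integral_excess {γ : ℝ → Plane} (hγ : ContDiff ℝ 1 γ) {L : ℝ} (hL0 : 0 < L)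
    (hL : ∀ t, ‖deriv γ t‖ = L) {φ₀ δ h : ℝ} (hδ : 0 ≤ δ) (hδ2 : δ ≤ Real.pi / 2) (hh : 0 ≤ h)
    (τ : ℝ) :
    2 * L * windowGap γ L φ₀ δ h τ ≤ ∫ φ in (φ₀ - δ)..(φ₀ + δ), excess γ τ (τ + h) φ := by
  set S := Ioc τ (τ + h) ∩ alignedTimes γ L φ₀ δ with hS
  have hcd := hγ.continuous_deriv le_rfl
  have hSm : MeasurableSet S := measurableSet_Ioc.inter (measurableSet_alignedTimes hγ _ _ _)
  have hSfin : volume S < ⊤ := lt_of_le_of_lt (measure_mono inter_subset_left) (by simp)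
  have : IsFiniteMeasure (volume.restrict S) := ⟨by simpa using hSfin⟩
  have hu1 : ∀ t, ‖L⁻¹ • deriv γ t‖ = 1 := fun t => by
    rw [norm_smul, hL, norm_inv, Real.norm_of_nonneg hL0.le, inv_mul_cancel₀ hL0.ne']
  have hum : Measurable fun t => L⁻¹ • deriv γ t := (measurable_deriv γ).const_smul L⁻¹
  have hae : ∀ᵐ t ∂(volume.restrict S), Real.cos δ < inner ℝ (L⁻¹ • deriv γ t) (dir φ₀) := by
    filter_upwards [ae_restrict_mem hSm] with t ht
    have := ht.2
    simp only [alignedTimes, mem_ofPred_eq] at this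
    rw [inner_smul_left, RCLike.conj_to_real, ← div_eq_inv_mul, lt_div_iff₀ hL0]; linarith
  have key := integral_excess_unit hum hu1 hδ hδ2 hae
  simp only [measureReal_restrict_apply_univ] at key
  have e1 : 2 * L * windowGap γ L φ₀ δ h τ = ∫ φ in (φ₀ - δ)..(φ₀ + δ),
      L * ((∫ t in S, |(inner ℝ (L⁻¹ • deriv γ t) (nrm φ) : ℝ)|)
        - |(inner ℝ (∫ t in S, L⁻¹ • deriv γ t) (nrm φ) : ℝ)|) := by
    rw [intervalIntegral.integral_const_mul, key]
    unfold windowGap; ring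
  rw [e1]
  have hInt : Integrable (fun t => L⁻¹ • deriv γ t) (volume.restrict S) :=
    Integrable.of_bound hum.aestronglyMeasurable 1 (Eventually.of_forall fun t => (hu1 t).le)
  have hpt : ∀ φ, L * ((∫ t in S, |(inner ℝ (L⁻¹ • deriv γ t) (nrm φ) : ℝ)|)
        - |(inner ℝ (∫ t in S, L⁻¹ • deriv γ t) (nrm φ) : ℝ)|) ≤ excess γ τ (τ + h) φ := by
    intro φ
    have hle : τ ≤ τ + h := by linarith
    have h1 := setIntegral_abs_sub_abs_mono (f := fun t => (inner ℝ (deriv γ t) (nrm φ) : ℝ)) hSm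
      (inter_subset_left : S ⊆ Ioc τ (τ + h))
      (((hcd.inner continuous_const).integrableOn_Icc).mono_set Ioc_subset_Icc_self)
    unfold excess
    rw [inner_sub_nrm_eq_integral hγ, intervalIntegral.integral_of_le hle,
      intervalIntegral.integral_of_le hle]
    refine le_trans (le_of_eq ?_) h1
    rw [← integral_inner_nrm hInt]
    simp_rw [inner_smul_left, RCLike.conj_to_real, abs_mul]
    rw [integral_const_mul, integral_const_mul, abs_mul, abs_of_pos (inv_pos.2 hL0)]
    field_simp
  refine intervalIntegral.integral_mono_on (by linarith) ?_
    ((continuous_excess hγ _ _).intervalIntegrable _ _) fun φ _ => hpt φ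
  by_contra hni
  have hcn := continuous_nrm
  refine hni (Continuous.intervalIntegrable ?_ _ _)
  refine continuous_const.mul (Continuous.sub ?_ (by fun_prop))
  refine continuous_of_dominated (bound := fun _ => 1) ?_ ?_ (integrable_const _) ?_
  · intro φ
    exact (hum.inner measurable_const).abs.aestronglyMeasurable
  · refine fun φ => Eventually.of_forall fun t => ?_
    rw [Real.norm_eq_abs, abs_abs]
    exact (abs_inner_nrm_le _ _).trans (hu1 t).le
  · refine Eventually.of_forall fun t => ?_
    fun_prop

lemma continuous_excess_window {γ : ℝ → Plane} (hγ : ContDiff ℝ 1 γ) (h : ℝ) :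
    Continuous fun p : ℝ × ℝ => excess γ p.2 (p.2 + h) p.1 := by
  have hcd := hγ.continuous_deriv le_rfl
  have hc := hγ.continuous
  have hcn := continuous_nrm
  unfold excess
  refine Continuous.sub ?_ (by fun_prop)
  have e : ∀ p : ℝ × ℝ, ∫ t in p.2..(p.2 + h), |(inner ℝ (deriv γ t) (nrm p.1) : ℝ)| =
      ∫ s in (0 : ℝ)..h, |(inner ℝ (deriv γ (p.2 + s)) (nrm p.1) : ℝ)| := by
    intro p
    rw [intervalIntegral.integral_comp_add_left (fun t => |(inner ℝ (deriv γ t) (nrm p.1) : ℝ)|),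
      add_zero]
  simp_rw [e]
  refine intervalIntegral.continuous_parametric_intervalIntegral_of_continuous' ?_ 0 h
  simp only [Function.uncurry_def]
  fun_prop

/-- A sharp lower bound for the defect of an arc in terms of windows that start at times after
which the arc advances steadily in the direction `dir φ₀`. -/
lemma lintegral_windowGap_le_arcDefect {γ : ℝ → Plane} (hγ : ContDiff ℝ 1 γ) {L : ℝ} (hL0 : 0 < L)
    (hL : ∀ t, ‖deriv γ t‖ = L) {t₀ t₁ h φ₀ δ : ℝ} (hh : 0 < h) (hδ : 0 < δ) (hδ4 : δ ≤ 1 / 4)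
    {R : Set ℝ} (hRm : MeasurableSet R)
    (hR : ∀ τ ∈ R, t₀ ≤ τ ∧ τ + h ≤ t₁ ∧ τ ∈ alignedTimes γ L φ₀ δ ∧
      ∀ t ∈ Icc τ t₁, 3 / 4 * L * (t - τ) ≤ inner ℝ (γ t - γ τ) (dir φ₀)) :
    ∫⁻ τ in R, ENNReal.ofReal (2 * Real.cos (2 * δ) * L ^ 2 * windowGap γ L φ₀ δ h τ) ≤
      arcDefect γ t₀ t₁ (L * h) := by
  have hpi := Real.pi_gt_three
  have hr : 0 < L * h := mul_pos hL0 hh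
  have hcos2 : 0 ≤ Real.cos (2 * δ) :=
    Real.cos_nonneg_of_neg_pi_div_two_le_of_le (by linarith) (by linarith)
  have hcd := hγ.continuous_deriv le_rfl
  -- the directions close to `dir φ₀`
  have hcosψ : ∀ ψ : ℝ, |ψ| ≤ δ → Real.cos δ ≤ Real.cos ψ ∧ |Real.sin ψ| ≤ Real.sin δ := by
    intro ψ hψ
    constructor
    · rw [← Real.cos_abs ψ]
      exact Real.cos_le_cos_of_nonneg_of_le_pi (abs_nonneg _) (by linarith) hψ
    · rw [abs_le] at hψ ⊢
      constructor
      · rw [← Real.sin_neg]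
        exact Real.sin_le_sin_of_le_of_le_pi_div_two (by linarith) (by linarith) hψ.1
      · exact Real.sin_le_sin_of_le_of_le_pi_div_two (by linarith) (by linarith) hψ.2
  -- Since `δ ≤ 1 / 4`, even `1 - 1 / 32` is available; `7 / 8` is convenient.
  have hcδ : 7 / 8 ≤ Real.cos δ := by
    have := Real.one_sub_sq_div_two_le_cos (x := δ); nlinarith
  have hsδ : Real.sin δ ≤ 1 / 4 := (Real.sin_le hδ.le).trans hδ4
  have hsδ0 : 0 ≤ Real.sin δ := Real.sin_nonneg_of_nonneg_of_le_pi hδ.le (by linarith)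
  -- The advance along `dir φ₀`, at least `3 / 4 * 7 / 8 = 21 / 32` of the elapsed length after
  -- rotation to `dir φ`, beats the lateral drift, at most `1 / 4` of it.
  have hadv : ∀ φ ∈ Ioc (φ₀ - δ) (φ₀ + δ), ∀ τ ∈ R, ∀ t ∈ Ioc τ t₁,
      inner ℝ (γ τ) (dir φ) < inner ℝ (γ t) (dir φ) := by
    intro φ hφ τ hτ t ht
    have hψ : |φ - φ₀| ≤ δ := by rw [abs_le]; constructor <;> linarith [hφ.1, hφ.2]
    obtain ⟨c1, c2⟩ := hcosψ _ hψ
    have h1 := (hR τ hτ).2.2.2 t ⟨ht.1.le, ht.2⟩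
    have h2 := (abs_inner_nrm_le (γ t - γ τ) φ₀).trans (norm_sub_le_of_speed hγ hL τ t)
    rw [abs_of_pos (sub_pos.2 ht.1)] at h2
    have h3 := inner_dir_add (γ t - γ τ) φ₀ (φ - φ₀)
    rw [add_sub_cancel, inner_sub_left] at h3
    have hpos : 0 < L * (t - τ) := mul_pos hL0 (sub_pos.2 ht.1)
    have h5 : |inner ℝ (γ t - γ τ) (nrm φ₀) * Real.sin (φ - φ₀)| ≤ L * (t - τ) * (1 / 4) := by
      rw [abs_mul]
      exact mul_le_mul h2 (c2.trans hsδ) (abs_nonneg _) hpos.le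
    have h6 : 3 / 4 * L * (t - τ) * (7 / 8) ≤
        inner ℝ (γ t - γ τ) (dir φ₀) * Real.cos (φ - φ₀) :=
      mul_le_mul h1 (hcδ.trans c1) (by norm_num) (le_trans (by nlinarith) h1)
    have h7 := (abs_le.1 h5).1
    linarith
  -- Change of variables `X = inner (γ τ) (dir φ)`. It is injective on `R` by the steady advance,
  -- its Jacobian is at least `L (cos² δ - sin² δ) = L cos 2δ`, and the window after `τ` stays over
  -- the segment of length `L * h` because the speed is `L`.
  have hdirbound : ∀ φ ∈ Ioc (φ₀ - δ) (φ₀ + δ),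
      ∫⁻ τ in R, ENNReal.ofReal (L * Real.cos (2 * δ)) * ENNReal.ofReal (excess γ τ (τ + h) φ) ≤
        2 * dirDefect γ t₀ t₁ (L * h) φ := by
    intro φ hφ
    set x : ℝ → ℝ := fun t => inner ℝ (γ t) (dir φ) with hx
    have hxd : ∀ τ, HasDerivAt x (inner ℝ (deriv γ τ) (dir φ)) τ := by
      intro τ
      have h := (hγ.differentiable one_ne_zero τ).hasDerivAt
      simpa using h.inner ℝ (hasDerivAt_const τ (dir φ))
    have hinj : InjOn x R := by
      intro τ hτ τ' hτ' heq
      by_contra hne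
      rcases lt_or_gt_of_ne hne with hlt | hlt
      · exact absurd heq (hadv φ hφ τ hτ τ' ⟨hlt, by linarith [(hR τ' hτ').2.1]⟩).ne
      · exact absurd heq (hadv φ hφ τ' hτ' τ ⟨hlt, by linarith [(hR τ hτ).2.1]⟩).ne'
    unfold dirDefect
    rw [← lintegral_const_mul' _ _ (by simp)]
    refine le_trans ?_ (setLIntegral_le_lintegral (x '' R) _)
    rw [lintegral_image_eq_lintegral_abs_deriv_mul hRm (fun τ _ => (hxd τ).hasDerivWithinAt) hinj]
    refine setLIntegral_mono' hRm fun τ hτ => ?_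
    obtain ⟨r1, r2, r3, r4⟩ := hR τ hτ
    refine mul_le_mul' (ENNReal.ofReal_le_ofReal ?_) ?_
    · have hψ : |φ - φ₀| ≤ δ := by rw [abs_le]; constructor <;> linarith [hφ.1, hφ.2]
      obtain ⟨c1, c2⟩ := hcosψ _ hψ
      have h3 := inner_dir_add (deriv γ τ) φ₀ (φ - φ₀)
      rw [add_sub_cancel] at h3
      refine le_trans ?_ (le_abs_self _)
      rw [h3]
      simp only [alignedTimes, mem_ofPred_eq] at r3
      have hq : |(inner ℝ (deriv γ τ) (nrm φ₀) : ℝ)| ≤ L * Real.sin δ := by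
        have hv : ‖L⁻¹ • deriv γ τ‖ = 1 := by
          rw [norm_smul, hL, norm_inv, Real.norm_of_nonneg hL0.le, inv_mul_cancel₀ hL0.ne']
        have := abs_inner_nrm_le_sin (φ₀ := φ₀) hv hδ.le (by linarith) (by
          rw [inner_smul_left, RCLike.conj_to_real, ← div_eq_inv_mul, lt_div_iff₀ hL0]; linarith)
        rw [inner_smul_left, RCLike.conj_to_real, abs_mul, abs_of_pos (inv_pos.2 hL0),
          ← div_eq_inv_mul, div_le_iff₀ hL0] at this
        linarith
      have h5 : |inner ℝ (deriv γ τ) (nrm φ₀) * Real.sin (φ - φ₀)| ≤ L * Real.sin δ * Real.sin δ := by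
        rw [abs_mul]
        exact mul_le_mul hq c2 (abs_nonneg _) (by positivity)
      have h6 : L * Real.cos δ * Real.cos δ ≤ inner ℝ (deriv γ τ) (dir φ₀) * Real.cos (φ - φ₀) :=
        mul_le_mul r3.le c1 (by linarith) (le_trans (by positivity) r3.le)
      have h7 := (abs_le.1 h5).1
      rw [Real.cos_two_mul]
      nlinarith [Real.sin_sq_add_cos_sq δ]
    · refine excess_le_lintegral hγ hr (by linarith) (Ioo_subset_Ioo r1 r2) fun t ht => ?_
      refine ⟨hadv φ hφ τ hτ t ⟨ht.1, by linarith [ht.2]⟩, ?_⟩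
      have h2 := (abs_inner_dir_le (γ t - γ τ) φ).trans (norm_sub_le_of_speed hγ hL τ t)
      rw [abs_of_pos (sub_pos.2 ht.1), inner_sub_left] at h2
      have h3 := (abs_le.1 h2).2
      have h4 : L * (t - τ) < L * h := by
        apply mul_lt_mul_of_pos_left _ hL0; linarith [ht.2]
      simp only [hx]; linarith
  have hsub : Ioc (φ₀ - δ) (φ₀ + δ) ⊆ Ioc (φ₀ - Real.pi / 2) (φ₀ + Real.pi / 2) :=
    Ioc_subset_Ioc (by linarith) (by linarith)
  rw [arcDefect_eq γ t₀ t₁ (L * h) φ₀, ← lintegral_const_mul' _ _ (by simp)]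
  refine le_trans ?_ (lintegral_mono_set hsub)
  refine le_trans ?_ (setLIntegral_mono' measurableSet_Ioc hdirbound)
  have hmeas : Measurable fun p : ℝ × ℝ => ENNReal.ofReal (L * Real.cos (2 * δ)) *
      ENNReal.ofReal (excess γ p.2 (p.2 + h) p.1) :=
    ((continuous_excess_window hγ h).measurable.ennreal_ofReal).const_mul _
  rw [lintegral_lintegral_swap (f := fun φ τ => ENNReal.ofReal (L * Real.cos (2 * δ)) *
      ENNReal.ofReal (excess γ τ (τ + h) φ)) hmeas.aemeasurable]
  refine lintegral_mono fun τ => ?_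
  rw [lintegral_const_mul' _ _ (by simp),
    ← ofReal_integral_eq_lintegral_ofReal
      ((continuous_excess hγ _ _).integrableOn_Icc.mono_set Ioc_subset_Icc_self)
      (Eventually.of_forall fun φ => excess_nonneg hγ (by linarith) φ),
    ← intervalIntegral.integral_of_le (by linarith), ← ENNReal.ofReal_mul (by positivity)]
  refine ENNReal.ofReal_le_ofReal ?_
  have h1 := windowGap_le_integral_excess hγ hL0 hL (φ₀ := φ₀) hδ.le (by linarith) hh.le τ
  have := mul_le_mul_of_nonneg_left h1 (mul_nonneg hL0.le hcos2)
  refine le_trans (le_of_eq ?_) this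
  ring

/-! ### A priori estimates on arcs with small defect -/

lemma halfCount_add_le {S T U : Set ℝ} (hS : S ⊆ U) (hT : T ⊆ U) (hd : Disjoint S T) :
    halfCount S + halfCount T ≤ halfCount U := by
  classical
  unfold halfCount
  have : Nonempty {F : Finset ℝ // ↑F ⊆ S} := ⟨⟨∅, by simp⟩⟩
  have : Nonempty {F : Finset ℝ // ↑F ⊆ T} := ⟨⟨∅, by simp⟩⟩
  refine ENNReal.iSup_add_iSup_le fun F G => ?_
  have hFG : Disjoint F.1 G.1 := by
    rw [← Finset.disjoint_coe]; exact hd.mono F.2 G.2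
  refine le_trans ?_ (le_iSup (fun F : {F : Finset ℝ // ↑F ⊆ U} =>
    ((F.1.card / 2 : ℕ) : ENNReal)) ⟨F.1 ∪ G.1, by simpa using ⟨F.2.trans hS, G.2.trans hT⟩⟩)
  rw [← Nat.cast_add]
  refine Nat.cast_le.2 ?_
  simp only [Finset.card_union_of_disjoint hFG]
  omega

lemma crossTimes_mono {γ : ℝ → Plane} {a b a' b' : ℝ} (h : Ioo a b ⊆ Ioo a' b') (x z : Plane) :
    crossTimes γ a b x z ⊆ crossTimes γ a' b' x z := fun _ ht => ⟨h ht.1, ht.2⟩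

lemma arcDefect_add_le (γ : ℝ → Plane) {a b c : ℝ} (hab : a ≤ b) (hbc : b ≤ c) (r : ℝ) :
    arcDefect γ a b r + arcDefect γ b c r ≤ arcDefect γ a c r := by
  unfold arcDefect
  refine (le_lintegral_add _ _).trans (lintegral_mono fun φ => ?_)
  refine (le_lintegral_add _ _).trans (lintegral_mono fun X => ?_)
  refine (le_lintegral_add _ _).trans (lintegral_mono fun η => ?_)
  refine halfCount_add_le (crossTimes_mono (Ioo_subset_Ioo_right hbc) _ _)
    (crossTimes_mono (Ioo_subset_Ioo_left hab) _ _) ?_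
  rw [Set.disjoint_left]
  intro t h1 h2
  exact absurd h1.1.2 (not_lt.2 h2.1.1.le)

/-- Each point lies in at most two of the windows formed by two consecutive intervals. -/
lemma sum_arcDefect_pairs_le (γ : ℝ → Plane) {p : ℕ → ℝ} (hp : Monotone p) (r : ℝ) (n : ℕ) :
    ∑ i ∈ Finset.range n, arcDefect γ (p i) (p (i + 2)) r ≤
      arcDefect γ (p 0) (p (n + 1)) r + arcDefect γ (p 0) (p n) r := by
  induction n with
  | zero => simp
  | succ n ih =>
    rw [Finset.sum_range_succ]
    calc _ ≤ arcDefect γ (p 0) (p (n + 1)) r + arcDefect γ (p 0) (p n) r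
          + arcDefect γ (p n) (p (n + 2)) r := by gcongr
      _ = arcDefect γ (p 0) (p (n + 1)) r + (arcDefect γ (p 0) (p n) r
          + arcDefect γ (p n) (p (n + 2)) r) := by rw [add_assoc]
      _ ≤ arcDefect γ (p 0) (p (n + 1)) r + arcDefect γ (p 0) (p (n + 2)) r := by
          gcongr
          exact arcDefect_add_le γ (hp (Nat.zero_le _)) (hp (by omega)) r
      _ = _ := add_comm _ _

lemma arcDefect_mono (γ : ℝ → Plane) {a b c : ℝ} (hbc : b ≤ c) (r : ℝ) :
    arcDefect γ a b r ≤ arcDefect γ a c r := by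
  unfold arcDefect
  refine lintegral_mono fun φ => lintegral_mono fun X => lintegral_mono fun η => ?_
  exact halfCount_mono (crossTimes_mono (Ioo_subset_Ioo_right hbc) _ _)

/-- With `s = ‖a + b‖` the parallelogram law gives `‖a - b‖² ≤ 4 - s²`, and `4 (2 - s) - (4 - s²) =
(s - 2)²`. -/
lemma norm_add_le_two_sub {a b : Plane} (ha : ‖a‖ ≤ 1) (hb : ‖b‖ ≤ 1) :
    ‖a - b‖ ^ 2 ≤ 4 * (2 - ‖a + b‖) := by
  have h := parallelogram_law_with_norm ℝ a b
  have h1 : ‖a‖ * ‖a‖ ≤ 1 := by nlinarith [norm_nonneg a]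
  have h2 : ‖b‖ * ‖b‖ ≤ 1 := by nlinarith [norm_nonneg b]
  nlinarith [sq_nonneg (‖a + b‖ - 2)]

/-- A discrete interpolation inequality. -/
lemma sq_le_of_sum_sq {f : ℕ → ℝ} (M : ℕ) {A B θ : ℝ} (hθ : 0 < θ)
    (hA : ∑ i ∈ Finset.range M, (f (i + 1) - f i) ^ 2 ≤ A)
    (hB : ∑ i ∈ Finset.range (M + 1), f i ^ 2 ≤ B) {j : ℕ} (hj : j ≤ M) :
    f j ^ 2 ≤ B / (M + 1) + (θ * A + 4 * B / θ) / 2 := by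
  -- Factor the difference of squares and apply Young's inequality with weight `θ`.
  have step : ∀ i, |f (i + 1) ^ 2 - f i ^ 2| ≤
      (θ * (f (i + 1) - f i) ^ 2 + 2 * (f (i + 1) ^ 2 + f i ^ 2) / θ) / 2 := by
    intro i
    have e : 2 * (f (i + 1) ^ 2 + f i ^ 2) / θ ≥ (f (i + 1) + f i) ^ 2 / θ := by
      apply div_le_div_of_nonneg_right _ hθ.le
      nlinarith [sq_nonneg (f (i + 1) - f i)]
    have e2 : |f (i + 1) ^ 2 - f i ^ 2| ≤
        (θ * (f (i + 1) - f i) ^ 2 + (f (i + 1) + f i) ^ 2 / θ) / 2 := by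
      have : θ * (f (i + 1) - f i) ^ 2 + (f (i + 1) + f i) ^ 2 / θ -
          2 * |f (i + 1) ^ 2 - f i ^ 2| =
          (θ * |f (i + 1) - f i| - |f (i + 1) + f i|) ^ 2 / θ := by
        have : |f (i + 1) ^ 2 - f i ^ 2| = |f (i + 1) - f i| * |f (i + 1) + f i| := by
          rw [← abs_mul]; congr 1; ring
        rw [this, ← sq_abs (f (i + 1) - f i), ← sq_abs (f (i + 1) + f i)]
        field_simp; ring
      have h0 : 0 ≤ (θ * |f (i + 1) - f i| - |f (i + 1) + f i|) ^ 2 / θ := by positivity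
      linarith
    linarith
  have hS : ∑ i ∈ Finset.range M, |f (i + 1) ^ 2 - f i ^ 2| ≤ (θ * A + 4 * B / θ) / 2 := by
    calc _ ≤ ∑ i ∈ Finset.range M,
          (θ * (f (i + 1) - f i) ^ 2 + 2 * (f (i + 1) ^ 2 + f i ^ 2) / θ) / 2 :=
        Finset.sum_le_sum fun i _ => step i
      _ = (θ * ∑ i ∈ Finset.range M, (f (i + 1) - f i) ^ 2 +
          2 * (∑ i ∈ Finset.range M, f (i + 1) ^ 2 + ∑ i ∈ Finset.range M, f i ^ 2) / θ) / 2 := by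
        rw [← Finset.sum_div, Finset.sum_add_distrib, ← Finset.mul_sum, ← Finset.sum_div,
          ← Finset.mul_sum, Finset.sum_add_distrib]
      _ ≤ _ := by
        have h1 : ∑ i ∈ Finset.range M, f (i + 1) ^ 2 ≤ B := by
          rw [Finset.sum_range_succ'] at hB
          nlinarith [sq_nonneg (f 0)]
        have h2 : ∑ i ∈ Finset.range M, f i ^ 2 ≤ B := by
          rw [Finset.sum_range_succ] at hB
          nlinarith [sq_nonneg (f M)]
        have h3 : 2 * (∑ i ∈ Finset.range M, f (i + 1) ^ 2 + ∑ i ∈ Finset.range M, f i ^ 2) / θ ≤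
            4 * B / θ := div_le_div_of_nonneg_right (by linarith) hθ.le
        have h4 := mul_le_mul_of_nonneg_left hA hθ.le
        linarith
  -- Some value of `f²` is at most the average; the summed increments of `f²` bound all others from
  -- there.
  obtain ⟨i, hi, hfi⟩ : ∃ i ∈ Finset.range (M + 1), f i ^ 2 ≤ B / (M + 1) := by
    apply Finset.exists_le_of_sum_le (by simp)
    rw [Finset.sum_const, Finset.card_range, nsmul_eq_mul]
    push_cast
    rw [mul_div_cancel₀ _ (by positivity)]
    exact hB
  have hdist : ∀ a b, a ≤ b → b ≤ M → |f b ^ 2 - f a ^ 2| ≤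
      ∑ i ∈ Finset.range M, |f (i + 1) ^ 2 - f i ^ 2| := by
    intro a b hab hb
    rw [← Finset.sum_Ico_sub (fun i => f i ^ 2) hab]
    refine (Finset.abs_sum_le_sum_abs _ _).trans
      (Finset.sum_le_sum_of_subset_of_nonneg ?_ fun _ _ _ => abs_nonneg _)
    intro x hx; simp only [Finset.mem_Ico, Finset.mem_range] at *; omega
  have hi' : i ≤ M := by simp at hi; omega
  rcases le_total i j with h | h
  · have := (abs_le.1 (hdist i j h hj)).2; linarith
  · have := (abs_le.1 (hdist j i h hi')).1; linarith

/-- Cauchy–Schwarz, read off from the non-negativity of the variance. -/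
lemma integral_sq_le {f : ℝ → ℝ} (hf : Continuous f) {a b : ℝ} (hab : a < b) :
    (∫ t in a..b, f t) ^ 2 ≤ (b - a) * ∫ t in a..b, f t ^ 2 := by
  set I := ∫ t in a..b, f t with hI
  have hk : 0 < b - a := by linarith
  have h0 : 0 ≤ ∫ t in a..b, (f t - I / (b - a)) ^ 2 :=
    intervalIntegral.integral_nonneg hab.le fun t _ => sq_nonneg _
  have e : ∫ t in a..b, (f t - I / (b - a)) ^ 2 =
      (∫ t in a..b, f t ^ 2) - 2 * (I / (b - a)) * I + (b - a) * (I / (b - a)) ^ 2 := by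
    have : ∀ t, (f t - I / (b - a)) ^ 2 =
        f t ^ 2 - 2 * (I / (b - a)) * f t + (I / (b - a)) ^ 2 := fun t => by ring
    simp_rw [this]
    rw [intervalIntegral.integral_add, intervalIntegral.integral_sub,
      intervalIntegral.integral_const_mul, intervalIntegral.integral_const, smul_eq_mul]
    all_goals exact Continuous.intervalIntegrable (by fun_prop) _ _
  rw [e] at h0
  have : (∫ t in a..b, f t ^ 2) - 2 * (I / (b - a)) * I + (b - a) * (I / (b - a)) ^ 2 =
      ((b - a) * (∫ t in a..b, f t ^ 2) - I ^ 2) / (b - a) := by field_simp; ring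
  rw [this] at h0
  have := mul_nonneg h0 hk.le
  rw [div_mul_cancel₀ _ hk.ne'] at this
  linarith

/-- The mean of `u` over the interval `[a, b]`. -/
def mean (u : ℝ → Plane) (a b : ℝ) : Plane := (b - a)⁻¹ • ∫ t in a..b, u t

lemma smul_mean (u : ℝ → Plane) {a b : ℝ} (hab : a < b) :
    (b - a) • mean u a b = ∫ t in a..b, u t := by
  rw [mean, smul_smul, mul_inv_cancel₀ (by linarith), one_smul]

lemma norm_mean_le {u : ℝ → Plane} (h1 : ∀ t, ‖u t‖ = 1) {a b : ℝ} (hab : a < b) :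
    ‖mean u a b‖ ≤ 1 := by
  have : ‖∫ t in a..b, u t‖ ≤ 1 * |b - a| :=
    intervalIntegral.norm_integral_le_of_norm_le_const fun t _ => (h1 t).le
  have hk : 0 < b - a := by linarith
  rw [abs_of_pos hk, one_mul] at this
  rw [mean, norm_smul, norm_inv, Real.norm_of_nonneg hk.le, inv_mul_le_iff₀ hk]; linarith

lemma mean_sub_const {u : ℝ → Plane} (hu : Continuous u) (e : Plane) {a b : ℝ} (hab : a < b) :
    mean u a b - e = mean (fun t => u t - e) a b := by
  have hk : b - a ≠ 0 := by linarith
  unfold mean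
  rw [intervalIntegral.integral_sub (hu.intervalIntegrable _ _)
    (continuous_const.intervalIntegrable _ _), intervalIntegral.integral_const, smul_sub, smul_smul,
    inv_mul_cancel₀ hk, one_smul]

/-- Subtracting `ε` absorbs the distance of `v` from `e`. What is left is the mean of `‖u - v‖`,
whose square is bounded by Cauchy–Schwarz. -/
lemma excess_mean_sq_le {u v : ℝ → Plane} (hu : Continuous u) (hv : Continuous v) {e : Plane}
    {a b ε : ℝ} (hab : a < b) (he : ∀ t ∈ Icc a b, ‖v t - e‖ ≤ ε) :
    max (‖mean u a b - e‖ - ε) 0 ^ 2 ≤ (b - a)⁻¹ * ∫ t in a..b, ‖u t - v t‖ ^ 2 := by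
  have hk : 0 < b - a := by linarith
  set J := ∫ t in a..b, ‖u t - v t‖ with hJ
  have hJ0 : 0 ≤ J := intervalIntegral.integral_nonneg hab.le fun t _ => norm_nonneg _
  have h1 : ‖mean u a b - e‖ ≤ (b - a)⁻¹ * J + ε := by
    rw [mean_sub_const hu e hab, mean, norm_smul, norm_inv, Real.norm_of_nonneg hk.le]
    have : ‖∫ t in a..b, (u t - e)‖ ≤ ∫ t in a..b, (‖u t - v t‖ + ε) := by
      refine intervalIntegral.norm_integral_le_of_norm_le hab.le ?_
        (Continuous.intervalIntegrable (by fun_prop) _ _)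
      refine ae_of_all _ fun t ht => ?_
      have h2 := he t (Ioc_subset_Icc_self ht)
      calc ‖u t - e‖ = ‖(u t - v t) + (v t - e)‖ := by congr 1; abel
        _ ≤ _ := (norm_add_le _ _).trans (by linarith)
    rw [intervalIntegral.integral_add (Continuous.intervalIntegrable (by fun_prop) _ _)
      (Continuous.intervalIntegrable (by fun_prop) _ _), intervalIntegral.integral_const,
      smul_eq_mul] at this
    calc _ ≤ (b - a)⁻¹ * (J + (b - a) * ε) := by gcongr
      _ = _ := by field_simp
  have h2 : max (‖mean u a b - e‖ - ε) 0 ≤ (b - a)⁻¹ * J :=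
    max_le (by linarith) (by positivity)
  calc _ ≤ ((b - a)⁻¹ * J) ^ 2 := pow_le_pow_left₀ (le_max_right _ _) h2 2
    _ = (b - a)⁻¹ ^ 2 * J ^ 2 := mul_pow _ _ _
    _ ≤ (b - a)⁻¹ ^ 2 * ((b - a) * ∫ t in a..b, ‖u t - v t‖ ^ 2) := by
        gcongr
        exact integral_sq_le (by fun_prop) hab
    _ = _ := by field_simp

lemma integral_norm_sub_mean_sq {u : ℝ → Plane} (hu : Continuous u) (h1 : ∀ t, ‖u t‖ = 1)
    {a b : ℝ} (hab : a < b) :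
    ∫ t in a..b, ‖u t - mean u a b‖ ^ 2 = (b - a) * (1 - ‖mean u a b‖ ^ 2) := by
  set m := mean u a b with hm
  have e : ∀ t, ‖u t - m‖ ^ 2 = (1 + ‖m‖ ^ 2) - 2 * inner ℝ m (u t) := fun t => by
    rw [norm_sub_sq_real, h1, real_inner_comm]; ring
  simp_rw [e]
  have hin : ∫ t in a..b, (inner ℝ m (u t) : ℝ) = inner ℝ m (∫ t in a..b, u t) := by
    rw [intervalIntegral.integral_of_le hab.le, intervalIntegral.integral_of_le hab.le]
    exact integral_inner (hu.integrableOn_Icc.mono_set Ioc_subset_Icc_self) m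
  rw [intervalIntegral.integral_sub (Continuous.intervalIntegrable (by fun_prop) _ _)
      (Continuous.intervalIntegrable (by fun_prop) _ _), intervalIntegral.integral_const,
      intervalIntegral.integral_const_mul, hin, ← smul_mean u hab, ← hm, inner_smul_right,
      real_inner_self_eq_norm_sq, smul_eq_mul]
  ring

/-- On a cell with mean close to `e`, most of the directions are close to `e`. -/
lemma volume_misaligned_cell_le {u : ℝ → Plane} (hu : Continuous u) (h1 : ∀ t, ‖u t‖ = 1)
    {e : Plane} (he : ‖e‖ = 1) {a b ε κ : ℝ} (hab : a < b) (hε : 0 < ε)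
    (hκ : (4 * ε) ^ 2 ≤ 2 * (1 - κ)) (hm : ‖mean u a b - e‖ ≤ 2 * ε) :
    volume (Ioc a b ∩ {t | inner ℝ (u t) e ≤ κ}) ≤
      ENNReal.ofReal ((b - a) * (1 - ‖mean u a b‖) / (2 * ε ^ 2)) := by
  set m := mean u a b with hmdef
  set S := Ioc a b ∩ {t | inner ℝ (u t) e ≤ κ} with hS
  have hSm : MeasurableSet S := measurableSet_Ioc.inter
    (isClosed_le (by fun_prop) continuous_const).measurableSet
  have hSfin : volume S < ⊤ := lt_of_le_of_lt (measure_mono inter_subset_left) (by simp)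
  -- Misalignment means `‖u t - e‖ ≥ 4 * ε`, and the mean is within `2 * ε` of `e`, so `u t` is at
  -- least `2 * ε` from the mean. The bound then follows as in Chebyshev's inequality, the variance
  -- being `1 - ‖m‖²` per unit length.
  have hpt : ∀ t ∈ S, 4 * ε ^ 2 ≤ ‖u t - m‖ ^ 2 := by
    intro t ht
    have h2 : inner ℝ (u t) e ≤ κ := ht.2
    have h3 : (4 * ε) ^ 2 ≤ ‖u t - e‖ ^ 2 := by
      rw [norm_sub_sq_real, h1, he]; linarith
    have h4 : 4 * ε ≤ ‖u t - e‖ := le_of_sq_le_sq h3 (norm_nonneg _)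
    have h5 : ‖u t - e‖ ≤ ‖u t - m‖ + ‖m - e‖ := norm_sub_le_norm_sub_add_norm_sub _ _ _
    nlinarith
  have hInt : IntegrableOn (fun t => ‖u t - m‖ ^ 2) (Ioc a b) :=
    (Continuous.integrableOn_Icc (by fun_prop)).mono_set Ioc_subset_Icc_self
  have h2 : volume.real S * (4 * ε ^ 2) ≤ (b - a) * (1 - ‖m‖ ^ 2) := by
    rw [← integral_norm_sub_mean_sq hu h1 hab, intervalIntegral.integral_of_le hab.le]
    calc volume.real S * (4 * ε ^ 2) = ∫ t in S, 4 * ε ^ 2 := by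
          rw [setIntegral_const, smul_eq_mul]
      _ ≤ ∫ t in S, ‖u t - m‖ ^ 2 := by
          refine setIntegral_mono_on ?_ (hInt.mono_set inter_subset_left) hSm hpt
          exact integrableOn_const hSfin.ne
      _ ≤ _ := setIntegral_mono_set hInt (ae_of_all _ fun t => sq_nonneg _)
          inter_subset_left.eventuallyLE
  have hm1 : ‖m‖ ≤ 1 := norm_mean_le h1 hab
  rw [← ofReal_measureReal hSfin.ne]
  refine ENNReal.ofReal_le_ofReal ?_
  rw [le_div_iff₀ (by positivity)]
  have : (1 - ‖m‖ ^ 2) ≤ 2 * (1 - ‖m‖) := by nlinarith [norm_nonneg m]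
  nlinarith

lemma sub_eq_smul_mean {γ : ℝ → Plane} (hγ : ContDiff ℝ 1 γ) {L : ℝ} (hL0 : 0 < L) {a b : ℝ}
    (hab : a < b) : γ b - γ a = (L * (b - a)) • mean (fun t => L⁻¹ • deriv γ t) a b := by
  rw [mul_smul, smul_mean _ hab, intervalIntegral.integral_smul, smul_smul,
    mul_inv_cancel₀ hL0.ne', one_smul, intervalIntegral.integral_deriv_eq_sub
      (fun t _ => hγ.differentiable one_ne_zero t)
      ((hγ.continuous_deriv le_rfl).intervalIntegrable _ _)]

/-- On an equidistant subdivision into `M + 1` cells, the oscillation of the mean directions is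
controlled by the defect. -/
lemma sum_two_sub_le {γ : ℝ → Plane} (hγ : ContDiff ℝ 1 γ) {L : ℝ} (hL0 : 0 < L)
    (hL : ∀ t, ‖deriv γ t‖ = L) {t₀ k r Q : ℝ} (hk : 0 < k) (hkr : 4 * (L * k) ≤ r)
    (hQ0 : 0 ≤ Q) (M : ℕ) (hQ : arcDefect γ t₀ (t₀ + (M + 1) * k) r ≤ ENNReal.ofReal Q) :
    ∑ i ∈ Finset.range M, (2 -
      ‖mean (fun t => L⁻¹ • deriv γ t) (t₀ + i * k) (t₀ + (i + 1) * k) +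
        mean (fun t => L⁻¹ • deriv γ t) (t₀ + (i + 1) * k) (t₀ + (i + 2) * k)‖) ≤
      2 * Q / (r * (L * k)) := by
  set u := fun t => L⁻¹ • deriv γ t with hu
  have hLk : 0 < L * k := by positivity
  have hr : 0 < r := by linarith
  set p : ℕ → ℝ := fun i => t₀ + i * k with hp
  have hpm : Monotone p := by
    intro i j hij
    have : (i : ℝ) ≤ j := by exact_mod_cast hij
    simp only [hp]; nlinarith
  have hu1 : ∀ t, ‖u t‖ = 1 := fun t => by
    simp only [hu]
    rw [norm_smul, hL, norm_inv, Real.norm_of_nonneg hL0.le, inv_mul_cancel₀ hL0.ne']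
  have hstep : ∀ i : ℕ, ENNReal.ofReal (r * (L * k) * (2 - ‖mean u (t₀ + i * k) (t₀ + (i + 1) * k) +
      mean u (t₀ + (i + 1) * k) (t₀ + (i + 2) * k)‖)) ≤ arcDefect γ (p i) (p (i + 2)) r := by
    intro i
    have e0 : p (i + 2) - p i = 2 * k := by simp only [hp]; push_cast; ring
    refine le_trans (ENNReal.ofReal_le_ofReal ?_)
      (le_arcDefect hγ hL (hpm (by omega)) hr (by rw [e0]; linarith))
    rw [e0]
    have e1 : γ (p (i + 2)) - γ (p i) = (L * k) • (mean u (t₀ + i * k) (t₀ + (i + 1) * k) +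
      mean u (t₀ + (i + 1) * k) (t₀ + (i + 2) * k)) := by
      have h1 := sub_eq_smul_mean hγ hL0 (a := t₀ + i * k) (b := t₀ + (i + 1) * k) (by linarith)
      have h2 := sub_eq_smul_mean hγ hL0 (a := t₀ + (i + 1) * k) (b := t₀ + (i + 2) * k) (by linarith)
      have e2 : t₀ + (i + 1) * k - (t₀ + i * k) = k := by ring
      have e3 : t₀ + (i + 2) * k - (t₀ + (i + 1) * k) = k := by ring
      rw [e2] at h1; rw [e3] at h2
      rw [smul_add, ← h1, ← h2]
      simp only [hp]; push_cast; abel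
    rw [e1, norm_smul, Real.norm_of_nonneg hLk.le]
    have h3 : ‖mean u (t₀ + i * k) (t₀ + (i + 1) * k) +
      mean u (t₀ + (i + 1) * k) (t₀ + (i + 2) * k)‖ ≤ 2 := by
      refine (norm_add_le _ _).trans ?_
      have := norm_mean_le hu1 (a := t₀ + i * k) (b := t₀ + (i + 1) * k) (by linarith)
      have := norm_mean_le hu1 (a := t₀ + (i + 1) * k) (b := t₀ + (i + 2) * k) (by linarith)
      linarith
    -- A pair of cells has length `2 * L * k ≤ r / 2`, so at least half of `r` remains in the factor
    -- of `le_arcDefect`.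
    have h4 : r ≤ 2 * (r - L * (2 * k)) := by linarith
    have h5 : 0 ≤ (L * k) * (2 - ‖mean u (t₀ + i * k) (t₀ + (i + 1) * k) +
      mean u (t₀ + (i + 1) * k) (t₀ + (i + 2) * k)‖) := mul_nonneg hLk.le (by linarith)
    calc _ = r * ((L * k) * (2 - ‖mean u (t₀ + i * k) (t₀ + (i + 1) * k) +
      mean u (t₀ + (i + 1) * k) (t₀ + (i + 2) * k)‖)) := by ring
      _ ≤ _ := mul_le_mul_of_nonneg_right h4 h5
      _ = _ := by ring
  have hsum := (Finset.sum_le_sum fun i (_ : i ∈ Finset.range M) => hstep i).trans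
    (sum_arcDefect_pairs_le γ hpm r M)
  have e5 : arcDefect γ (p 0) (p (M + 1)) r = arcDefect γ t₀ (t₀ + (M + 1) * k) r := by
    simp [hp]
  have h6 : arcDefect γ (p 0) (p M) r ≤ arcDefect γ (p 0) (p (M + 1)) r :=
    arcDefect_mono γ (hpm (by omega)) r
  rw [e5] at hsum h6
  have h7 : ∑ i ∈ Finset.range M, ENNReal.ofReal (r * (L * k) * (2 -
      ‖mean u (t₀ + i * k) (t₀ + (i + 1) * k) +
      mean u (t₀ + (i + 1) * k) (t₀ + (i + 2) * k)‖)) ≤ ENNReal.ofReal (2 * Q) := by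
    refine hsum.trans ?_
    rw [two_mul, ENNReal.ofReal_add hQ0 hQ0]
    exact add_le_add hQ (h6.trans hQ)
  rw [← ENNReal.ofReal_sum_of_nonneg, ENNReal.ofReal_le_ofReal_iff (by positivity),
    ← Finset.mul_sum] at h7
  · rw [le_div_iff₀ (by positivity)]; linarith
  · intro i _
    have := norm_mean_le hu1 (a := t₀ + i * k) (b := t₀ + (i + 1) * k) (by linarith)
    have := norm_mean_le hu1 (a := t₀ + (i + 1) * k) (b := t₀ + (i + 2) * k) (by linarith)
    have := norm_add_le (mean u (t₀ + i * k) (t₀ + (i + 1) * k))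
      (mean u (t₀ + (i + 1) * k) (t₀ + (i + 2) * k))
    exact mul_nonneg (by positivity) (by linarith)

/-- If the defect is of third order and the direction is close to `e` in the mean square, then the
set of times at which it is not close to `e` has measure of second order. -/
lemma volume_misaligned_le {γ : ℝ → Plane} (hγ : ContDiff ℝ 1 γ) {L : ℝ} (hL0 : 0 < L)
    (hL : ∀ t, ‖deriv γ t‖ = L) {t₀ t₁ r C : ℝ} (ht : t₀ < t₁) (hr : 0 < r)
    (hrL : r ≤ 2 * L * (t₁ - t₀)) (hC : 0 ≤ C)
    (hD : arcDefect γ t₀ t₁ r ≤ ENNReal.ofReal (C * r ^ 3))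
    {v : ℝ → Plane} (hv : Continuous v) {e : Plane} (he : ‖e‖ = 1) {ε κ η θ : ℝ} (hε : 0 < ε)
    (hκ : (4 * ε) ^ 2 ≤ 2 * (1 - κ)) (hve : ∀ t ∈ Icc t₀ t₁, ‖v t - e‖ ≤ ε) (hθ : 0 < θ)
    (hη : ∫ t in t₀..t₁, ‖L⁻¹ • deriv γ t - v t‖ ^ 2 ≤ η)
    (hsmall : η / (t₁ - t₀) + (θ * (64 * C) + 32 * L * η / θ) / 2 ≤ ε ^ 2) :
    volume (Ioc t₀ t₁ ∩ {t | inner ℝ (L⁻¹ • deriv γ t) e ≤ κ}) ≤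
      ENNReal.ofReal (4 * C * r ^ 2 / (ε ^ 2 * L)) := by
  set u := fun t => L⁻¹ • deriv γ t with hu
  have hγc := hγ.continuous_deriv le_rfl
  have huc : Continuous u := by simp only [hu]; fun_prop
  have hu1 : ∀ t, ‖u t‖ = 1 := fun t => by
    simp only [hu]
    rw [norm_smul, hL, norm_inv, Real.norm_of_nonneg hL0.le, inv_mul_cancel₀ hL0.ne']
  have hT : 0 < t₁ - t₀ := by linarith
  have hη0 : 0 ≤ η := le_trans (intervalIntegral.integral_nonneg ht.le fun t _ => sq_nonneg _) hη
  -- The cells get length between `r / 8` and `r / 4`. There are at least two of them, so every cell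
  -- has a neighbour.
  obtain ⟨M, hM1, hM2⟩ : ∃ M : ℕ, 4 * L * (t₁ - t₀) / r ≤ M + 1 ∧
      (M : ℝ) + 1 ≤ 2 * (4 * L * (t₁ - t₀) / r) ∧ 1 ≤ M := by
    have h2 : 2 ≤ 4 * L * (t₁ - t₀) / r := by rw [le_div_iff₀ hr]; linarith
    refine ⟨⌈4 * L * (t₁ - t₀) / r⌉₊ - 1, ?_, ?_, ?_⟩
    all_goals
      have h3 : 2 ≤ ⌈4 * L * (t₁ - t₀) / r⌉₊ := by
        have := (h2.trans (Nat.le_ceil _)); exact_mod_cast this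
    · rw [Nat.cast_sub (by omega)]; push_cast; linarith [Nat.le_ceil (4 * L * (t₁ - t₀) / r)]
    · rw [Nat.cast_sub (by omega)]; push_cast
      linarith [Nat.ceil_lt_add_one (a := 4 * L * (t₁ - t₀) / r) (by linarith)]
    · omega
  obtain ⟨hM2, hM3⟩ := hM2
  set k := (t₁ - t₀) / (M + 1) with hkdef
  have hM0 : (0 : ℝ) < M + 1 := by positivity
  have hk : 0 < k := by positivity
  have hkM : (M + 1) * k = t₁ - t₀ := by rw [hkdef]; field_simp
  have hk1 : 4 * (L * k) ≤ r := by
    rw [div_le_iff₀ hr] at hM1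
    have : (M + 1) * (4 * (L * k)) ≤ (M + 1) * r := by
      calc _ = 4 * L * ((M + 1) * k) := by ring
        _ ≤ _ := by rw [hkM]; exact hM1
    exact le_of_mul_le_mul_left this hM0
  have hk2 : r ≤ 8 * (L * k) := by
    rw [← mul_div_assoc, le_div_iff₀ hr] at hM2
    have : (M + 1) * r ≤ (M + 1) * (8 * (L * k)) := by
      calc _ ≤ _ := hM2
        _ = 8 * L * ((M + 1) * k) := by rw [hkM]; ring
        _ = _ := by ring
    exact le_of_mul_le_mul_left this hM0
  have hend : t₀ + (M + 1) * k = t₁ := by rw [hkM]; ring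
  have hS := sum_two_sub_le hγ hL0 hL (t₀ := t₀) hk hk1 (Q := C * r ^ 3) (by positivity) M
    (by rw [hend]; exact hD)
  set m : ℕ → Plane := fun i => mean u (t₀ + i * k) (t₀ + (i + 1) * k) with hm
  have hm1 : ∀ i, ‖m i‖ ≤ 1 := fun i => norm_mean_le hu1 (by linarith)
  have hms : ∀ i : ℕ, mean u (t₀ + (i + 1) * k) (t₀ + (i + 2) * k) = m (i + 1) := fun i => by
    simp only [hm]; push_cast; congr 2; ring
  change ∑ i ∈ Finset.range M, (2 - ‖m i + mean u (t₀ + (i + 1) * k) (t₀ + (i + 2) * k)‖) ≤ _ at hS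
  simp_rw [hms] at hS
  have hQ : 2 * (C * r ^ 3) / (r * (L * k)) ≤ 16 * C * r := by
    rw [div_le_iff₀ (by positivity)]
    have : 0 ≤ 2 * C * r ^ 2 := by positivity
    nlinarith
  -- oscillation of the means
  set f : ℕ → ℝ := fun i => max (‖m i - e‖ - ε) 0 with hf
  have hA : ∑ i ∈ Finset.range M, (f (i + 1) - f i) ^ 2 ≤ 64 * C * r := by
    calc _ ≤ ∑ i ∈ Finset.range M, 4 * (2 - ‖m i + m (i + 1)‖) := by
          refine Finset.sum_le_sum fun i _ => ?_
          refine le_trans ?_ (norm_add_le_two_sub (hm1 i) (hm1 (i + 1)))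
          rw [← sq_abs]
          refine pow_le_pow_left₀ (abs_nonneg _) ?_ 2
          calc |f (i + 1) - f i| ≤ |(‖m (i + 1) - e‖ - ε) - (‖m i - e‖ - ε)| :=
                abs_max_sub_max_le_abs _ _ _
            _ = |‖m (i + 1) - e‖ - ‖m i - e‖| := by congr 1; ring
            _ ≤ ‖(m (i + 1) - e) - (m i - e)‖ := abs_norm_sub_norm_le _ _
            _ = ‖m i - m (i + 1)‖ := by rw [norm_sub_rev]; congr 1; abel
      _ = 4 * ∑ i ∈ Finset.range M, (2 - ‖m i + m (i + 1)‖) := by rw [Finset.mul_sum]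
      _ ≤ _ := by linarith
  have hB : ∑ i ∈ Finset.range (M + 1), f i ^ 2 ≤ η / k := by
    calc _ ≤ ∑ i ∈ Finset.range (M + 1),
          k⁻¹ * ∫ t in (t₀ + (i : ℕ) * k)..(t₀ + ((i + 1 : ℕ) : ℝ) * k), ‖u t - v t‖ ^ 2 := by
          refine Finset.sum_le_sum fun i hi => ?_
          have h3 := excess_mean_sq_le huc hv (e := e) (a := t₀ + i * k) (b := t₀ + (i + 1) * k)
            (ε := ε) (by linarith) (fun t hti => hve t ⟨?_, ?_⟩)
          · rw [show t₀ + (i + 1) * k - (t₀ + i * k) = k by ring] at h3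
            push_cast
            exact h3
          · have : 0 ≤ (i : ℝ) * k := by positivity
            linarith [hti.1]
          · have : (i : ℝ) + 1 ≤ M + 1 := by
              have := Finset.mem_range.1 hi
              exact_mod_cast this
            have : ((i : ℝ) + 1) * k ≤ (M + 1) * k := mul_le_mul_of_nonneg_right this hk.le
            linarith [hti.2]
      _ = k⁻¹ * ∫ t in t₀..t₁, ‖u t - v t‖ ^ 2 := by
          rw [← Finset.mul_sum, intervalIntegral.sum_integral_adjacent_intervals
            (a := fun i : ℕ => t₀ + (i : ℝ) * k) (fun i _ => Continuous.intervalIntegrable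
              (by fun_prop) _ _)]
          congr 2
          · simp
          · push_cast; rw [hend]
      _ ≤ _ := by rw [div_eq_inv_mul]; gcongr
  -- The increments of `f` have square sum `O(r)`, the values only `η / k = O(η / r)`. The weight `θ
  -- / r` in the interpolation inequality balances the two powers of `r`.
  have hclose : ∀ j ≤ M, ‖m j - e‖ ≤ 2 * ε := by
    intro j hj
    have h4 := sq_le_of_sum_sq M (θ := θ / r) (by positivity) hA hB hj
    have h5 : f j ^ 2 ≤ ε ^ 2 := by
      refine h4.trans (le_trans ?_ hsmall)
      have e1 : η / k / (M + 1) = η / (t₁ - t₀) := by rw [div_div, mul_comm k, hkM]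
      have e2 : θ / r * (64 * C * r) = θ * (64 * C) := by field_simp
      have e3 : 4 * (η / k) / (θ / r) ≤ 32 * L * η / θ := by
        rw [show 4 * (η / k) / (θ / r) = (4 * η * r) / (k * θ) by field_simp,
          div_le_div_iff₀ (by positivity) hθ]
        have : 4 * η * θ * r ≤ 4 * η * θ * (8 * (L * k)) :=
          mul_le_mul_of_nonneg_left hk2 (by positivity)
        linarith
      rw [e1, e2]; linarith
    have h6 : f j ≤ ε := le_of_sq_le_sq h5 hε.le
    have h7 : ‖m j - e‖ - ε ≤ f j := le_max_left _ _
    linarith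
  -- measure of the misaligned times
  have hcover : Ioc t₀ t₁ ∩ {t | inner ℝ (u t) e ≤ κ} ⊆ ⋃ i ∈ Finset.range (M + 1),
      Ioc (t₀ + (i : ℕ) * k) (t₀ + (i + 1) * k) ∩ {t | inner ℝ (u t) e ≤ κ} := by
    rintro t ⟨ht1, ht2⟩
    have hpos : 0 < (t - t₀) / k := div_pos (by linarith [ht1.1]) hk
    have hc1 : 1 ≤ ⌈(t - t₀) / k⌉₊ := Nat.one_le_iff_ne_zero.2 (Nat.ceil_pos.2 hpos).ne'
    have hc2 : ⌈(t - t₀) / k⌉₊ ≤ M + 1 := by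
      rw [Nat.ceil_le, div_le_iff₀ hk]; push_cast; rw [hkM]; linarith [ht1.2]
    simp only [mem_iUnion, Finset.mem_range]
    refine ⟨⌈(t - t₀) / k⌉₊ - 1, by omega, ⟨?_, ?_⟩, ht2⟩
    · have h8 := Nat.ceil_lt_add_one hpos.le
      have : ((⌈(t - t₀) / k⌉₊ - 1 : ℕ) : ℝ) < (t - t₀) / k := by
        rw [Nat.cast_sub hc1]; push_cast; linarith
      rw [lt_div_iff₀ hk] at this
      linarith
    · have h8 := Nat.le_ceil ((t - t₀) / k)
      rw [div_le_iff₀ hk] at h8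
      rw [Nat.cast_sub hc1]; push_cast; linarith
  -- Each `1 - ‖m i‖` is controlled by the pair with the next cell; the last cell uses its
  -- predecessor. This doubles the bound `16 * C * r`.
  have hlast : ∑ i ∈ Finset.range (M + 1), (1 - ‖m i‖) ≤ 32 * C * r := by
    have hpair : ∀ i, 1 - ‖m i‖ ≤ 2 - ‖m i + m (i + 1)‖ ∧
        1 - ‖m (i + 1)‖ ≤ 2 - ‖m i + m (i + 1)‖ := fun i => by
      have := norm_add_le (m i) (m (i + 1))
      constructor <;> linarith [hm1 i, hm1 (i + 1)]
    obtain ⟨M', rfl⟩ : ∃ M', M = M' + 1 := ⟨M - 1, by omega⟩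
    have h9 : 1 - ‖m (M' + 1)‖ ≤ ∑ i ∈ Finset.range (M' + 1), (2 - ‖m i + m (i + 1)‖) := by
      refine (hpair M').2.trans (Finset.single_le_sum (f := fun i => 2 - ‖m i + m (i + 1)‖)
        (fun i _ => ?_) (by simp))
      have := (hpair i).1; have := hm1 i; linarith
    rw [Finset.sum_range_succ]
    have h10 := Finset.sum_le_sum fun i (_ : i ∈ Finset.range (M' + 1)) => (hpair i).1
    linarith
  calc _ ≤ _ := measure_mono hcover
    _ ≤ ∑ i ∈ Finset.range (M + 1), volume (Ioc (t₀ + (i : ℕ) * k) (t₀ + (i + 1) * k) ∩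
        {t | inner ℝ (u t) e ≤ κ}) := measure_biUnion_finset_le _ _
    _ ≤ ∑ i ∈ Finset.range (M + 1), ENNReal.ofReal (k * (1 - ‖m i‖) / (2 * ε ^ 2)) := by
        refine Finset.sum_le_sum fun i hi => ?_
        have h11 := volume_misaligned_cell_le huc hu1 he (a := t₀ + (i : ℕ) * k)
          (b := t₀ + (i + 1) * k) (by linarith) hε hκ
          (hclose i (by have := Finset.mem_range.1 hi; omega))
        rwa [show t₀ + (i + 1) * k - (t₀ + i * k) = k by ring] at h11
    _ = ENNReal.ofReal (k / (2 * ε ^ 2) * ∑ i ∈ Finset.range (M + 1), (1 - ‖m i‖)) := by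
        rw [← ENNReal.ofReal_sum_of_nonneg, Finset.mul_sum]
        · congr 1; refine Finset.sum_congr rfl fun i _ => by ring
        · intro i _
          have := hm1 i
          exact div_nonneg (mul_nonneg hk.le (by linarith)) (by positivity)
    _ ≤ _ := by
        refine ENNReal.ofReal_le_ofReal ?_
        have hlast' : ∑ i ∈ Finset.range (M + 1), (1 - ‖m i‖) ≤ 32 * C * r := hlast
        calc _ ≤ k / (2 * ε ^ 2) * (32 * C * r) := by gcongr
          _ = (4 * (L * k)) * (4 * C * r) / (ε ^ 2 * L) := by field_simp; ring
          _ ≤ r * (4 * C * r) / (ε ^ 2 * L) := by gcongr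
          _ = _ := by ring

/-! ### Times after which a function stays above its current value -/

/-- The times `τ` in `[t₀, t₁]` after which `f` does not fall below `f τ`. -/
def futureMinTimes (f : ℝ → ℝ) (t₀ t₁ : ℝ) : Set ℝ := {τ | τ ∈ Icc t₀ t₁ ∧ ∀ t ∈ Icc τ t₁, f τ ≤ f t}

/-- Replacing `t` by `max τ t` turns the condition over the moving interval into an intersection of
closed conditions. -/
lemma isClosed_futureMinTimes {f : ℝ → ℝ} (hf : Continuous f) (t₀ t₁ : ℝ) :
    IsClosed (futureMinTimes f t₀ t₁) := by
  have : futureMinTimes f t₀ t₁ = Icc t₀ t₁ ∩ ⋂ t ∈ Iic t₁, {τ | f τ ≤ f (max τ t)} := by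
    ext τ
    simp only [futureMinTimes, mem_ofPred_eq, mem_inter_iff, mem_iInter, mem_Iic]
    refine and_congr_right fun hτ => ⟨fun h t ht => h _ ⟨le_max_left _ _, max_le hτ.2 ht⟩,
      fun h t ht => ?_⟩
    have := h t ht.2
    rwa [max_eq_right ht.1] at this
  rw [this]
  refine isClosed_Icc.inter (isClosed_biInter fun t _ => isClosed_le hf (by fun_prop))

/-- The last time at which `f ≤ y` is a future minimum, and by continuity its value is `y`. -/
lemma Icc_subset_image_futureMinTimes {f : ℝ → ℝ} (hf : Continuous f) {t₀ t₁ : ℝ} (h : t₀ ≤ t₁) :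
    Icc (f t₀) (f t₁) ⊆ f '' futureMinTimes f t₀ t₁ := by
  intro y hy
  set S := Icc t₀ t₁ ∩ {t | f t ≤ y} with hS
  have hSc : IsCompact S := isCompact_Icc.inter_right (isClosed_le hf continuous_const)
  obtain ⟨τ, hτS, hτ⟩ := hSc.exists_isGreatest ⟨t₀, ⟨left_mem_Icc.2 h, hy.1⟩⟩
  have hafter : ∀ t, τ < t → t ≤ t₁ → y < f t := by
    intro t h1 h2
    by_contra! h3
    exact absurd (hτ ⟨⟨hτS.1.1.trans h1.le, h2⟩, h3⟩) (not_le.2 h1)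
  have hfτ : f τ = y := by
    refine le_antisymm hτS.2 ?_
    rcases eq_or_lt_of_le hτS.1.2 with h1 | h1
    · rw [h1]; exact hy.2
    · have hev : ∀ᶠ t in 𝓝[>] τ, y ≤ f t := by
        filter_upwards [Ioc_mem_nhdsGT h1] with t ht
        exact (hafter t ht.1 ht.2).le
      exact ge_of_tendsto (hf.continuousAt.tendsto.mono_left nhdsWithin_le_nhds) hev
  refine ⟨τ, ⟨hτS.1, fun t ht => ?_⟩, hfτ⟩
  rcases eq_or_lt_of_le ht.1 with h1 | h1
  · rw [h1]
  · rw [hfτ]; exact (hafter t h1 ht.2).le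

lemma deriv_nonneg_of_futureMin {f : ℝ → ℝ} (hf : Differentiable ℝ f) {t₀ t₁ τ : ℝ}
    (hτ : τ ∈ futureMinTimes f t₀ t₁) (h : τ < t₁) : 0 ≤ deriv f τ := by
  have h1 : Tendsto (slope f τ) (𝓝[>] τ) (𝓝 (deriv f τ)) :=
    ((hasDerivAt_iff_tendsto_slope.1 (hf τ).hasDerivAt).mono_left
      (nhdsWithin_mono _ fun x hx => ne_of_gt hx))
  refine ge_of_tendsto h1 ?_
  filter_upwards [Ioc_mem_nhdsGT h] with t ht
  rw [slope_def_field]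
  exact div_nonneg (by linarith [hτ.2 t ⟨ht.1.le, ht.2⟩]) (by linarith [ht.1])

/-- The future minima already cover every value between `f t₀` and `f t₁`, and `f` has non-negative
derivative there except possibly at `t₁`. So their part of the integral is at least the net
increase, which leaves a non-positive remainder. -/
lemma integral_compl_futureMinTimes_nonpos {f : ℝ → ℝ} (hf : ContDiff ℝ 1 f) {t₀ t₁ : ℝ}
    (h : t₀ ≤ t₁) : ∫ t in Icc t₀ t₁ \ futureMinTimes f t₀ t₁, deriv f t ≤ 0 := by
  have hfd := hf.differentiable one_ne_zero
  have hfc := hf.continuous_deriv le_rfl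
  set R := futureMinTimes f t₀ t₁ with hR
  have hRm : MeasurableSet R := (isClosed_futureMinTimes hf.continuous _ _).measurableSet
  have hRsub : R ⊆ Icc t₀ t₁ := fun τ hτ => hτ.1
  have hInt : IntegrableOn (deriv f) (Icc t₀ t₁) := hfc.integrableOn_Icc
  have h1 : ENNReal.ofReal (f t₁ - f t₀) ≤ ∫⁻ t in R, ENNReal.ofReal |deriv f t| := by
    calc ENNReal.ofReal (f t₁ - f t₀) = volume (Icc (f t₀) (f t₁)) := by rw [Real.volume_Icc]
      _ ≤ volume (f '' R) := measure_mono (Icc_subset_image_futureMinTimes hf.continuous h)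
      _ ≤ ∫⁻ t in R, ENNReal.ofReal |(ContinuousLinearMap.toSpanSingleton ℝ (deriv f t)).det| :=
          addHaar_image_le_lintegral_abs_det_fderiv volume hRm
            fun t _ => (hfd t).hasDerivAt.hasFDerivAt.hasFDerivWithinAt
      _ = _ := by simp
  have hne : ∀ᵐ t ∂(volume.restrict R), 0 ≤ deriv f t := by
    have h2 : ∀ᵐ t ∂(volume.restrict R), t ≠ t₁ := by
      refine ae_restrict_of_ae ?_
      simp [ae_iff, measure_singleton]
    filter_upwards [ae_restrict_mem hRm, h2] with t ht1 ht2
    exact deriv_nonneg_of_futureMin hfd ht1 (lt_of_le_of_ne ht1.1.2 ht2)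
  have h3 : ∫⁻ t in R, ENNReal.ofReal |deriv f t| = ENNReal.ofReal (∫ t in R, deriv f t) := by
    rw [ofReal_integral_eq_lintegral_ofReal (hInt.mono_set hRsub) hne]
    refine lintegral_congr_ae ?_
    filter_upwards [hne] with t ht
    rw [abs_of_nonneg ht]
  rw [h3] at h1
  have h4 : f t₁ - f t₀ ≤ ∫ t in R, deriv f t := by
    rcases le_total (f t₁ - f t₀) 0 with h5 | h5
    · exact h5.trans (integral_nonneg_of_ae hne)
    · exact (ENNReal.ofReal_le_ofReal_iff (integral_nonneg_of_ae hne)).1 h1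
  have h5 : ∫ t in Icc t₀ t₁, deriv f t = f t₁ - f t₀ := by
    rw [integral_Icc_eq_integral_Ioc, ← intervalIntegral.integral_of_le h,
      intervalIntegral.integral_deriv_eq_sub (fun t _ => hfd t) (hfc.intervalIntegrable _ _)]
  rw [setIntegral_sdiff hRm hInt hRsub, h5]
  linarith

/-- Off the future minima, growth at rate `1 / 8` on `A` must be offset by decline at rate at most
`7 / 4` off `A`. So the part in `A` has at most `14` times the measure of the part outside, and `15
= 14 + 1`. -/
lemma volume_compl_futureMinTimes_le {f : ℝ → ℝ} (hf : ContDiff ℝ 1 f) {t₀ t₁ : ℝ}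
    (h : t₀ ≤ t₁) {A : Set ℝ} (hA : MeasurableSet A) (h1 : ∀ t ∈ A, 1 / 8 ≤ deriv f t)
    (h2 : ∀ t, -(7 / 4) ≤ deriv f t) :
    volume.real (Icc t₀ t₁ \ futureMinTimes f t₀ t₁) ≤ 15 * volume.real (Icc t₀ t₁ \ A) := by
  have h0 := integral_compl_futureMinTimes_nonpos hf h
  set R := futureMinTimes f t₀ t₁ with hR
  have hRm : MeasurableSet R := (isClosed_futureMinTimes hf.continuous _ _).measurableSet
  have hfc := hf.continuous_deriv le_rfl
  set T := Icc t₀ t₁ \ R with hT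
  have hTm : MeasurableSet T := measurableSet_Icc.diff hRm
  have hTsub : T ⊆ Icc t₀ t₁ := sdiff_subset
  have hfin : volume T ≠ ⊤ := (lt_of_le_of_lt (measure_mono hTsub) (by simp)).ne
  have hInt : IntegrableOn (deriv f) T := hfc.integrableOn_Icc.mono_set hTsub
  have e1 : ∫ t in T, deriv f t = (∫ t in T ∩ A, deriv f t) + ∫ t in T \ A, deriv f t :=
    (integral_inter_add_sdiff hA hInt).symm
  have fin1 : volume (T ∩ A) ≠ ⊤ := (lt_of_le_of_lt (measure_mono inter_subset_left) hfin.lt_top).ne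
  have fin2 : volume (T \ A) ≠ ⊤ := (lt_of_le_of_lt (measure_mono sdiff_subset) hfin.lt_top).ne
  have e2 : 1 / 8 * volume.real (T ∩ A) ≤ ∫ t in T ∩ A, deriv f t := by
    have := setIntegral_mono_on (μ := volume) (f := fun _ => (1 / 8 : ℝ))
      (integrableOn_const fin1) (hInt.mono_set inter_subset_left) (hTm.inter hA)
      fun t ht => h1 t ht.2
    rw [setIntegral_const, smul_eq_mul] at this; linarith
  have e3 : -(7 / 4) * volume.real (T \ A) ≤ ∫ t in T \ A, deriv f t := by
    have := setIntegral_mono_on (μ := volume) (f := fun _ => (-(7 / 4) : ℝ))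
      (integrableOn_const fin2) (hInt.mono_set sdiff_subset) (hTm.diff hA)
      fun t _ => h2 t
    rw [setIntegral_const, smul_eq_mul] at this; linarith
  have e4 : volume.real T = volume.real (T ∩ A) + volume.real (T \ A) :=
    (measureReal_inter_add_sdiff hA hfin).symm
  have e5 : volume.real (T \ A) ≤ volume.real (Icc t₀ t₁ \ A) :=
    measureReal_mono (sdiff_subset_sdiff_left hTsub)
      (lt_of_le_of_lt (measure_mono sdiff_subset) (by simp)).ne
  linarith

/-! ### The sharp lower bound by duality -/

/-- The lower bound for the loss of length in a window by means of a linear competitor. -/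
lemma le_windowGap {γ : ℝ → Plane} (hγ : ContDiff ℝ 1 γ) {L : ℝ} (hL0 : 0 < L)
    (hL : ∀ t, ‖deriv γ t‖ = L) (φ₀ δ : ℝ) {h : ℝ} (hh : 0 ≤ h) (τ : ℝ) (ψ : Plane) :
    (∫ t in τ..(τ + h), (t - τ - h / 2) * inner ℝ (L⁻¹ • deriv γ t) ψ) - ‖ψ‖ ^ 2 * h ^ 3 / 24
      - h * ‖ψ‖ * volume.real (Ioc τ (τ + h) \ alignedTimes γ L φ₀ δ) ≤
      windowGap γ L φ₀ δ h τ := by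
  set A := alignedTimes γ L φ₀ δ with hA
  have hAm : MeasurableSet A := measurableSet_alignedTimes hγ _ _ _
  set W := Ioc τ (τ + h) with hW
  set u := fun t => L⁻¹ • deriv γ t with hu
  have hγc := hγ.continuous_deriv le_rfl
  have huc : Continuous u := by simp only [hu]; fun_prop
  have hu1 : ∀ t, ‖u t‖ = 1 := fun t => by
    simp only [hu]
    rw [norm_smul, hL, norm_inv, Real.norm_of_nonneg hL0.le, inv_mul_cancel₀ hL0.ne']
  have hle : τ ≤ τ + h := by linarith
  have hI : ∀ {f : ℝ → ℝ}, Continuous f → IntegrableOn f W := fun hf =>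
    hf.integrableOn_Icc.mono_set Ioc_subset_Icc_self
  have hIp : IntegrableOn u W := huc.integrableOn_Icc.mono_set Ioc_subset_Icc_self
  have hWfin : volume W ≠ ⊤ := by simp [hW]
  have fin1 : volume (W ∩ A) ≠ ⊤ := (lt_of_le_of_lt (measure_mono inter_subset_left) hWfin.lt_top).ne
  have fin2 : volume (W \ A) ≠ ⊤ := (lt_of_le_of_lt (measure_mono sdiff_subset) hWfin.lt_top).ne
  have hWA : MeasurableSet (W ∩ A) := measurableSet_Ioc.inter hAm
  -- With `e` a unit vector in the direction of the mean aligned tangent, the gap becomes the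
  -- integral of `1 - inner e (u t)`.
  obtain ⟨β, hβ⟩ := exists_eq_norm_smul_dir (∫ t in W ∩ A, u t)
  set e := dir β with he
  have he1 : ‖e‖ = 1 := norm_dir β
  have hgap : windowGap γ L φ₀ δ h τ = ∫ t in W ∩ A, (1 - inner ℝ e (u t)) := by
    have c1 : IntegrableOn (fun _ : ℝ => (1 : ℝ)) (W ∩ A) := integrableOn_const fin1
    have c2 : IntegrableOn (fun t => (inner ℝ e (u t) : ℝ)) (W ∩ A) :=
      (hI (by fun_prop)).mono_set inter_subset_left
    rw [integral_sub c1 c2, setIntegral_const, smul_eq_mul, mul_one, integral_inner (hIp.mono_set inter_subset_left)]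
    unfold windowGap
    congr 1
    change ‖∫ t in W ∩ A, u t‖ = _
    nth_rewrite 2 [hβ]
    rw [inner_smul_right, real_inner_self_eq_norm_sq, he1]; ring
  set g : ℝ → ℝ := fun t => (t - τ - h / 2) * inner ℝ (u t) ψ - (t - τ - h / 2) * inner ℝ e ψ
    with hg
  set q : ℝ → ℝ := fun t => (t - τ - h / 2) ^ 2 * ‖ψ‖ ^ 2 / 2 with hq
  have hgc : Continuous g := by simp only [hg]; fun_prop
  have hqc : Continuous q := by simp only [hq]; fun_prop
  -- Expand `‖u t - e - s • ψ‖² ≥ 0` with `s = t - τ - h / 2`: the tangent is compared with one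
  -- turning at constant rate `ψ`.
  have hpt : ∀ t, g t - q t ≤ 1 - inner ℝ e (u t) := by
    intro t
    have h1 : 0 ≤ ‖u t - e - (t - τ - h / 2) • ψ‖ ^ 2 := sq_nonneg _
    rw [norm_sub_sq_real, norm_sub_sq_real, hu1, he1, inner_smul_right, norm_smul, mul_pow,
      inner_sub_left, real_inner_comm] at h1
    simp only [hg, hq]
    rw [Real.norm_eq_abs, sq_abs] at h1
    linarith
  have h1 : ∫ t in W ∩ A, (g t - q t) ≤ windowGap γ L φ₀ δ h τ := by
    rw [hgap]
    exact setIntegral_mono ((hI (by fun_prop)).mono_set inter_subset_left)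
      ((hI (by fun_prop)).mono_set inter_subset_left) hpt
  rw [integral_sub ((hI hgc).mono_set inter_subset_left)
    ((hI hqc).mono_set inter_subset_left)] at h1
  -- The second moment of a window about its midpoint is `h³ / 12`.
  have h2 : ∫ t in W ∩ A, q t ≤ ‖ψ‖ ^ 2 * h ^ 3 / 24 := by
    calc _ ≤ ∫ t in W, q t := setIntegral_mono_set (hI hqc)
          (ae_of_all _ fun t => by simp only [hq]; positivity) inter_subset_left.eventuallyLE
      _ = ∫ t in τ..(τ + h), q t := (intervalIntegral.integral_of_le hle).symm
      _ = ‖ψ‖ ^ 2 / 2 * ∫ t in τ..(τ + h), (t - (τ + h / 2)) ^ 2 := by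
          rw [← intervalIntegral.integral_const_mul]
          refine intervalIntegral.integral_congr fun t _ => ?_
          simp only [hq]; ring
      _ = _ := by
          rw [intervalIntegral.integral_comp_sub_right (fun t => t ^ 2), integral_pow]
          ring
  have h3 : |∫ t in W \ A, g t| ≤ h * ‖ψ‖ * volume.real (W \ A) := by
    rw [← Real.norm_eq_abs]
    refine norm_setIntegral_le_of_norm_le_const fin2.lt_top fun t ht => ?_
    have h4 : |t - τ - h / 2| ≤ h / 2 := by
      rw [abs_le]; constructor <;> linarith [ht.1.1, ht.1.2]
    have h5 : ‖u t - e‖ ≤ 2 := (norm_sub_le _ _).trans (by rw [hu1, he1]; norm_num)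
    have h6 : g t = (t - τ - h / 2) * inner ℝ (u t - e) ψ := by
      simp only [hg]; rw [inner_sub_left]; ring
    rw [h6, norm_mul, Real.norm_eq_abs]
    calc _ ≤ h / 2 * (2 * ‖ψ‖) := by
          refine mul_le_mul h4 ?_ (norm_nonneg _) (by linarith)
          refine (norm_inner_le_norm _ _).trans ?_
          gcongr
      _ = _ := by ring
  have h4 : (∫ t in W ∩ A, g t) + ∫ t in W \ A, g t =
      ∫ t in τ..(τ + h), (t - τ - h / 2) * inner ℝ (u t) ψ := by
    rw [integral_inter_add_sdiff hAm (hI hgc), hW, ← intervalIntegral.integral_of_le hle]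
    simp only [hg]
    rw [intervalIntegral.integral_sub (Continuous.intervalIntegrable (by fun_prop) _ _)
      (Continuous.intervalIntegrable (by fun_prop) _ _), intervalIntegral.integral_mul_const]
    -- Centring at the midpoint removes the unknown direction `e`.
    have : ∫ t in τ..(τ + h), (t - τ - h / 2) = 0 := by
      have e1 : ∀ t, t - τ - h / 2 = t - (τ + h / 2) := fun t => by ring
      simp_rw [e1]
      rw [intervalIntegral.integral_comp_sub_right (fun t => t), integral_id]; ring
    rw [this]; ring
  have h5 := (abs_le.1 h3).2
  linarith

lemma setIntegral_setIntegral_swap {F : ℝ → ℝ → ℝ} (hF : Measurable (Function.uncurry F))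
    {a b c d C : ℝ} (hC : ∀ x, ∀ y ∈ Ioc c d, |F x y| ≤ C) :
    ∫ x in Ioc a b, ∫ y in Ioc c d, F x y = ∫ y in Ioc c d, ∫ x in Ioc a b, F x y := by
  refine integral_integral_swap ?_
  refine Integrable.of_bound hF.aestronglyMeasurable C ?_
  rw [Measure.prod_restrict]
  filter_upwards [ae_restrict_mem (measurableSet_Ioc.prod measurableSet_Ioc)] with p hp
  exact hC _ _ hp.2

lemma ofReal_integral_le_lintegral {α : Type*} [MeasurableSpace α] {μ : Measure α} {f : α → ℝ}
    (hf : Integrable f μ) : ENNReal.ofReal (∫ x, f x ∂μ) ≤ ∫⁻ x, ENNReal.ofReal (f x) ∂μ := by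
  have h1 : ∫ x, f x ∂μ ≤ ∫ x, max (f x) 0 ∂μ :=
    integral_mono hf hf.pos_part fun x => le_max_left _ _
  refine (ENNReal.ofReal_le_ofReal h1).trans ?_
  rw [ofReal_integral_eq_lintegral_ofReal hf.pos_part (ae_of_all _ fun x => le_max_right _ _)]
  refine le_of_eq (lintegral_congr fun x => ?_)
  rcases le_total (f x) 0 with h | h
  · rw [max_eq_right h, ENNReal.ofReal_of_nonpos h, ENNReal.ofReal_zero]
  · rw [max_eq_left h]

lemma windowMeasure_eq {B : Set ℝ} (hB : MeasurableSet B) {h : ℝ} (hh : 0 ≤ h) (τ : ℝ) :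
    volume.real (Ioc τ (τ + h) ∩ B) = ∫ σ in Ioc 0 h, B.indicator (fun _ => (1 : ℝ)) (τ + σ) := by
  rw [← intervalIntegral.integral_of_le hh,
    intervalIntegral.integral_comp_add_left (fun t => B.indicator (fun _ => (1 : ℝ)) t), add_zero,
    intervalIntegral.integral_of_le (by linarith), setIntegral_indicator hB, setIntegral_const,
    smul_eq_mul, mul_one]

/-- Fubini: a time belongs to the windows of a set of starting times of measure at most `h`. -/
lemma integral_windowMeasure_le {B : Set ℝ} (hB : MeasurableSet B) {h a b : ℝ} (hh : 0 ≤ h)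
    (hab : a ≤ b - h) :
    ∫ τ in Ioc a (b - h), volume.real (Ioc τ (τ + h) ∩ B) ≤ h * volume.real (Icc a b ∩ B) := by
  simp_rw [windowMeasure_eq hB hh]
  have hm : Measurable (B.indicator (fun _ => (1 : ℝ))) := measurable_const.indicator hB
  rw [setIntegral_setIntegral_swap (C := 1)]
  · calc _ ≤ ∫ σ in Ioc 0 h, volume.real (Icc a b ∩ B) := by
          refine setIntegral_mono_on ?_ ?_ measurableSet_Ioc fun σ hσ => ?_
          · have hm2 : Measurable (Function.uncurry fun σ τ => B.indicator (fun _ => (1 : ℝ)) (τ + σ)) :=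
              hm.comp (measurable_snd.add measurable_fst)
            refine Integrable.of_bound (C := volume.real (Ioc a (b - h)))
              hm2.stronglyMeasurable.integral_prod_right.aestronglyMeasurable
              (ae_of_all _ fun σ => ?_)
            refine (norm_setIntegral_le_of_norm_le_const (C := 1) (by simp) fun τ _ => ?_).trans
              (by simp)
            by_cases hx : τ + σ ∈ B <;> simp [hx]
          · exact integrableOn_const (by simp)
          · rw [← intervalIntegral.integral_of_le hab, intervalIntegral.integral_comp_add_right
              (fun t => B.indicator (fun _ => (1 : ℝ)) t), intervalIntegral.integral_of_le
              (by linarith), setIntegral_indicator hB, setIntegral_const, smul_eq_mul, mul_one]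
            refine measureReal_mono (inter_subset_inter_left _ fun t ht => ?_)
              (lt_of_le_of_lt (measure_mono inter_subset_left) (by simp)).ne
            exact ⟨by linarith [ht.1, hσ.1], by linarith [ht.2, hσ.2]⟩
      _ = _ := by rw [setIntegral_const, smul_eq_mul]; simp [hh]
  · exact hm.comp (measurable_fst.add measurable_snd)
  · intro x y _
    by_cases hx : x + y ∈ B <;> simp [hx]

/-- The integral over all windows of the first moment of `u`, tested with `ψ`. -/
lemma le_integral_moment {u ψ : ℝ → Plane} (hu : Continuous u) (hu1 : ∀ t, ‖u t‖ = 1)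
    (hψ : ContDiff ℝ 1 ψ) {t₀ t₁ h K₂ : ℝ} (hh : 0 < h) (ht : t₀ ≤ t₁ - h)
    (hsupp : ∀ t, ψ t ≠ 0 → t ∈ Ioc t₀ (t₁ - h)) {K : ℝ} (hK : ∀ t, ‖ψ t‖ ≤ K)
    (hK2 : ∀ t, ∀ σ ∈ Ioc 0 h, ‖ψ (t - σ) - ψ t + σ • deriv ψ t‖ ≤ K₂ * σ ^ 2) :
    -(h ^ 3 / 12 * ∫ t in t₀..t₁, (inner ℝ (u t) (deriv ψ t) : ℝ)) - K₂ * h ^ 4 * (t₁ - t₀) ≤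
      ∫ τ in Ioc t₀ (t₁ - h), ∫ t in τ..(τ + h), (t - τ - h / 2) * inner ℝ (u t) (ψ τ) := by
  have hψc := hψ.continuous
  have hψd := hψ.continuous_deriv le_rfl
  have ht' : t₀ ≤ t₁ := by linarith
  have hK0 : 0 ≤ K := (norm_nonneg _).trans (hK 0)
  have hK20 : 0 ≤ K₂ := by
    have := (norm_nonneg _).trans (hK2 0 h ⟨hh, le_rfl⟩)
    by_contra! hneg
    nlinarith [sq_pos_of_pos hh]
  have e1 : ∀ τ, ∫ t in τ..(τ + h), (t - τ - h / 2) * inner ℝ (u t) (ψ τ) =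
      ∫ σ in Ioc 0 h, (σ - h / 2) * inner ℝ (u (τ + σ)) (ψ τ) := by
    intro τ
    have := intervalIntegral.integral_comp_add_left (a := 0) (b := h)
      (fun t => (t - τ - h / 2) * inner ℝ (u t) (ψ τ)) τ
    rw [add_zero] at this
    rw [← this, intervalIntegral.integral_of_le hh.le]
    refine setIntegral_congr_fun measurableSet_Ioc fun σ _ => ?_
    simp
  simp_rw [e1]
  rw [setIntegral_setIntegral_swap (C := h / 2 * K)]
  rotate_left
  · refine Continuous.measurable ?_
    simp only [Function.uncurry_def]
    fun_prop
  · intro τ σ hσ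
    rw [abs_mul]
    refine mul_le_mul (abs_le.2 ⟨by linarith [hσ.1], by linarith [hσ.2]⟩) ?_ (abs_nonneg _)
      (by linarith)
    refine (abs_real_inner_le_norm _ _).trans ?_
    rw [hu1, one_mul]; exact hK τ
  set J₀ := ∫ t in t₀..t₁, (inner ℝ (u t) (ψ t) : ℝ) with hJ0
  set J₁ := ∫ t in t₀..t₁, (inner ℝ (u t) (deriv ψ t) : ℝ) with hJ1
  -- Substituting `t = τ + σ` puts the shift on the smooth field `ψ`, so that the expansion in `σ`
  -- needs no regularity of `u` beyond continuity.
  set J : ℝ → ℝ := fun σ => ∫ t in t₀..t₁, (inner ℝ (u t) (ψ (t - σ)) : ℝ) with hJ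
  have hJc : Continuous J := by
    simp only [hJ]
    exact intervalIntegral.continuous_parametric_intervalIntegral_of_continuous' (by fun_prop) _ _
  have e2 : ∀ σ ∈ Ioc 0 h, ∫ τ in Ioc t₀ (t₁ - h), (σ - h / 2) * inner ℝ (u (τ + σ)) (ψ τ) =
      (σ - h / 2) * J σ := by
    intro σ hσ
    rw [integral_const_mul]
    congr 1
    rw [← intervalIntegral.integral_of_le ht, intervalIntegral.integral_eq_integral_of_support_subset]
    · simp only [hJ]
      rw [intervalIntegral.integral_eq_integral_of_support_subset,
        ← integral_sub_right_eq_self (fun τ => (inner ℝ (u (τ + σ)) (ψ τ) : ℝ)) σ]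
      · simp
      · intro t ht2
        have : ψ (t - σ) ≠ 0 := fun h0 => ht2 (by simp [h0])
        have := hsupp _ this
        exact ⟨by linarith [this.1, hσ.1], by linarith [this.2, hσ.2]⟩
    · intro t ht2
      exact hsupp _ fun h0 => ht2 (by simp [h0])
  rw [setIntegral_congr_fun measurableSet_Ioc e2]
  have e3 : ∀ σ ∈ Ioc 0 h, |J σ - J₀ + σ * J₁| ≤ K₂ * h ^ 2 * (t₁ - t₀) := by
    intro σ hσ
    have : J σ - J₀ + σ * J₁ =
        ∫ t in t₀..t₁, (inner ℝ (u t) (ψ (t - σ) - ψ t + σ • deriv ψ t) : ℝ) := by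
      simp only [hJ, hJ0, hJ1]
      rw [← intervalIntegral.integral_sub, ← intervalIntegral.integral_const_mul,
        ← intervalIntegral.integral_add]
      · refine intervalIntegral.integral_congr fun t _ => ?_
        simp only [inner_add_right, inner_sub_right, inner_smul_right]
      all_goals exact Continuous.intervalIntegrable (by fun_prop) _ _
    rw [this, ← Real.norm_eq_abs]
    refine (intervalIntegral.norm_integral_le_of_norm_le_const (C := K₂ * h ^ 2)
      fun t _ => ?_).trans_eq (by rw [abs_of_nonneg (by linarith)])
    refine (norm_inner_le_norm _ _).trans ?_
    rw [hu1, one_mul]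
    refine (hK2 t σ hσ).trans ?_
    have := pow_le_pow_left₀ hσ.1.le hσ.2 2
    gcongr
  have hIo : ∀ {f : ℝ → ℝ}, Continuous f → IntegrableOn f (Ioc 0 h) := fun hf =>
    hf.integrableOn_Icc.mono_set Ioc_subset_Icc_self
  have e4 : ∫ σ in Ioc 0 h, ((σ - h / 2) * (J₀ - σ * J₁) - h / 2 * (K₂ * h ^ 2 * (t₁ - t₀))) ≤
      ∫ σ in Ioc 0 h, (σ - h / 2) * J σ := by
    refine setIntegral_mono_on (hIo (by fun_prop)) (hIo (by fun_prop)) measurableSet_Ioc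
      fun σ hσ => ?_
    have h1 : |(σ - h / 2) * (J σ - J₀ + σ * J₁)| ≤ h / 2 * (K₂ * h ^ 2 * (t₁ - t₀)) := by
      rw [abs_mul]
      exact mul_le_mul (abs_le.2 ⟨by linarith [hσ.1], by linarith [hσ.2]⟩) (e3 σ hσ)
        (abs_nonneg _) (by linarith)
    have := (abs_le.1 h1).1
    nlinarith
  refine le_trans ?_ e4
  -- The weight `σ - h / 2` has mean zero, which removes `J₀`; its first moment `h³ / 12` multiplies
  -- `-J₁`.
  have e5 : ∫ σ in Ioc 0 h, ((σ - h / 2) * (J₀ - σ * J₁) - h / 2 * (K₂ * h ^ 2 * (t₁ - t₀))) =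
      -(h ^ 3 / 12 * J₁) - h ^ 2 / 2 * (K₂ * h ^ 2 * (t₁ - t₀)) := by
    rw [← intervalIntegral.integral_of_le hh.le]
    have : ∀ σ : ℝ, (σ - h / 2) * (J₀ - σ * J₁) - h / 2 * (K₂ * h ^ 2 * (t₁ - t₀)) =
        (-J₁) * σ ^ 2 + (J₀ + h / 2 * J₁) * σ + (-(h / 2 * J₀) -
          h / 2 * (K₂ * h ^ 2 * (t₁ - t₀))) := fun σ => by ring
    simp_rw [this]
    rw [intervalIntegral.integral_add, intervalIntegral.integral_add,
      intervalIntegral.integral_const_mul, intervalIntegral.integral_const_mul,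
      intervalIntegral.integral_const, integral_pow, integral_id, smul_eq_mul]
    · ring
    all_goals exact Continuous.intervalIntegrable (by fun_prop) _ _
  rw [e5]
  have : 0 ≤ K₂ * h ^ 4 * (t₁ - t₀) := by
    have : 0 ≤ t₁ - t₀ := by linarith
    positivity
  nlinarith

/-- The sharp lower bound for the defect of an arc that is aligned with `dir φ₀` up to a set of
times of small measure. -/
lemma sharp_le_arcDefect {γ ψ : ℝ → Plane} (hγ : ContDiff ℝ 1 γ) {L : ℝ} (hL0 : 0 < L)
    (hL : ∀ t, ‖deriv γ t‖ = L) {t₀ t₁ h φ₀ δ : ℝ} (hh : 0 < h) (hδ : 0 < δ) (hδ4 : δ ≤ 1 / 4)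
    (hψ : ContDiff ℝ 1 ψ) (ht : t₀ ≤ t₁ - h)
    (hsupp : ∀ t, ψ t ≠ 0 → t ∈ Ioc t₀ (t₁ - h)) {K K₂ : ℝ} (hK : ∀ t, ‖ψ t‖ ≤ K)
    (hK2 : ∀ t, ∀ σ ∈ Ioc 0 h, ‖ψ (t - σ) - ψ t + σ • deriv ψ t‖ ≤ K₂ * σ ^ 2) :
    ENNReal.ofReal (2 * Real.cos (2 * δ) * L ^ 2 *
      (-(h ^ 3 / 12 * ∫ t in t₀..t₁, (inner ℝ (L⁻¹ • deriv γ t) (deriv ψ t) : ℝ))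
        - K₂ * h ^ 4 * (t₁ - t₀) - h ^ 3 / 24 * (∫ t in t₀..t₁, ‖ψ t‖ ^ 2)
        - 9 * h ^ 2 * K * volume.real (Icc t₀ t₁ \ alignedTimes γ L φ₀ δ))) ≤
      arcDefect γ t₀ t₁ (L * h) := by
  set A := alignedTimes γ L φ₀ δ with hA
  have hAm : MeasurableSet A := measurableSet_alignedTimes hγ _ _ _
  set u := fun t => L⁻¹ • deriv γ t with hu
  have hγc := hγ.continuous_deriv le_rfl
  have huc : Continuous u := by simp only [hu]; fun_prop
  have hu1 : ∀ t, ‖u t‖ = 1 := fun t => by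
    simp only [hu]
    rw [norm_smul, hL, norm_inv, Real.norm_of_nonneg hL0.le, inv_mul_cancel₀ hL0.ne']
  have hψc := hψ.continuous
  have ht' : t₀ ≤ t₁ := by linarith
  have hK0 : 0 ≤ K := (norm_nonneg _).trans (hK 0)
  have hcos2 : 0 ≤ Real.cos (2 * δ) := Real.cos_nonneg_of_mem_Icc
    ⟨by linarith [Real.pi_gt_three], by linarith [Real.pi_gt_three]⟩
  set V := volume.real (Icc t₀ t₁ \ A) with hV
  -- the good times
  set f : ℝ → ℝ := fun t => L⁻¹ * inner ℝ (γ t) (dir φ₀) - 3 / 4 * t with hf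
  have hfC : ContDiff ℝ 1 f := by
    have := hγ.inner ℝ (contDiff_const (c := dir φ₀) (n := 1))
    simp only [hf]
    fun_prop
  have hfd : ∀ t, deriv f t = L⁻¹ * inner ℝ (deriv γ t) (dir φ₀) - 3 / 4 := by
    intro t
    have h1 : HasDerivAt γ (deriv γ t) t := (hγ.differentiable one_ne_zero t).hasDerivAt
    have h2 := (h1.inner ℝ (hasDerivAt_const t (dir φ₀))).const_mul L⁻¹
    have h3 : HasDerivAt f _ t := h2.sub ((hasDerivAt_id t).const_mul (3 / 4))
    rw [h3.deriv]
    simp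
  set R := futureMinTimes f t₀ t₁ with hR
  have hRm : MeasurableSet R := (isClosed_futureMinTimes hfC.continuous _ _).measurableSet
  have hcosδ : 7 / 8 ≤ Real.cos δ := by
    have := Real.one_sub_sq_div_two_le_cos (x := δ); nlinarith
  have hRV : volume.real (Icc t₀ t₁ \ R) ≤ 15 * V := by
    refine volume_compl_futureMinTimes_le hfC ht' hAm (fun t htA => ?_) fun t => ?_
    · rw [hfd]
      have h1 : L * Real.cos δ < inner ℝ (deriv γ t) (dir φ₀) := htA
      have h2 : Real.cos δ < L⁻¹ * inner ℝ (deriv γ t) (dir φ₀) := by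
        rw [← div_eq_inv_mul, lt_div_iff₀ hL0]; linarith
      linarith
    · rw [hfd]
      have h1 := (abs_le.1 (abs_inner_dir_le (deriv γ t) φ₀)).1
      rw [hL] at h1
      have h2 : L⁻¹ * (-L) ≤ L⁻¹ * inner ℝ (deriv γ t) (dir φ₀) :=
        mul_le_mul_of_nonneg_left h1 (by positivity)
      rw [mul_neg, inv_mul_cancel₀ hL0.ne'] at h2
      linarith
  set T := Ioc t₀ (t₁ - h) with hT
  set R' := T ∩ (R ∩ A) with hR'
  have hR'm : MeasurableSet R' := measurableSet_Ioc.inter (hRm.inter hAm)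
  have hmain := lintegral_windowGap_le_arcDefect hγ hL0 hL (t₀ := t₀) (t₁ := t₁) (φ₀ := φ₀)
    hh hδ hδ4 hR'm (fun τ hτ => ⟨hτ.1.1.le, by linarith [hτ.1.2], hτ.2.2, fun t htt => by
      have h1 := hτ.2.1.2 t htt
      simp only [hf] at h1
      have h2 : L * (L⁻¹ * inner ℝ (γ τ) (dir φ₀) - 3 / 4 * τ) ≤
          L * (L⁻¹ * inner ℝ (γ t) (dir φ₀) - 3 / 4 * t) := mul_le_mul_of_nonneg_left h1 hL0.le
      rw [mul_sub, mul_sub, mul_inv_cancel_left₀ hL0.ne', mul_inv_cancel_left₀ hL0.ne'] at h2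
      rw [inner_sub_left]; linarith⟩)
  refine le_trans ?_ hmain
  -- the integrand
  set Φ : ℝ → ℝ := fun τ => ∫ t in τ..(τ + h), (t - τ - h / 2) * inner ℝ (u t) (ψ τ) with hΦ
  have hΦe : Φ = fun τ => ∫ σ in (0 : ℝ)..h, (σ - h / 2) * inner ℝ (u (τ + σ)) (ψ τ) := by
    funext τ
    have := intervalIntegral.integral_comp_add_left (a := 0) (b := h)
      (fun t => (t - τ - h / 2) * inner ℝ (u t) (ψ τ)) τ
    rw [add_zero] at this
    simp only [hΦ]
    rw [← this]
    simp
  have hΦc : Continuous Φ := by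
    rw [hΦe]
    exact intervalIntegral.continuous_parametric_intervalIntegral_of_continuous' (by fun_prop) _ _
  have hΦb : ∀ τ, |Φ τ| ≤ h ^ 2 / 2 * K := by
    intro τ
    rw [hΦe, ← Real.norm_eq_abs]
    refine (intervalIntegral.norm_integral_le_of_norm_le_const (C := h / 2 * K)
      fun σ hσ => ?_).trans_eq (by rw [sub_zero, abs_of_pos hh]; ring)
    rw [uIoc_of_le hh.le] at hσ
    rw [norm_mul]
    refine mul_le_mul (abs_le.2 ⟨by linarith [hσ.1], by linarith [hσ.2]⟩) ?_ (norm_nonneg _)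
      (by linarith)
    refine (norm_inner_le_norm _ _).trans ?_
    rw [hu1, one_mul]; exact hK τ
  set w : ℝ → ℝ := fun τ => volume.real (Ioc τ (τ + h) \ A) with hw
  have hwe : w = fun τ => ∫ σ in Ioc 0 h, Aᶜ.indicator (fun _ => (1 : ℝ)) (τ + σ) := by
    funext τ
    simp only [hw]
    rw [Set.sdiff_eq, windowMeasure_eq hAm.compl hh.le]
  have hwm : Measurable w := by
    rw [hwe]
    have hm : Measurable (Aᶜ.indicator (fun _ => (1 : ℝ))) := measurable_const.indicator hAm.compl
    have hm2 : Measurable (Function.uncurry fun τ σ => Aᶜ.indicator (fun _ => (1 : ℝ)) (τ + σ)) :=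
      hm.comp (measurable_fst.add measurable_snd)
    exact hm2.stronglyMeasurable.integral_prod_right.measurable
  have hw0 : ∀ τ, 0 ≤ w τ := fun τ => measureReal_nonneg
  have hwh : ∀ τ, w τ ≤ h := by
    intro τ
    calc w τ ≤ volume.real (Ioc τ (τ + h)) := measureReal_mono sdiff_subset (by simp)
      _ = h := by simp [hh.le]
  set q : ℝ → ℝ := fun τ => ‖ψ τ‖ ^ 2 * h ^ 3 / 24 + h * ‖ψ τ‖ * w τ with hq
  have hqm : Measurable q := by simp only [hq]; fun_prop
  have hq0 : ∀ τ, 0 ≤ q τ := fun τ => by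
    have := hw0 τ; simp only [hq]; positivity
  have hqb : ∀ τ, ‖q τ‖ ≤ K ^ 2 * h ^ 3 / 24 + h * K * h := by
    intro τ
    rw [Real.norm_of_nonneg (hq0 τ)]
    have h1 := pow_le_pow_left₀ (norm_nonneg _) (hK τ) 2
    have h2 : ‖ψ τ‖ * w τ ≤ K * h := mul_le_mul (hK τ) (hwh τ) (hw0 τ) hK0
    simp only [hq]
    have h3 : ‖ψ τ‖ ^ 2 * h ^ 3 ≤ K ^ 2 * h ^ 3 := by gcongr
    have h4 : h * (‖ψ τ‖ * w τ) ≤ h * (K * h) := by gcongr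
    linarith
  have hTfin : volume T ≠ ⊤ := by simp [hT]
  have : IsFiniteMeasure (volume.restrict T) := ⟨by simpa using hTfin.lt_top⟩
  have hqi : IntegrableOn q T :=
    Integrable.of_bound hqm.aestronglyMeasurable _ (ae_of_all _ hqb)
  have hΦi : IntegrableOn Φ T := hΦc.integrableOn_Icc.mono_set Ioc_subset_Icc_self
  have hsub : R' ⊆ T := inter_subset_left
  have hstep : ENNReal.ofReal (∫ τ in R', 2 * Real.cos (2 * δ) * L ^ 2 * (Φ τ - q τ)) ≤
      ∫⁻ τ in R', ENNReal.ofReal (2 * Real.cos (2 * δ) * L ^ 2 * windowGap γ L φ₀ δ h τ) := by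
    refine (ofReal_integral_le_lintegral
      (((hΦi.mono_set hsub).sub (hqi.mono_set hsub)).const_mul _)).trans ?_
    refine lintegral_mono fun τ => ENNReal.ofReal_le_ofReal ?_
    refine mul_le_mul_of_nonneg_left ?_ (by positivity)
    have h1 := le_windowGap hγ hL0 hL φ₀ δ hh.le τ (ψ τ)
    have h2 : Φ τ - ‖ψ τ‖ ^ 2 * h ^ 3 / 24 - h * ‖ψ τ‖ * w τ ≤ windowGap γ L φ₀ δ h τ := h1
    have h3 : q τ = ‖ψ τ‖ ^ 2 * h ^ 3 / 24 + h * ‖ψ τ‖ * w τ := rfl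
    change Φ τ - q τ ≤ _
    linarith
  refine le_trans (ENNReal.ofReal_le_ofReal ?_) hstep
  rw [integral_const_mul]
  refine mul_le_mul_of_nonneg_left ?_ (by positivity)
  rw [integral_sub (hΦi.mono_set hsub) (hqi.mono_set hsub)]
  have h1 : -(h ^ 3 / 12 * ∫ t in t₀..t₁, (inner ℝ (u t) (deriv ψ t) : ℝ))
      - K₂ * h ^ 4 * (t₁ - t₀) ≤ ∫ τ in T, Φ τ :=
    le_integral_moment huc hu1 hψ hh ht hsupp hK hK2
  have h2 : ∫ τ in T, Φ τ = (∫ τ in R', Φ τ) + ∫ τ in T \ (R ∩ A), Φ τ :=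
    (integral_inter_add_sdiff (hRm.inter hAm) hΦi).symm
  have finI : ∀ S : Set ℝ, volume (Icc t₀ t₁ \ S) ≠ ⊤ := fun S =>
    (lt_of_le_of_lt (measure_mono sdiff_subset) (by simp)).ne
  have h3 : volume.real (T \ (R ∩ A)) ≤ 16 * V := by
    have hs : T \ (R ∩ A) ⊆ (Icc t₀ t₁ \ R) ∪ (Icc t₀ t₁ \ A) := by
      rintro τ ⟨hτ, hn⟩
      have hτ' : τ ∈ Icc t₀ t₁ := ⟨hτ.1.le, by linarith [hτ.2]⟩
      by_cases hr : τ ∈ R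
      · exact Or.inr ⟨hτ', fun ha => hn ⟨hr, ha⟩⟩
      · exact Or.inl ⟨hτ', hr⟩
    calc _ ≤ _ := measureReal_mono hs (measure_union_ne_top (finI _) (finI _))
      _ ≤ _ := measureReal_union_le _ _
      _ ≤ 15 * V + V := by gcongr
      _ = _ := by ring
  have h4 : ∫ τ in T \ (R ∩ A), Φ τ ≤ h ^ 2 / 2 * K * (16 * V) := by
    have fin3 : volume (T \ (R ∩ A)) < ⊤ :=
      lt_of_le_of_lt (measure_mono sdiff_subset) hTfin.lt_top
    have := norm_setIntegral_le_of_norm_le_const fin3 (f := Φ) (C := h ^ 2 / 2 * K)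
      fun τ _ => hΦb τ
    refine (le_abs_self _).trans (this.trans ?_)
    gcongr
  have h5 : ∫ τ in R', q τ ≤ ∫ τ in T, q τ :=
    setIntegral_mono_set hqi (ae_of_all _ hq0) hsub.eventuallyLE
  have h6 : ∫ τ in T, q τ ≤ h ^ 3 / 24 * (∫ t in t₀..t₁, ‖ψ t‖ ^ 2) + h * K * (h * V) := by
    have hwi : IntegrableOn w T := Integrable.of_bound hwm.aestronglyMeasurable h
      (ae_of_all _ fun τ => by rw [Real.norm_of_nonneg (hw0 τ)]; exact hwh τ)
    have hpi : IntegrableOn (fun τ => ‖ψ τ‖ ^ 2) (Icc t₀ t₁) :=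
      Continuous.integrableOn_Icc (by fun_prop)
    have hTs : T ⊆ Icc t₀ t₁ := fun τ hτ => ⟨hτ.1.le, by linarith [hτ.2]⟩
    calc _ ≤ ∫ τ in T, (h ^ 3 / 24 * ‖ψ τ‖ ^ 2 + h * K * w τ) := by
          refine setIntegral_mono hqi
            (((hpi.mono_set hTs).const_mul _).add (hwi.const_mul _)) fun τ => ?_
          have : h * ‖ψ τ‖ * w τ ≤ h * K * w τ :=
            mul_le_mul_of_nonneg_right (mul_le_mul_of_nonneg_left (hK τ) hh.le) (hw0 τ)
          simp only [hq]; linarith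
      _ = h ^ 3 / 24 * (∫ τ in T, ‖ψ τ‖ ^ 2) + h * K * ∫ τ in T, w τ := by
          rw [integral_add ((hpi.mono_set hTs).const_mul _) (hwi.const_mul _),
            integral_const_mul, integral_const_mul]
      _ ≤ _ := by
          have h7 : ∫ τ in T, w τ ≤ h * V := by
            have := integral_windowMeasure_le hAm.compl hh.le ht
            simpa only [hw, hV, Set.sdiff_eq] using this
          have h8 : ∫ τ in T, ‖ψ τ‖ ^ 2 ≤ ∫ t in t₀..t₁, ‖ψ t‖ ^ 2 := by
            rw [intervalIntegral.integral_of_le ht']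
            exact setIntegral_mono_set (hpi.mono_set Ioc_subset_Icc_self)
              (ae_of_all _ fun _ => sq_nonneg _)
              (Ioc_subset_Ioc_right (by linarith)).eventuallyLE
          gcongr
  -- The discarded starting times cost `h² / 2 * K * 16 * V` and the misaligned parts of the windows
  -- `h² * K * V`, together `9 * h² * K * V`.
  nlinarith

/-! ### The lower limit of the defect of an arc -/

lemma exists_taylor_bound {ψ : ℝ → Plane} (hψ : ContDiff ℝ ∞ ψ) (hc : HasCompactSupport ψ) :
    ∃ K, ∀ t, ∀ σ, 0 ≤ σ → ‖ψ (t - σ) - ψ t + σ • deriv ψ t‖ ≤ K * σ ^ 2 := by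
  have hd : ContDiff ℝ ∞ (deriv ψ) := (contDiff_infty_iff_deriv.1 hψ).2
  obtain ⟨M, hM⟩ := hc.deriv.deriv.exists_bound_of_continuous (hd.continuous_deriv (by simp))
  have hM0 : 0 ≤ M := (norm_nonneg _).trans (hM 0)
  have hlip : ∀ a b, ‖deriv ψ b - deriv ψ a‖ ≤ M * ‖b - a‖ := fun a b =>
    convex_univ.norm_image_sub_le_of_norm_deriv_le
      (fun x _ => hd.differentiable (by simp) x) (fun x _ => hM x) (mem_univ a) (mem_univ b)
  refine ⟨M, fun t σ hσ => ?_⟩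
  have hg : ∀ s ∈ Icc 0 σ, HasDerivWithinAt (fun s => ψ (t - s) + s • deriv ψ t)
      (-deriv ψ (t - s) + deriv ψ t) (Icc 0 σ) s := by
    intro s _
    have h1 : HasDerivAt ψ (deriv ψ (t - s)) (t - s) :=
      (hψ.differentiable (by simp) (t - s)).hasDerivAt
    have h2 := h1.scomp s ((hasDerivAt_id s).const_sub t)
    have h3 := h2.add ((hasDerivAt_id s).smul_const (deriv ψ t))
    simp only [neg_smul, one_smul, id] at h3
    exact h3.hasDerivWithinAt
  have := (convex_Icc 0 σ).norm_image_sub_le_of_norm_hasDerivWithin_le hg (C := M * σ)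
    (fun s hs => ?_) (left_mem_Icc.2 hσ) (right_mem_Icc.2 hσ)
  · simp only [sub_zero, zero_smul, add_zero, Real.norm_of_nonneg hσ] at this
    calc _ = ‖ψ (t - σ) + σ • deriv ψ t - ψ t‖ := by congr 1; abel
      _ ≤ _ := this
      _ = _ := by ring
  · rw [neg_add_eq_sub]
    refine (hlip _ _).trans ?_
    rw [show t - (t - s) = s by ring, Real.norm_of_nonneg hs.1]
    exact mul_le_mul_of_nonneg_left hs.2 hM0

lemma tendsto_integral_inner {l : Filter ℕ} {u : ℕ → ℝ → Plane} {v p : ℝ → Plane}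
    (hu : ∀ n, Continuous (u n)) (hv : Continuous v) (hp : Continuous p)
    (hpc : HasCompactSupport p) {t₀ t₁ : ℝ} (ht : t₀ < t₁)
    (h : Tendsto (fun n => ∫ t in t₀..t₁, ‖u n t - v t‖ ^ 2) l (𝓝 0)) :
    Tendsto (fun n => ∫ t in t₀..t₁, (inner ℝ (u n t) (p t) : ℝ)) l
      (𝓝 (∫ t in t₀..t₁, (inner ℝ (v t) (p t) : ℝ))) := by
  obtain ⟨K, hK⟩ := hpc.exists_bound_of_continuous hp
  rw [tendsto_iff_norm_sub_tendsto_zero]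
  have hsq : Tendsto (fun n => ‖(∫ t in t₀..t₁, (inner ℝ (u n t) (p t) : ℝ)) -
      ∫ t in t₀..t₁, (inner ℝ (v t) (p t) : ℝ)‖ ^ 2) l (𝓝 0) := by
    have h0 : Tendsto (fun n => (t₁ - t₀) * (K ^ 2 * ∫ t in t₀..t₁, ‖u n t - v t‖ ^ 2)) l (𝓝 0) := by
      have := (h.const_mul (K ^ 2)).const_mul (t₁ - t₀)
      simpa using this
    refine squeeze_zero (fun n => by positivity) (fun n => ?_) h0
    have hun := hu n
    rw [Real.norm_eq_abs, sq_abs, ← intervalIntegral.integral_sub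
      (Continuous.intervalIntegrable (by fun_prop) _ _)
      (Continuous.intervalIntegrable (by fun_prop) _ _)]
    simp_rw [← inner_sub_left]
    refine (integral_sq_le (by fun_prop) ht).trans ?_
    refine mul_le_mul_of_nonneg_left ?_ (by linarith)
    rw [← intervalIntegral.integral_const_mul]
    refine intervalIntegral.integral_mono_on ht.le (Continuous.intervalIntegrable (by fun_prop) _ _)
      (Continuous.intervalIntegrable (by fun_prop) _ _) fun t _ => ?_
    rw [← sq_abs, ← mul_pow]
    refine pow_le_pow_left₀ (abs_nonneg _) ((abs_real_inner_le_norm _ _).trans ?_) 2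
    rw [mul_comm]
    exact mul_le_mul_of_nonneg_right (hK t) (norm_nonneg _)
  have := hsq.sqrt
  simpa [Real.sqrt_sq_eq_abs] using this

/-- The sharp asymptotic lower bound for the defect of arcs that converge to an arc whose
direction is close to `dir φ₀`. -/
lemma eventually_le_arcDefect {l : Filter ℕ} {γ : ℕ → ℝ → Plane} (hγ : ∀ n, ContDiff ℝ 1 (γ n))
    {L r : ℕ → ℝ} (hL0 : ∀ n, 0 < L n) (hL : ∀ n t, ‖deriv (γ n) t‖ = L n) {Λ : ℝ} (hΛ : 0 < Λ)
    (hLΛ : Tendsto L l (𝓝 Λ)) (hr0 : ∀ᶠ n in l, 0 < r n) (hr : Tendsto r l (𝓝 0)) {v : ℝ → Plane}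
    (hv : Continuous v) {t₀ t₁ : ℝ} (ht : t₀ < t₁)
    (huv : Tendsto (fun n => ∫ t in t₀..t₁, ‖(L n)⁻¹ • deriv (γ n) t - v t‖ ^ 2) l (𝓝 0))
    {δ ε φ₀ : ℝ} (hδ : 0 < δ) (hδ4 : δ ≤ 1 / 4) (hε : 0 < ε)
    (hεδ : (4 * ε) ^ 2 ≤ 2 * (1 - Real.cos δ)) (hve : ∀ t ∈ Icc t₀ t₁, ‖v t - dir φ₀‖ ≤ ε)
    {ψ : ℝ → Plane} (hψ : ContDiff ℝ ∞ ψ) (hψc : HasCompactSupport ψ)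
    (hψs : tsupport ψ ⊆ Ioo t₀ t₁) {x : ℝ}
    (hx : x < Real.cos (2 * δ) / (12 * Λ) * (-(2 * ∫ t in t₀..t₁, (inner ℝ (v t) (deriv ψ t) : ℝ))
      - ∫ t in t₀..t₁, ‖ψ t‖ ^ 2)) :
    ∀ᶠ n in l, ENNReal.ofReal (x * r n ^ 3) ≤ arcDefect (γ n) t₀ t₁ (r n) := by
  set C := max x 0 with hC
  have hC0 : 0 ≤ C := le_max_right _ _
  -- A defect above `C * r n ^ 3` needs no proof since `x ≤ C`. Otherwise it is of third order, as
  -- the estimate of the misaligned times requires.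
  suffices H : ∀ᶠ n in l, arcDefect (γ n) t₀ t₁ (r n) ≤ ENNReal.ofReal (C * r n ^ 3) →
      ENNReal.ofReal (x * r n ^ 3) ≤ arcDefect (γ n) t₀ t₁ (r n) by
    filter_upwards [H, hr0] with n hn hrn
    by_contra! hlt
    refine absurd (hn (hlt.le.trans (ENNReal.ofReal_le_ofReal ?_))) (not_le.2 hlt)
    have : x ≤ C := le_max_left _ _
    gcongr
  obtain ⟨K, hK⟩ := hψc.exists_bound_of_continuous hψ.continuous
  have hK0 : 0 ≤ K := (norm_nonneg _).trans (hK 0)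
  obtain ⟨K₂, hK₂⟩ := exists_taylor_bound hψ hψc
  have hT : 0 < t₁ - t₀ := by linarith
  -- the support of `ψ` keeps a distance from `t₁`
  obtain ⟨b, hb1, hb⟩ : ∃ b < t₁, ∀ t, ψ t ≠ 0 → t ≤ b := by
    rcases (tsupport ψ).eq_empty_or_nonempty with he | hne
    · exact ⟨t₀, ht, fun t h0 => absurd (subset_tsupport ψ h0) (by simp [he])⟩
    · obtain ⟨b, hbS, hb⟩ := hψc.isCompact.exists_isGreatest hne
      exact ⟨b, (hψs hbS).2, fun t h0 => hb (subset_tsupport ψ h0)⟩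
  -- Then `θ * (64 * C) / 2 ≤ ε² / 2`, and the terms with `η n` are eventually below the remaining
  -- `ε² / 2`.
  set θ := ε ^ 2 / (64 * (C + 1)) with hθdef
  have hθ : 0 < θ := by positivity
  have hθC : θ * (64 * C) ≤ ε ^ 2 := by
    rw [hθdef, div_mul_eq_mul_div, div_le_iff₀ (by positivity)]
    nlinarith [sq_nonneg ε]
  set η : ℕ → ℝ := fun n => ∫ t in t₀..t₁, ‖(L n)⁻¹ • deriv (γ n) t - v t‖ ^ 2 with hη
  have hsmall : ∀ᶠ n in l, η n / (t₁ - t₀) + (32 * L n * η n / θ) / 2 < ε ^ 2 / 2 := by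
    have h1 : Tendsto (fun n => η n / (t₁ - t₀) + (32 * L n * η n / θ) / 2) l
        (𝓝 (0 / (t₁ - t₀) + (32 * Λ * 0 / θ) / 2)) :=
      (huv.div_const _).add ((((hLΛ.const_mul 32).mul huv).div_const _).div_const _)
    simp only [zero_div, mul_zero, add_zero] at h1
    exact h1.eventually_lt_const (by positivity)
  have hJ := tendsto_integral_inner (p := deriv ψ) (fun n => by
      have := (hγ n).continuous_deriv le_rfl
      change Continuous fun t => (L n)⁻¹ • deriv (γ n) t
      fun_prop) hv
      (hψ.continuous_deriv (by simp)) hψc.deriv ht huv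
  set J := ∫ t in t₀..t₁, (inner ℝ (v t) (deriv ψ t) : ℝ) with hJdef
  set Ψ := ∫ t in t₀..t₁, ‖ψ t‖ ^ 2 with hΨ
  -- This is the sharp bound divided by `r n ^ 3`. The misaligned times enter with `36 = 9 * 4` and
  -- an extra factor `r n`, so they disappear in the limit.
  have hmain : ∀ᶠ n in l, x < 2 * Real.cos (2 * δ) / L n *
      (-((∫ t in t₀..t₁, (inner ℝ ((L n)⁻¹ • deriv (γ n) t) (deriv ψ t) : ℝ)) / 12)
        - K₂ * (r n / L n) * (t₁ - t₀) - Ψ / 24 - 36 * K * C * r n / ε ^ 2) := by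
    have h1 : Tendsto (fun n => 2 * Real.cos (2 * δ) / L n *
      (-((∫ t in t₀..t₁, (inner ℝ ((L n)⁻¹ • deriv (γ n) t) (deriv ψ t) : ℝ)) / 12)
        - K₂ * (r n / L n) * (t₁ - t₀) - Ψ / 24 - 36 * K * C * r n / ε ^ 2)) l
        (𝓝 (2 * Real.cos (2 * δ) / Λ * (-(J / 12) - K₂ * (0 / Λ) * (t₁ - t₀) - Ψ / 24
          - 36 * K * C * 0 / ε ^ 2))) :=
      (tendsto_const_nhds.div hLΛ hΛ.ne').mul
        ((((hJ.div_const _).neg.sub (((hr.div hLΛ hΛ.ne').const_mul _).mul_const _)).sub_const _).sub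
          ((hr.const_mul _).div_const _))
    refine h1.eventually_const_lt (hx.trans_eq ?_)
    field_simp
    ring
  have hr2 : ∀ᶠ n in l, r n < 2 * L n * (t₁ - t₀) := by
    have h1 : Tendsto (fun n => 2 * L n * (t₁ - t₀)) l (𝓝 (2 * Λ * (t₁ - t₀))) :=
      (hLΛ.const_mul 2).mul_const _
    exact hr.eventually_lt h1 (by positivity)
  have hrb : ∀ᶠ n in l, r n / L n < min (t₁ - b) (t₁ - t₀) := by
    have h1 : Tendsto (fun n => r n / L n) l (𝓝 (0 / Λ)) := hr.div hLΛ hΛ.ne'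
    rw [zero_div] at h1
    exact h1.eventually_lt_const (lt_min (by linarith) hT)
  filter_upwards [hsmall, hmain, hr2, hrb, hr0] with n hn1 hn2 hn3 hn4 hn5 hD
  have hLn := hL0 n
  have hvol := volume_misaligned_le (hγ n) hLn (hL n) ht hn5 hn3.le hC0 hD hv (norm_dir φ₀) hε hεδ
    hve hθ (le_refl (η n)) (by
      have : (θ * (64 * C) + 32 * L n * η n / θ) / 2 =
        θ * (64 * C) / 2 + 32 * L n * η n / θ / 2 := by ring
      rw [this]; linarith)
  set V := volume.real (Icc t₀ t₁ \ alignedTimes (γ n) (L n) φ₀ δ) with hV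
  have hVle : V ≤ 4 * C * r n ^ 2 / (ε ^ 2 * L n) := by
    have hs : Icc t₀ t₁ \ alignedTimes (γ n) (L n) φ₀ δ ⊆
        {t₀} ∪ (Ioc t₀ t₁ ∩ {t | inner ℝ ((L n)⁻¹ • deriv (γ n) t) (dir φ₀) ≤ Real.cos δ}) := by
      rintro t ⟨ht1, ht2⟩
      rcases eq_or_lt_of_le ht1.1 with h0 | h0
      · exact Or.inl h0.symm
      · refine Or.inr ⟨⟨h0, ht1.2⟩, ?_⟩
        simp only [alignedTimes, mem_ofPred_eq, not_lt] at ht2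
        simp only [mem_ofPred_eq]
        rw [inner_smul_left, RCLike.conj_to_real, inv_mul_le_iff₀ hLn]
        exact ht2
    have h1 : volume (Icc t₀ t₁ \ alignedTimes (γ n) (L n) φ₀ δ) ≤
        ENNReal.ofReal (4 * C * r n ^ 2 / (ε ^ 2 * L n)) := by
      refine (measure_mono hs).trans ((measure_union_le _ _).trans ?_)
      rw [Real.volume_singleton, zero_add]
      exact hvol
    exact ENNReal.toReal_le_of_le_ofReal (by positivity) h1
  set h := r n / L n with hh
  have hh0 : 0 < h := div_pos hn5 hLn
  have hLh : L n * h = r n := by rw [hh]; field_simp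
  have hmin := lt_min_iff.1 hn4
  have hsharp := sharp_le_arcDefect (hγ n) hLn (hL n) (φ₀ := φ₀) hh0 hδ hδ4
    (hψ.of_le (by simp)) (t₀ := t₀) (t₁ := t₁) (by linarith [hmin.2]) (fun t h0 =>
      ⟨(hψs (subset_tsupport ψ h0)).1, by linarith [hmin.1, hb t h0]⟩) hK
      (fun t σ hσ => hK₂ t σ hσ.1.le)
  rw [hLh] at hsharp
  refine le_trans (ENNReal.ofReal_le_ofReal ?_) hsharp
  have hcos2 : 0 ≤ Real.cos (2 * δ) := Real.cos_nonneg_of_mem_Icc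
    ⟨by linarith [Real.pi_gt_three], by linarith [Real.pi_gt_three]⟩
  rw [← hV, ← hΨ]
  set Jn := ∫ t in t₀..t₁, (inner ℝ ((L n)⁻¹ • deriv (γ n) t) (deriv ψ t) : ℝ) with hJn
  have hr3 : r n = L n * h := hLh.symm
  calc x * r n ^ 3 ≤ (2 * Real.cos (2 * δ) / L n * (-(Jn / 12) - K₂ * h * (t₁ - t₀) - Ψ / 24
        - 36 * K * C * r n / ε ^ 2)) * r n ^ 3 := by gcongr
    _ = 2 * Real.cos (2 * δ) * L n ^ 2 * (-(h ^ 3 / 12 * Jn) - K₂ * h ^ 4 * (t₁ - t₀)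
        - h ^ 3 / 24 * Ψ - 9 * h ^ 2 * K * (4 * C * r n ^ 2 / (ε ^ 2 * L n))) := by
        rw [hr3]; field_simp; ring
    _ ≤ _ := by gcongr

/-! ### Weak derivatives on the line -/

lemma integrable_smul_of_compactSupport {f : ℝ → Plane} (hf : LocallyIntegrable f) {φ : ℝ → ℝ}
    (hφ : Continuous φ) (hc : HasCompactSupport φ) : Integrable fun t => φ t • f t :=
  hf.integrable_smul_left_of_hasCompactSupport hφ hc

lemma exists_support_subset {φ : ℝ → ℝ} (hc : HasCompactSupport φ) :
    ∃ R : ℝ, 0 < R ∧ tsupport φ ⊆ Ioo (-R) R := by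
  obtain ⟨R, hR⟩ := (hc.isCompact.isBounded).subset_ball 0
  refine ⟨max R 1, by positivity, fun t ht => ?_⟩
  have h := hR ht
  rw [Metric.mem_ball, dist_zero_right, Real.norm_eq_abs, abs_lt] at h
  exact ⟨by linarith [h.1, le_max_left R 1], by linarith [h.2, le_max_left R 1]⟩

lemma tsupport_deriv_subset_tsupport {φ : ℝ → ℝ} : tsupport (deriv φ) ⊆ tsupport φ := by
  exact closure_minimal (support_deriv_subset) isClosed_closure

lemma integral_eq_interval {F : Type*} [NormedAddCommGroup F] [NormedSpace ℝ F] {f : ℝ → F} {a b : ℝ}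
    (h : ∀ t, f t ≠ 0 → t ∈ Ioo a b) : ∫ t, f t = ∫ t in a..b, f t :=
  (intervalIntegral.integral_eq_integral_of_support_subset
    fun t ht => Ioo_subset_Ioc_self (h t ht)).symm

/-- The primitive of a scalar locally integrable function has this function as its weak
derivative. -/
lemma integral_deriv_mul_primitive {h φ : ℝ → ℝ} (hh : LocallyIntegrable h) (hφ : ContDiff ℝ ∞ φ)
    (hc : HasCompactSupport φ) :
    ∫ t, deriv φ t * (∫ s in (0 : ℝ)..t, h s) = -∫ t, φ t * h t := by
  obtain ⟨R, hR0, hR⟩ := exists_support_subset hc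
  have z : ∀ t, t ∉ Ioo (-R) R → φ t = 0 := fun t ht => by
    by_contra h0; exact ht (hR (subset_tsupport φ h0))
  have zd : ∀ t, t ∉ Ioo (-R) R → deriv φ t = 0 := fun t ht => by
    by_contra h0
    exact ht (hR (tsupport_deriv_subset_tsupport (subset_tsupport _ h0)))
  rw [integral_eq_interval (a := -R) (b := R), integral_eq_interval (a := -R) (b := R)]
  rotate_left
  · intro t ht; by_contra h0; exact ht (by simp [z t h0])
  · intro t ht; by_contra h0; exact ht (by simp [zd t h0])
  have hi : ∀ a b, IntervalIntegrable h volume a b := fun a b => by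
    exact (hh.integrableOn_isCompact isCompact_uIcc).intervalIntegrable
  have hac : AbsolutelyContinuousOnInterval (fun t => ∫ s in (0 : ℝ)..t, h s) (-R) R :=
    (hi (-R) R).absolutelyContinuousOnInterval_intervalIntegral
      (c := 0) (by rw [uIcc_of_le (by linarith)]; exact ⟨by linarith, hR0.le⟩)
  have hφac : AbsolutelyContinuousOnInterval φ (-R) R :=
    (hφ.of_le (by simp)).contDiffOn.absolutelyContinuousOnInterval
  have key := AbsolutelyContinuousOnInterval.integral_mul_deriv_eq_deriv_mul hφac hac
  rw [z R (by simp), z (-R) (by simp)] at key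
  simp only [zero_mul, sub_zero, zero_sub] at key
  rw [← neg_eq_iff_eq_neg, ← key]
  refine intervalIntegral.integral_congr_ae ?_
  filter_upwards [(hi (-R) R).ae_hasDerivAt_integral] with t ht1 ht2
  rw [(ht1 (uIoc_subset_uIcc ht2) 0
    (by rw [uIcc_of_le (by linarith)]; exact ⟨by linarith, hR0.le⟩)).deriv]

lemma integral_apply {f : ℝ → Plane} (hf : Integrable f) (i : Fin 2) :
    (∫ t, f t) i = ∫ t, f t i :=
  ((EuclideanSpace.proj i : Plane →L[ℝ] ℝ).integral_comp_comm hf).symm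

lemma locallyIntegrable_apply {f : ℝ → Plane} (hf : LocallyIntegrable f) (i : Fin 2) :
    LocallyIntegrable fun t => f t i := by
  rw [locallyIntegrable_iff] at hf ⊢
  exact fun k hk => (EuclideanSpace.proj i : Plane →L[ℝ] ℝ).integrable_comp (hf k hk)

lemma intervalIntegral_apply {f : ℝ → Plane} (hf : LocallyIntegrable f) (i : Fin 2) (a b : ℝ) :
    (∫ t in a..b, f t) i = ∫ t in a..b, f t i := by
  have hi : IntervalIntegrable f volume a b :=
    (hf.integrableOn_isCompact isCompact_uIcc).intervalIntegrable
  exact ((EuclideanSpace.proj i : Plane →L[ℝ] ℝ).intervalIntegral_comp_comm hi).symm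

lemma continuous_primitive {h : ℝ → Plane} (hh : LocallyIntegrable h) :
    Continuous fun t => ∫ s in (0 : ℝ)..t, h s :=
  intervalIntegral.continuous_primitive
    (fun _ _ => (hh.integrableOn_isCompact isCompact_uIcc).intervalIntegrable) 0

lemma hasWeakDeriv_primitive {h : ℝ → Plane} (hh : LocallyIntegrable h) :
    HasWeakDeriv (fun t => ∫ s in (0 : ℝ)..t, h s) h := by
  refine ⟨(continuous_primitive hh).locallyIntegrable, hh, fun φ hφ hc => ?_⟩
  have hi1 := integrable_smul_of_compactSupport (continuous_primitive hh).locallyIntegrable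
    (hφ.continuous_deriv (by simp)) hc.deriv
  have hi2 := integrable_smul_of_compactSupport hh hφ.continuous hc
  ext i
  rw [PiLp.neg_apply, integral_apply hi1, integral_apply hi2]
  simp only [PiLp.smul_apply, smul_eq_mul, intervalIntegral_apply hh]
  exact integral_deriv_mul_primitive (locallyIntegrable_apply hh i) hφ hc

/-- A function with vanishing weak derivative is constant. -/
lemma ae_eq_const_of_weakDeriv_zero {f : ℝ → Plane} (hf : LocallyIntegrable f)
    (h : ∀ φ : ℝ → ℝ, ContDiff ℝ ∞ φ → HasCompactSupport φ → ∫ t, deriv φ t • f t = 0) :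
    ∃ c : Plane, ∀ᵐ t, f t = c := by
  let β : ContDiffBump (0 : ℝ) := ⟨1, 2, by norm_num, by norm_num⟩
  set ρ : ℝ → ℝ := β.normed volume with hρ
  have hρc : ContDiff ℝ ∞ ρ := β.contDiff_normed
  have hρs : HasCompactSupport ρ := β.hasCompactSupport_normed
  have hρ1 : ∫ t, ρ t = 1 := β.integral_normed
  refine ⟨∫ t, ρ t • f t, ?_⟩
  refine ae_eq_of_integral_contDiff_smul_eq hf (continuous_const.locallyIntegrable)
    fun φ hφ hφs => ?_
  set I := ∫ t, φ t with hI
  -- Removing the mean by a fixed bump makes the primitive of `χ` compactly supported, hence an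
  -- admissible test function.
  set χ : ℝ → ℝ := fun t => φ t - I * ρ t with hχ
  have hχc : ContDiff ℝ ∞ χ := by simp only [hχ]; fun_prop
  have hχs : HasCompactSupport χ := hφs.sub (hρs.mul_left)
  obtain ⟨R, hR0, hR⟩ := exists_support_subset hχs
  have z : ∀ t, t ∉ Ioo (-R) R → χ t = 0 := fun t ht => by
    by_contra h0; exact ht (hR (subset_tsupport χ h0))
  have hχ0 : ∫ t in (-R)..R, χ t = 0 := by
    rw [← integral_eq_interval (a := -R) (b := R)]
    · simp only [hχ]
      rw [integral_sub (hφ.continuous.integrable_of_hasCompactSupport hφs)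
        ((hρc.continuous.integrable_of_hasCompactSupport hρs).const_mul _), integral_const_mul, hρ1]
      ring
    · intro t ht; by_contra h0; exact ht (z t h0)
  set Φ : ℝ → ℝ := fun t => ∫ s in (-R)..t, χ s with hΦ
  have hΦd : ∀ t, HasDerivAt Φ (χ t) t := fun t =>
    intervalIntegral.integral_hasDerivAt_right (hχc.continuous.intervalIntegrable _ _)
      (hχc.continuous.stronglyMeasurableAtFilter _ _) hχc.continuous.continuousAt
  have hdΦ : deriv Φ = χ := funext fun t => (hΦd t).deriv
  have hΦc : ContDiff ℝ ∞ Φ := by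
    rw [contDiff_infty_iff_deriv]
    exact ⟨fun t => (hΦd t).differentiableAt, by rw [hdΦ]; exact hχc⟩
  have hΦs : HasCompactSupport Φ := by
    refine HasCompactSupport.of_support_subset_isCompact (isCompact_Icc (a := -R) (b := R)) ?_
    intro t ht
    by_contra h0
    refine ht ?_
    rw [mem_Icc, not_and_or, not_le, not_le] at h0
    simp only [hΦ]
    rcases h0 with h0 | h0
    · rw [intervalIntegral.integral_zero_ae]
      refine ae_of_all _ fun s hs => z s fun hs2 => ?_
      rw [uIoc_of_ge h0.le] at hs
      linarith [hs.2, hs2.1]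
    · rw [← intervalIntegral.integral_add_adjacent_intervals
        (hχc.continuous.intervalIntegrable (-R) R) (hχc.continuous.intervalIntegrable R t), hχ0,
        zero_add, intervalIntegral.integral_zero_ae]
      refine ae_of_all _ fun s hs => z s fun hs2 => ?_
      rw [uIoc_of_le h0.le] at hs
      linarith [hs.1, hs2.2]
  have key := h Φ hΦc hΦs
  rw [hdΦ] at key
  have hi1 := integrable_smul_of_compactSupport hf hφ.continuous hφs
  have hi2 := integrable_smul_of_compactSupport hf hρc.continuous hρs
  have e : ∫ t, χ t • f t = (∫ t, φ t • f t) - I • ∫ t, ρ t • f t := by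
    have hi3 : Integrable fun t => I • ρ t • f t := hi2.smul I
    rw [← integral_smul, ← integral_sub hi1 hi3]
    refine integral_congr_ae (ae_of_all _ fun t => ?_)
    simp only [hχ, sub_smul, mul_smul]
  rw [e, sub_eq_zero] at key
  rw [key, integral_smul_const]

lemma ae_eq_add_const_of_hasWeakDeriv {f g h : ℝ → Plane} (hf : HasWeakDeriv f h)
    (hg : HasWeakDeriv g h) : ∃ c : Plane, ∀ᵐ t, f t = g t + c := by
  obtain ⟨c, hc⟩ := ae_eq_const_of_weakDeriv_zero (hf.1.sub hg.1) fun φ hφ hφs => by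
    have hi1 := integrable_smul_of_compactSupport hf.1 (hφ.continuous_deriv (by simp)) hφs.deriv
    have hi2 := integrable_smul_of_compactSupport hg.1 (hφ.continuous_deriv (by simp)) hφs.deriv
    simp only [Pi.sub_apply, smul_sub]
    rw [integral_sub hi1 hi2, hf.2.2 φ hφ hφs, hg.2.2 φ hφ hφs, sub_self]
  refine ⟨c, ?_⟩
  filter_upwards [hc] with t ht
  rw [← ht]; simp

lemma HasWeakDeriv.congr {f f' g : ℝ → Plane} (h : HasWeakDeriv f g) (hff : ∀ᵐ t, f t = f' t)
    (hf' : LocallyIntegrable f') : HasWeakDeriv f' g := by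
  refine ⟨hf', h.2.1, fun φ hφ hc => ?_⟩
  rw [← h.2.2 φ hφ hc]
  refine integral_congr_ae ?_
  filter_upwards [hff] with t ht
  rw [ht]

lemma HasWeakDeriv.unique {f g g' : ℝ → Plane} (h : HasWeakDeriv f g) (h' : HasWeakDeriv f g') :
    ∀ᵐ t, g t = g' t := by
  refine ae_eq_of_integral_contDiff_smul_eq h.2.1 h'.2.1 fun φ hφ hc => ?_
  have h1 := h.2.2 φ hφ hc
  rw [h'.2.2 φ hφ hc] at h1
  exact (neg_injective h1).symm

/-- A curve of class `H²` is of class `C¹`, and its derivative has a square integrable weak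
derivative. -/
lemma IsH2Curve.contDiff {γ : ℝ → Plane} (hγ : IsH2Curve γ) : ContDiff ℝ 1 γ ∧
    HasWeakDeriv (deriv γ) (weakDeriv (deriv γ)) ∧ MemL2Loc (weakDeriv (deriv γ)) := by
  obtain ⟨hc, -, g, h, hg2, hh2, hg, hh⟩ := hγ
  obtain ⟨c, hc1⟩ := ae_eq_add_const_of_hasWeakDeriv hh (hasWeakDeriv_primitive hh.2.1)
  set g' : ℝ → Plane := fun t => (∫ s in (0 : ℝ)..t, h s) + c with hg'
  have hg'c : Continuous g' := (continuous_primitive hh.2.1).add continuous_const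
  have hprim := hasWeakDeriv_primitive hg'c.locallyIntegrable
  have hγ' : HasWeakDeriv γ g' := by
    refine ⟨hg.1, hg'c.locallyIntegrable, fun φ hφ hφs => ?_⟩
    rw [hg.2.2 φ hφ hφs]
    congr 1
    refine integral_congr_ae ?_
    filter_upwards [hc1] with t ht
    rw [ht]
  obtain ⟨c', hc2⟩ := ae_eq_add_const_of_hasWeakDeriv hγ' hprim
  have hγe : γ = fun t => (∫ s in (0 : ℝ)..t, g' s) + c' := by
    refine (Continuous.ae_eq_iff_eq volume hc ?_).1 hc2
    exact (continuous_primitive hg'c.locallyIntegrable).add continuous_const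
  have hd : ∀ t, HasDerivAt γ (g' t) t := fun t => by
    rw [hγe]
    exact (intervalIntegral.integral_hasDerivAt_right (hg'c.intervalIntegrable _ _)
      (hg'c.stronglyMeasurableAtFilter _ _) hg'c.continuousAt).add_const c'
  have hdγ : deriv γ = g' := funext fun t => (hd t).deriv
  have hC1 : ContDiff ℝ 1 γ := by
    rw [contDiff_one_iff_deriv]
    exact ⟨fun t => (hd t).differentiableAt, by rw [hdγ]; exact hg'c⟩
  have hw : HasWeakDeriv (deriv γ) h := by
    rw [hdγ]
    exact hh.congr hc1 hg'c.locallyIntegrable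
  have hex : ∃ w, HasWeakDeriv (deriv γ) w := ⟨h, hw⟩
  have hww : HasWeakDeriv (deriv γ) (weakDeriv (deriv γ)) := by
    unfold weakDeriv
    rw [dif_pos hex]
    exact hex.choose_spec
  refine ⟨hC1, hww, fun K hK => ?_⟩
  refine (memLp_congr_ae ?_).1 (hh2 K hK)
  exact ae_restrict_of_ae (hw.unique hww)

/-- Testing the weak derivative with vector fields. -/
lemma HasWeakDeriv.integral_inner {f g : ℝ → Plane} (h : HasWeakDeriv f g) {ψ : ℝ → Plane}
    (hψ : ContDiff ℝ ∞ ψ) (hc : HasCompactSupport ψ) :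
    ∫ t, (inner ℝ (f t) (deriv ψ t) : ℝ) = -∫ t, (inner ℝ (g t) (ψ t) : ℝ) := by
  have hcomp : ∀ i : Fin 2, ContDiff ℝ ∞ fun t => ψ t i := fun i =>
    (EuclideanSpace.proj i : Plane →L[ℝ] ℝ).contDiff.comp hψ
  have hcs : ∀ i : Fin 2, HasCompactSupport fun t => ψ t i := fun i =>
    hc.comp_left (g := fun v : Plane => v i) (by simp)
  have hd : ∀ (i : Fin 2) t, deriv (fun t => ψ t i) t = deriv ψ t i := fun i t =>
    ((EuclideanSpace.proj i : Plane →L[ℝ] ℝ).hasFDerivAt.comp_hasDerivAt t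
      (hψ.differentiable (by simp) t).hasDerivAt).deriv
  have hi1 : ∀ i : Fin 2, Integrable fun t => (deriv (fun t => ψ t i) t • f t) := fun i =>
    integrable_smul_of_compactSupport h.1 ((hcomp i).continuous_deriv (by simp)) (hcs i).deriv
  have hi2 : ∀ i : Fin 2, Integrable fun t => (ψ t i • g t) := fun i =>
    integrable_smul_of_compactSupport h.2.1 (hcomp i).continuous (hcs i)
  have hj1 : ∀ i : Fin 2, Integrable fun t => deriv ψ t i * f t i := fun i => by
    have := (EuclideanSpace.proj i : Plane →L[ℝ] ℝ).integrable_comp (hi1 i)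
    simpa [hd] using this
  have hj2 : ∀ i : Fin 2, Integrable fun t => ψ t i * g t i := fun i => by
    have := (EuclideanSpace.proj i : Plane →L[ℝ] ℝ).integrable_comp (hi2 i)
    simpa using this
  have key : ∀ i : Fin 2, ∫ t, deriv ψ t i * f t i = -∫ t, ψ t i * g t i := fun i => by
    have h1 := congrArg (fun v : Plane => v i) (h.2.2 _ (hcomp i) (hcs i))
    simp only [PiLp.neg_apply] at h1
    rw [integral_apply (hi1 i), integral_apply (hi2 i)] at h1
    simpa [hd] using h1
  simp only [PiLp.inner_apply, Fin.sum_univ_two, RCLike.inner_apply, conj_trivial]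
  rw [integral_add (hj1 0) (hj1 1), integral_add (hj2 0) (hj2 1), key, key]
  ring

/-! ### Density of test fields in `L²` and the limit along converging curves -/

lemma toReal_eLpNorm_two_sq {μ : Measure ℝ} {f : ℝ → Plane} (hf : MemLp f 2 μ) :
    ∫ t, ‖f t‖ ^ 2 ∂μ = (eLpNorm f 2 μ).toReal ^ 2 := by
  have h := hf.eLpNorm_eq_integral_rpow_norm (by norm_num) (by norm_num)
  rw [h, ENNReal.toReal_ofReal (by positivity)]
  simp only [ENNReal.toReal_ofNat, Real.rpow_ofNat]
  rw [← Real.rpow_natCast, ← Real.rpow_mul (integral_nonneg fun t => by positivity)]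
  norm_num

/-- Smooth cut-off functions that exhaust an open interval. -/
lemma exists_cutoff {t₀ t₁ : ℝ} (ht : t₀ < t₁) : ∃ β : ℕ → ℝ → ℝ,
    (∀ k, ContDiff ℝ ∞ (β k) ∧ tsupport (β k) ⊆ Ioo t₀ t₁ ∧ (∀ t, 0 ≤ β k t) ∧ ∀ t, β k t ≤ 1) ∧
      ∀ t ∈ Ioo t₀ t₁, ∀ᶠ k in atTop, β k t = 1 := by
  set m := (t₀ + t₁) / 2 with hm
  set ℓ := (t₁ - t₀) / 2 with hℓ
  have hℓ0 : 0 < ℓ := by simp only [hℓ]; linarith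
  have h1 : ∀ k : ℕ, 0 < ℓ * (1 - 1 / ((k : ℝ) + 2)) := fun k => by
    have : 1 / ((k : ℝ) + 2) < 1 := by
      rw [div_lt_one (by positivity)]; linarith [k.cast_nonneg (α := ℝ)]
    exact mul_pos hℓ0 (by linarith)
  have h2 : ∀ k : ℕ, ℓ * (1 - 1 / ((k : ℝ) + 2)) < ℓ * (1 - 1 / ((k : ℝ) + 3)) := fun k => by
    have : 1 / ((k : ℝ) + 3) < 1 / ((k : ℝ) + 2) :=
      one_div_lt_one_div_of_lt (by positivity) (by linarith)
    exact mul_lt_mul_of_pos_left (by linarith) hℓ0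
  refine ⟨fun k => (⟨_, _, h1 k, h2 k⟩ : ContDiffBump m), fun k => ⟨ContDiffBump.contDiff _, ?_,
    fun t => ContDiffBump.nonneg _, fun t => ContDiffBump.le_one _⟩, fun t ht1 => ?_⟩
  · rw [ContDiffBump.tsupport_eq, Real.closedBall_eq_Icc]
    intro t htt
    have h3 : 0 < 1 / ((k : ℝ) + 3) := by positivity
    have h4 : ℓ * (1 - 1 / ((k : ℝ) + 3)) < ℓ := by nlinarith
    simp only [hm, hℓ] at htt h4
    exact ⟨by linarith [htt.1], by linarith [htt.2]⟩
  · have hd : dist t m < ℓ := by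
      rw [Real.dist_eq, abs_lt]; simp only [hm, hℓ]; constructor <;> linarith [ht1.1, ht1.2]
    have hr : Tendsto (fun k : ℕ => ℓ * (1 - 1 / ((k : ℝ) + 2))) atTop (𝓝 (ℓ * (1 - 0))) := by
      refine (tendsto_const_nhds.sub ?_).const_mul _
      have h2 := (tendsto_add_atTop_iff_nat 1).2 (tendsto_one_div_add_atTop_nhds_zero_nat (𝕜 := ℝ))
      refine h2.congr fun k => ?_
      push_cast; ring
    rw [sub_zero, mul_one] at hr
    filter_upwards [hr.eventually_const_lt hd] with k hk
    exact ContDiffBump.one_of_mem_closedBall _ (Metric.mem_closedBall.2 hk.le)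

lemma tendsto_integral_cutoff {w g : ℝ → Plane} {t₀ t₁ : ℝ}
    (hw : MemLp w 2 (volume.restrict (Ioc t₀ t₁))) (hgm : MemLp g 2 (volume.restrict (Ioc t₀ t₁)))
    (hg : Continuous g) {β : ℕ → ℝ → ℝ} (hβc : ∀ k, Continuous (β k)) (hβ0 : ∀ k t, 0 ≤ β k t)
    (hβ2 : ∀ k t, β k t ≤ 1) (hβ1 : ∀ t ∈ Ioo t₀ t₁, ∀ᶠ k in atTop, β k t = 1) :
    Tendsto (fun k : ℕ => ∫ t in Ioc t₀ t₁, ‖w t - β k t • g t‖ ^ 2) atTop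
      (𝓝 (∫ t in Ioc t₀ t₁, ‖w t - g t‖ ^ 2)) := by
  refine tendsto_integral_of_dominated_convergence (fun t => (‖w t‖ + ‖g t‖) ^ 2) ?_ ?_ ?_ ?_
  · intro k
    have hb : Continuous fun t => β k t • g t := (hβc k).smul hg
    have h1 : AEStronglyMeasurable (fun t => ‖w t - β k t • g t‖)
        (volume.restrict (Ioc t₀ t₁)) := (hw.1.sub hb.aestronglyMeasurable).norm
    exact h1.pow 2
  · have h1 : MemLp (fun t => ‖w t‖ + ‖g t‖) 2 (volume.restrict (Ioc t₀ t₁)) :=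
      hw.norm.add hgm.norm
    exact h1.integrable_sq
  · intro k
    refine ae_of_all _ fun t => ?_
    rw [Real.norm_of_nonneg (by positivity)]
    refine pow_le_pow_left₀ (norm_nonneg _) ((norm_sub_le _ _).trans ?_) 2
    rw [norm_smul, Real.norm_of_nonneg (hβ0 k t)]
    have := mul_le_mul_of_nonneg_right (hβ2 k t) (norm_nonneg (g t))
    linarith
  · have hne : ∀ᵐ t ∂(volume.restrict (Ioc t₀ t₁)), t ≠ t₁ := by
      refine ae_restrict_of_ae ?_
      simp [ae_iff, measure_singleton]
    filter_upwards [ae_restrict_mem measurableSet_Ioc, hne] with t ht1 ht2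
    have ht3 : t < t₁ := lt_of_le_of_ne ht1.2 ht2
    refine tendsto_const_nhds.congr' ?_
    filter_upwards [hβ1 t ⟨ht1.1, ht3⟩] with k hk
    rw [hk, one_smul]

/-- Smooth functions with compact support in an open interval are dense in `L²`. -/
lemma exists_test_near {w : ℝ → Plane} {t₀ t₁ : ℝ} (ht : t₀ < t₁)
    (hw : MemLp w 2 (volume.restrict (Ioc t₀ t₁))) {ε : ℝ} (hε : 0 < ε) :
    ∃ ψ : ℝ → Plane, ContDiff ℝ ∞ ψ ∧ HasCompactSupport ψ ∧ tsupport ψ ⊆ Ioo t₀ t₁ ∧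
      ∫ t in Ioc t₀ t₁, ‖w t - ψ t‖ ^ 2 < ε := by
  obtain ⟨g, hgs, hgc, hg⟩ := hw.exist_eLpNorm_sub_le (by norm_num) (by norm_num)
    (ε := Real.sqrt (ε / 2)) (by positivity)
  have hgm : MemLp g 2 (volume.restrict (Ioc t₀ t₁)) :=
    hgc.continuous.memLp_of_hasCompactSupport hgs
  have hg2 : ∫ t in Ioc t₀ t₁, ‖w t - g t‖ ^ 2 ≤ ε / 2 := by
    have h1 := toReal_eLpNorm_two_sq (hw.sub hgm)
    simp only [Pi.sub_apply] at h1
    rw [h1]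
    calc _ ≤ Real.sqrt (ε / 2) ^ 2 := by
          refine pow_le_pow_left₀ ENNReal.toReal_nonneg ?_ 2
          exact ENNReal.toReal_le_of_le_ofReal (by positivity) hg
      _ = _ := Real.sq_sqrt (by positivity)
  obtain ⟨β, hβ, hβ1⟩ := exists_cutoff ht
  have hlim := tendsto_integral_cutoff hw hgm hgc.continuous (fun k => (hβ k).1.continuous)
    (fun k => (hβ k).2.2.1) (fun k => (hβ k).2.2.2) hβ1
  have hlt : ∫ t in Ioc t₀ t₁, ‖w t - g t‖ ^ 2 < ε := by linarith
  obtain ⟨k, hk⟩ := (hlim.eventually_lt_const hlt).exists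
  have hcs : HasCompactSupport fun t => β k t • g t :=
    hgs.mono fun t h0 h1 => h0 (by simp only [h1, smul_zero])
  have hts : tsupport (fun t => β k t • g t) ⊆ tsupport (β k) :=
    closure_mono fun t h0 h1 => h0 (by simp only [h1, zero_smul])
  exact ⟨fun t => β k t • g t, (hβ k).1.smul hgc, hcs, hts.trans (hβ k).2.1, hk⟩

/-- Test functions for which the dual expression almost attains `∫ ‖w‖²`. -/
lemma exists_test_dual {v w : ℝ → Plane} (hvw : HasWeakDeriv v w) (hw : MemL2Loc w) {t₀ t₁ : ℝ}
    (ht : t₀ < t₁) {ε : ℝ} (hε : 0 < ε) :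
    ∃ ψ : ℝ → Plane, ContDiff ℝ ∞ ψ ∧ HasCompactSupport ψ ∧ tsupport ψ ⊆ Ioo t₀ t₁ ∧
      (∫ t in t₀..t₁, ‖w t‖ ^ 2) - ε < -(2 * ∫ t in t₀..t₁, (inner ℝ (v t) (deriv ψ t) : ℝ))
        - ∫ t in t₀..t₁, ‖ψ t‖ ^ 2 := by
  have hw' : MemLp w 2 (volume.restrict (Ioc t₀ t₁)) :=
    (hw (Icc t₀ t₁) isCompact_Icc).mono_measure (Measure.restrict_mono Ioc_subset_Icc_self le_rfl)
  obtain ⟨ψ, hψ, hψc, hψs, hψε⟩ := exists_test_near ht hw' hε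
  refine ⟨ψ, hψ, hψc, hψs, ?_⟩
  have z : ∀ t, t ∉ Ioo t₀ t₁ → ψ t = 0 := fun t ht => by
    by_contra h0; exact ht (hψs (subset_tsupport ψ h0))
  have zd : ∀ t, t ∉ Ioo t₀ t₁ → deriv ψ t = 0 := fun t ht => by
    by_contra h0
    exact ht (hψs (closure_minimal support_deriv_subset isClosed_closure (subset_tsupport _ h0)))
  have e1 := hvw.integral_inner hψ hψc
  rw [integral_eq_interval (a := t₀) (b := t₁) (fun t h0 => by
      by_contra h1; exact h0 (by simp [zd t h1])),
    integral_eq_interval (a := t₀) (b := t₁) (fun t h0 => by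
      by_contra h1; exact h0 (by simp [z t h1]))] at e1
  rw [e1]
  have hψm : MemLp ψ 2 (volume.restrict (Ioc t₀ t₁)) :=
    hψ.continuous.memLp_of_hasCompactSupport hψc
  -- Integration by parts turns the dual expression into `∫ (2 inner w ψ - ‖ψ‖²)`, which is `∫ ‖w‖²
  -- - ∫ ‖w - ψ‖²`. Good test fields are thus `L²` approximations of `w`.
  have e2 : ∫ t in Ioc t₀ t₁, ‖w t - ψ t‖ ^ 2 = (∫ t in Ioc t₀ t₁, ‖w t‖ ^ 2)
      - 2 * (∫ t in Ioc t₀ t₁, (inner ℝ (w t) (ψ t) : ℝ)) + ∫ t in Ioc t₀ t₁, ‖ψ t‖ ^ 2 := by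
    have i1 : Integrable (fun t => ‖w t‖ ^ 2) (volume.restrict (Ioc t₀ t₁)) :=
      hw'.norm.integrable_sq
    have i2 : Integrable (fun t => ‖ψ t‖ ^ 2) (volume.restrict (Ioc t₀ t₁)) :=
      hψm.norm.integrable_sq
    have i3 : Integrable (fun t => (inner ℝ (w t) (ψ t) : ℝ)) (volume.restrict (Ioc t₀ t₁)) := by
      refine (i1.add i2).mono' (hw'.1.inner hψm.1) (ae_of_all _ fun t => ?_)
      refine (norm_inner_le_norm _ _).trans ?_
      simp only [Pi.add_apply]
      nlinarith [sq_nonneg (‖w t‖ - ‖ψ t‖), sq_nonneg (‖w t‖), sq_nonneg ‖ψ t‖]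
    have i4 : Integrable (fun t => ‖w t‖ ^ 2 - 2 * (inner ℝ (w t) (ψ t) : ℝ))
        (volume.restrict (Ioc t₀ t₁)) := i1.sub (i3.const_mul 2)
    rw [← integral_const_mul, ← integral_sub i1 (i3.const_mul 2), ← integral_add i4 i2]
    refine integral_congr_ae (ae_of_all _ fun t => ?_)
    simp only [norm_sub_sq_real]
  rw [e2] at hψε
  simp only [intervalIntegral.integral_of_le ht.le]
  linarith

/-- The sharp asymptotic lower bound for the defect of a converging sequence of curves. -/
lemma eventually_le_arcDefect_curve {l : Filter ℕ} {γ : ℕ → ℝ → Plane}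
    (hγ : ∀ n, ContDiff ℝ 1 (γ n)) {L r : ℕ → ℝ} (hL0 : ∀ n, 0 < L n)
    (hL : ∀ n t, ‖deriv (γ n) t‖ = L n) {Λ : ℝ} (hΛ : 0 < Λ)
    (hLΛ : Tendsto L l (𝓝 Λ)) (hr0 : ∀ᶠ n in l, 0 < r n) (hr : Tendsto r l (𝓝 0)) {v w : ℝ → Plane}
    (hv : Continuous v) (hv1 : ∀ t, ‖v t‖ = 1) (hvw : HasWeakDeriv v w) (hw : MemL2Loc w)
    (huv : Tendsto (fun n => ∫ t in (0 : ℝ)..1, ‖(L n)⁻¹ • deriv (γ n) t - v t‖ ^ 2) l (𝓝 0))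
    {y : ℝ} (hy : y < (∫ t in (0 : ℝ)..1, ‖w t‖ ^ 2) / (12 * Λ)) :
    ∀ᶠ n in l, ENNReal.ofReal (y * r n ^ 3) ≤ arcDefect (γ n) 0 1 (r n) := by
  set W := ∫ t in (0 : ℝ)..1, ‖w t‖ ^ 2 with hW
  rw [lt_div_iff₀ (by positivity)] at hy
  -- The loss `cos 2δ` of the sharp bound is hidden in the strict inequality for `y`.
  obtain ⟨δ, hδ0, hδ4, hδ⟩ : ∃ δ, 0 < δ ∧ δ ≤ 1 / 4 ∧ y * (12 * Λ) < Real.cos (2 * δ) * W := by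
    have h1 : Tendsto (fun δ : ℝ => Real.cos (2 * δ) * W) (𝓝[>] 0) (𝓝 (Real.cos (2 * 0) * W)) :=
      (Continuous.tendsto (by fun_prop) _).mono_left nhdsWithin_le_nhds
    simp only [mul_zero, Real.cos_zero, one_mul] at h1
    obtain ⟨δ, h2, h3⟩ := ((h1.eventually_const_lt hy).and
      (Ioc_mem_nhdsGT (show (0 : ℝ) < 1 / 4 by norm_num))).exists
    exact ⟨δ, h3.1, h3.2, h2⟩
  have hcos : 0 < Real.cos (2 * δ) := Real.cos_pos_of_mem_Ioo
    ⟨by linarith [Real.pi_gt_three], by linarith [Real.pi_gt_three]⟩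
  have hcosδ : Real.cos δ < 1 := by
    have := Real.cos_lt_cos_of_nonneg_of_le_pi (x := 0) (y := δ) le_rfl
      (by linarith [Real.pi_gt_three]) hδ0
    rwa [Real.cos_zero] at this
  set ε := Real.sqrt (2 * (1 - Real.cos δ)) / 4 with hεdef
  have hε : 0 < ε := by
    have : 0 < 2 * (1 - Real.cos δ) := by linarith
    positivity
  have hεδ : (4 * ε) ^ 2 ≤ 2 * (1 - Real.cos δ) := by
    rw [hεdef, mul_div_cancel₀ _ (by norm_num), Real.sq_sqrt (by linarith)]
  -- a partition on whose intervals `v` is almost constant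
  obtain ⟨M, hM0, hM⟩ : ∃ M : ℕ, 0 < M ∧ ∀ s ∈ Icc (0 : ℝ) 1, ∀ t ∈ Icc (0 : ℝ) 1,
      |s - t| ≤ 1 / M → ‖v s - v t‖ ≤ ε := by
    have huc := isCompact_Icc.uniformContinuousOn_of_continuous (hv.continuousOn (s := Icc (0 : ℝ) 1))
    rw [Metric.uniformContinuousOn_iff_le] at huc
    obtain ⟨d, hd, hd2⟩ := huc ε hε
    obtain ⟨M, hM⟩ := exists_nat_one_div_lt hd
    refine ⟨M + 1, by omega, fun s hs t ht hst => ?_⟩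
    rw [← dist_eq_norm]
    refine hd2 s hs t ht ?_
    rw [Real.dist_eq]
    push_cast at hst
    linarith
  have hMr : (0 : ℝ) < M := by exact_mod_cast hM0
  set p : ℕ → ℝ := fun j => j / M with hp
  have hpm : ∀ j, p j < p (j + 1) := fun j => by
    simp only [hp]; push_cast; gcongr; linarith
  have hp01 : ∀ j < M, Icc (p j) (p (j + 1)) ⊆ Icc 0 1 := by
    intro j hj t ht
    have h1 : ((j : ℝ) + 1) ≤ M := by exact_mod_cast hj
    refine ⟨le_trans (by positivity) ht.1, ht.2.trans ?_⟩
    simp only [hp]; push_cast; rw [div_le_one hMr]; exact h1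
  have hpd : ∀ j, p (j + 1) - p j = 1 / M := fun j => by
    simp only [hp]; push_cast; ring
  set W' : ℕ → ℝ := fun j => ∫ t in (p j)..(p (j + 1)), ‖w t‖ ^ 2 with hW'
  have hwi : ∀ a b, IntervalIntegrable (fun t => ‖w t‖ ^ 2) volume a b := fun a b => by
    rw [intervalIntegrable_iff]
    refine IntegrableOn.mono_set ?_ uIoc_subset_uIcc
    exact (hw _ isCompact_uIcc).norm.integrable_sq
  have hsumW : ∑ j ∈ Finset.range M, W' j = W := by
    simp only [hW']
    rw [intervalIntegral.sum_integral_adjacent_intervals (fun k _ => hwi _ _)]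
    simp only [hp, hW, Nat.cast_zero, zero_div, div_self hMr.ne']
  -- The slack is divided evenly among the `M` intervals, so that the local constants `x j` add up
  -- to exactly `y`.
  set ε' := (Real.cos (2 * δ) * W - y * (12 * Λ)) / (Real.cos (2 * δ) * M) with hε'
  have hε'0 : 0 < ε' := div_pos (by linarith) (by positivity)
  set x : ℕ → ℝ := fun j => Real.cos (2 * δ) / (12 * Λ) * (W' j - ε') with hx
  have hsumx : ∑ j ∈ Finset.range M, x j = y := by
    simp only [hx]
    rw [← Finset.mul_sum, Finset.sum_sub_distrib, hsumW, Finset.sum_const, Finset.card_range,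
      nsmul_eq_mul, hε']
    field_simp
    ring
  have hstep : ∀ j ∈ Finset.range M, ∀ᶠ n in l,
      ENNReal.ofReal (x j * r n ^ 3) ≤ arcDefect (γ n) (p j) (p (j + 1)) (r n) := by
    intro j hj
    have hj' := Finset.mem_range.1 hj
    obtain ⟨ψ, hψ, hψc, hψs, hψε⟩ := exists_test_dual hvw hw (hpm j) hε'0
    obtain ⟨φ₀, hφ₀⟩ := exists_eq_norm_smul_dir (v (p j))
    rw [hv1, one_smul] at hφ₀
    refine eventually_le_arcDefect hγ hL0 hL hΛ hLΛ hr0 hr hv (hpm j) ?_ hδ0 hδ4 hε hεδ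
      (φ₀ := φ₀) (fun t ht => ?_) hψ hψc hψs ?_
    · refine squeeze_zero (fun n => intervalIntegral.integral_nonneg (hpm j).le
        fun t _ => sq_nonneg _) (fun n => ?_) huv
      have hc := (hγ n).continuous_deriv le_rfl
      rw [intervalIntegral.integral_of_le (hpm j).le, intervalIntegral.integral_of_le zero_le_one]
      refine setIntegral_mono_set ((Continuous.integrableOn_Icc (by fun_prop)).mono_set
        Ioc_subset_Icc_self) (ae_of_all _ fun _ => sq_nonneg _) (Ioc_subset_Ioc ?_ ?_).eventuallyLE
      · exact (hp01 j hj' (left_mem_Icc.2 (hpm j).le)).1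
      · exact (hp01 j hj' (right_mem_Icc.2 (hpm j).le)).2
    · rw [← hφ₀]
      refine hM t (hp01 j hj' ht) _ (hp01 j hj' (left_mem_Icc.2 (hpm j).le)) ?_
      rw [abs_of_nonneg (by linarith [ht.1])]
      linarith [ht.2, hpd j]
    · simp only [hx]
      exact mul_lt_mul_of_pos_left hψε (by positivity)
  have hall := (Finset.eventually_all (Finset.range M)).2 hstep
  filter_upwards [hall, hr0] with n hn hrn
  have hsup : ∀ m : ℕ, ∑ j ∈ Finset.range m, arcDefect (γ n) (p j) (p (j + 1)) (r n) ≤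
      arcDefect (γ n) (p 0) (p m) (r n) := by
    have hmono : Monotone p := monotone_nat_of_le_succ fun j => (hpm j).le
    intro m
    induction m with
    | zero => simp
    | succ m ih =>
      rw [Finset.sum_range_succ]
      exact (add_le_add_left ih _).trans (arcDefect_add_le _ (hmono (Nat.zero_le _)) (hpm m).le _)
  have hpe : p 0 = 0 ∧ p M = 1 := by
    simp only [hp]; exact ⟨by simp, div_self hMr.ne'⟩
  have h2 := hsup M
  rw [hpe.1, hpe.2] at h2
  refine le_trans ?_ h2
  refine le_trans ?_ (Finset.sum_le_sum hn)
  rw [← hsumx, Finset.sum_mul]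
  generalize Finset.range M = s
  classical
  induction s using Finset.induction_on with
  | empty => simp
  | insert a s ha ih =>
    rw [Finset.sum_insert ha, Finset.sum_insert ha]
    exact ENNReal.ofReal_add_le.trans (add_le_add_right ih _)

/-! ### The length of the boundary curves is bounded by the perimeter -/

/-- Cut each curve into `M` cells and use segments of length `1`. By `le_arcCount` a curve of length
`ℓ` is crossed with measure at least `4 ℓ (1 - ℓ / M)`, while all crossings have measure at most `4
P`; let `M` tend to infinity. -/
lemma sum_curveLength_le {Ω : Set Plane} (hΩ : IsRegularSet Ω) {P : ENNReal}
    (hP : ∀ r : ℝ, 0 ≤ r → oddMeasure Ω r ≤ ENNReal.ofReal (4 * r) * P) {N : ℕ}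
    {c : Fin N → ℝ → Plane} (hc : IsBoundaryDecomposition Ω c) {ι : Type*} [Fintype ι]
    {q : ι → Fin N} (hq : Function.Injective q) :
    ENNReal.ofReal (∑ i, curveLength (c (q i))) ≤ P := by
  have hΩm : MeasurableSet Ω := hΩ.2.1.measurableSet
  have hL : ∀ i t, ‖deriv (c (q i)) t‖ = curveLength (c (q i)) := fun i => (hc.1 (q i)).2.2.2.2
  have hL0 : ∀ i, 0 ≤ curveLength (c (q i)) := fun i => by
    rw [← hL i 0]; exact norm_nonneg _
  have hC1 : ∀ i, ContDiff ℝ 1 (c (q i)) := fun i => (hc.1 (q i)).1.of_le (by simp)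
  have key : ∀ᶠ M : ℕ in atTop, ENNReal.ofReal
      (∑ i, (1 - curveLength (c (q i)) * (1 / M)) * (4 * curveLength (c (q i)))) ≤
        ENNReal.ofReal (4 * 1) * P := by
    have hev : ∀ i, ∀ᶠ M : ℕ in atTop, curveLength (c (q i)) * (1 / M) < 1 := fun i => by
      have : Tendsto (fun M : ℕ => curveLength (c (q i)) * (1 / (M : ℝ))) atTop
          (𝓝 (curveLength (c (q i)) * 0)) := tendsto_one_div_atTop_nhds_zero_nat.const_mul _
      rw [mul_zero] at this
      exact this.eventually_lt_const one_pos
    filter_upwards [eventually_all.2 hev, eventually_gt_atTop 0] with M hM hM0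
    have hMr : (0 : ℝ) < M := by exact_mod_cast hM0
    have hA : ArcFamily (ι × Fin M) (fun p => q p.1) (fun p => (p.2 : ℕ) / (M : ℝ))
        (fun p => ((p.2 : ℕ) + 1) / (M : ℝ)) := by
      refine ⟨fun p => by positivity, fun p => ?_, ?_⟩
      · rw [div_le_one hMr]; exact_mod_cast p.2.2
      · rintro ⟨i, j⟩ ⟨i', j'⟩ hne hqq
        have hi : i = i' := hq hqq
        subst hi
        have hj : (j : ℕ) ≠ j' := fun h => hne (by rw [Fin.ext h])
        rw [Set.disjoint_left]
        rintro t ht1 ht2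
        rcases lt_or_gt_of_ne hj with h | h
        · have h1 : (((j : ℕ) : ℝ) + 1) / M ≤ (j' : ℕ) / M := by
            gcongr; exact_mod_cast h
          linarith [ht1.2, ht2.1]
        · have h1 : (((j' : ℕ) : ℝ) + 1) / M ≤ (j : ℕ) / M := by
            gcongr; exact_mod_cast h
          linarith [ht1.1, ht2.2]
    refine le_trans ?_ ((sum_arcCount_le hΩ hc hA 1).trans
      (lintegral_crossCount_le hΩm hP zero_le_one))
    have hcell : ∀ p : ι × Fin M, ENNReal.ofReal ((1 - curveLength (c (q p.1)) * (1 / M)) *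
        (4 * (curveLength (c (q p.1)) * (1 / M)))) ≤
        arcCount (c (q p.1)) ((p.2 : ℕ) / (M : ℝ)) (((p.2 : ℕ) + 1) / (M : ℝ)) 1 := by
      intro p
      have e : ((p.2 : ℕ) + 1) / (M : ℝ) - (p.2 : ℕ) / (M : ℝ) = 1 / M := by ring
      have h1 : ((p.2 : ℕ) : ℝ) / (M : ℝ) ≤ ((p.2 : ℕ) + 1) / (M : ℝ) := by
        have : (0 : ℝ) < 1 / M := by positivity
        linarith
      have := le_arcCount (hC1 p.1) (hL p.1) h1 one_pos (by rw [e]; exact (hM p.1).le)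
      rwa [e] at this
    refine le_trans ?_ (Finset.sum_le_sum fun p _ => hcell p)
    rw [← ENNReal.ofReal_sum_of_nonneg, Fintype.sum_prod_type]
    · refine ENNReal.ofReal_le_ofReal (le_of_eq ?_)
      refine Finset.sum_congr rfl fun i _ => ?_
      dsimp only
      rw [Finset.sum_const, Finset.card_univ, Fintype.card_fin, nsmul_eq_mul]
      field_simp
    · intro p _
      have := hL0 p.1
      exact mul_nonneg (by linarith [hM p.1]) (by positivity)
  have hlim : Tendsto (fun M : ℕ => ENNReal.ofReal
      (∑ i, (1 - curveLength (c (q i)) * (1 / M)) * (4 * curveLength (c (q i))))) atTop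
      (𝓝 (ENNReal.ofReal (∑ i, (1 - curveLength (c (q i)) * 0) * (4 * curveLength (c (q i)))))) := by
    refine ENNReal.tendsto_ofReal (tendsto_finsetSum _ fun i _ => ?_)
    exact (tendsto_const_nhds.sub (tendsto_one_div_atTop_nhds_zero_nat.const_mul _)).mul_const _
  have h := le_of_tendsto hlim key
  simp only [mul_zero, sub_zero, one_mul] at h
  rw [← Finset.mul_sum, ENNReal.ofReal_mul (by norm_num), mul_one] at h
  exact (ENNReal.mul_le_mul_iff_right (by simp) (by simp)).1 h

/-! ### The nonlocal energy in polar coordinates -/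

lemma lintegral_polar {f : Plane → ENNReal} (hf : Measurable f) :
    ∫⁻ z, f z = ∫⁻ r in Ioi (0 : ℝ), ∫⁻ φ in Ioc (-Real.pi) Real.pi,
      ENNReal.ofReal r * f (r • dir φ) := by
  rw [← measurePreserving_pairPlane.lintegral_comp_emb measurableEmbedding_pairPlane,
    ← lintegral_comp_polarCoord_symm]
  have e : ∀ p : ℝ × ℝ, pairPlane (polarCoord.symm p) = p.1 • dir p.2 := fun p => by
    ext i; fin_cases i <;> simp [pairPlane, polarCoord, dir]
  simp_rw [e, smul_eq_mul]
  have ht : polarCoord.target = Ioi (0 : ℝ) ×ˢ Ioo (-Real.pi) Real.pi := rfl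
  have hm : Measurable fun p : ℝ × ℝ => ENNReal.ofReal p.1 * f (p.1 • dir p.2) := by
    have := measurable_dir
    fun_prop
  rw [ht, Measure.volume_eq_prod, ← Measure.prod_restrict, lintegral_prod _ hm.aemeasurable]
  refine lintegral_congr fun r => ?_
  exact setLIntegral_congr Ioo_ae_eq_Ioc

lemma measurable_oddMeasure {Ω : Set Plane} (hΩ : MeasurableSet Ω) : Measurable (oddMeasure Ω) := by
  unfold oddMeasure
  have h1 : Measurable fun q : (ℝ × ℝ) × Plane => (chg Ω q.2 (q.2 + q.1.1 • dir q.1.2) : ENNReal) :=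
    measurable_natCast_comp (measurable_chg hΩ measurable_snd
      (by have := measurable_dir; fun_prop))
  have h2 : Measurable fun p : ℝ × ℝ => ∫⁻ x, (chg Ω x (x + p.1 • dir p.2) : ENNReal) :=
    h1.lintegral_prod_right'
  exact h2.lintegral_prod_right'

lemma measurable_totalDefect {Ω : Set Plane} (hΩ : MeasurableSet Ω) :
    Measurable (totalDefect Ω) := by
  unfold totalDefect
  have h1 : Measurable fun q : (ℝ × ℝ) × Plane => defect Ω q.2 (q.1.1 • dir q.1.2) :=
    measurable_defect hΩ measurable_snd (by have := measurable_dir; fun_prop)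
  have h2 : Measurable fun p : ℝ × ℝ => ∫⁻ x, defect Ω x (p.1 • dir p.2) :=
    h1.lintegral_prod_right'
  exact h2.lintegral_prod_right'

open Classical in
lemma chg_eq (Ω : Set Plane) (x y : Plane) : (chg Ω x y : ENNReal) =
    Ω.indicator 1 x * Ωᶜ.indicator 1 y + Ωᶜ.indicator 1 x * Ω.indicator 1 y := by
  unfold chg
  by_cases hx : x ∈ Ω <;> by_cases hy : y ∈ Ω <;> simp [hx, hy]

/-- For an even kernel the interaction of `Ω` with its complement is an average over segments. -/
lemma two_mul_lintegral_interaction {Ω : Set Plane} (hΩ : MeasurableSet Ω) {k : Plane → ENNReal}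
    (hk : Measurable k) (heven : ∀ z, k (-z) = k z) :
    2 * ∫⁻ x in Ω, ∫⁻ y in Ωᶜ, k (x - y) =
      ∫⁻ z, k z * ∫⁻ x, (chg Ω x (x + z) : ENNReal) := by
  have hi : Measurable (Ω.indicator (1 : Plane → ENNReal)) := measurable_one.indicator hΩ
  have hi' : Measurable (Ωᶜ.indicator (1 : Plane → ENNReal)) := measurable_one.indicator hΩ.compl
  have hAm : Measurable fun p : Plane × Plane =>
      Ω.indicator 1 p.1 * Ωᶜ.indicator 1 p.2 * k (p.1 - p.2) := by fun_prop
  have hA : ∫⁻ x in Ω, ∫⁻ y in Ωᶜ, k (x - y) =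
      ∫⁻ x, ∫⁻ y, Ω.indicator 1 x * Ωᶜ.indicator 1 y * k (x - y) := by
    rw [← lintegral_indicator hΩ]
    refine lintegral_congr fun x => ?_
    by_cases hx : x ∈ Ω
    · simp only [hx, indicator_of_mem, Pi.one_apply, one_mul]
      rw [← lintegral_indicator hΩ.compl]
      refine lintegral_congr fun y => ?_
      by_cases hy : y ∈ Ω <;> simp [hy]
    · simp [hx]
  have hB : ∫⁻ x, ∫⁻ y, Ωᶜ.indicator 1 x * Ω.indicator 1 y * k (x - y) =
      ∫⁻ x, ∫⁻ y, Ω.indicator 1 x * Ωᶜ.indicator 1 y * k (x - y) := by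
    rw [lintegral_lintegral_swap (by fun_prop)]
    refine lintegral_congr fun x => lintegral_congr fun y => ?_
    rw [← heven (x - y), neg_sub, mul_comm (Ωᶜ.indicator 1 y)]
  have hc : Measurable fun p : Plane × Plane => (chg Ω p.1 (p.1 + p.2) : ENNReal) :=
    measurable_natCast_comp (measurable_chg hΩ measurable_fst (by fun_prop))
  calc 2 * ∫⁻ x in Ω, ∫⁻ y in Ωᶜ, k (x - y)
      = (∫⁻ x, ∫⁻ y, Ω.indicator 1 x * Ωᶜ.indicator 1 y * k (x - y)) +
        ∫⁻ x, ∫⁻ y, Ωᶜ.indicator 1 x * Ω.indicator 1 y * k (x - y) := by rw [hA, hB, two_mul]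
    _ = ∫⁻ x, ∫⁻ y, (chg Ω x y : ENNReal) * k (x - y) := by
        rw [← lintegral_add_left (hAm.lintegral_prod_right')]
        refine lintegral_congr fun x => ?_
        rw [← lintegral_add_left (by fun_prop)]
        refine lintegral_congr fun y => ?_
        rw [chg_eq, add_mul]
    _ = ∫⁻ x, ∫⁻ z, k z * (chg Ω x (x + z) : ENNReal) := by
        refine lintegral_congr fun x => ?_
        rw [← lintegral_add_left_eq_self _ x]
        refine lintegral_congr fun z => ?_
        rw [sub_add_cancel_left, heven, mul_comm]
    _ = _ := by
        rw [lintegral_lintegral_swap (by fun_prop)]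
        refine lintegral_congr fun z => ?_
        rw [lintegral_const_mul]
        exact measurable_natCast_comp (measurable_chg hΩ measurable_id (by fun_prop))

/-- The Jacobian `r` of polar coordinates cancels the singularity `1 / r` of the kernel. -/
lemma lintegral_kernel {Ω : Set Plane} (hΩ : MeasurableSet Ω) {a : ℝ} :
    2 * ∫⁻ x in Ω, ∫⁻ y in Ωᶜ, ENNReal.ofReal (Real.exp (-(a * ‖x - y‖)) / ‖x - y‖) =
      ∫⁻ r in Ioi (0 : ℝ), ENNReal.ofReal (Real.exp (-(a * r))) * oddMeasure Ω r := by
  have h := two_mul_lintegral_interaction hΩ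
    (k := fun z => ENNReal.ofReal (Real.exp (-(a * ‖z‖)) / ‖z‖)) (by fun_prop)
    (fun z => by simp only [norm_neg])
  have hc : Measurable fun p : Plane × Plane => (chg Ω p.2 (p.2 + p.1) : ENNReal) :=
    measurable_natCast_comp (measurable_chg hΩ measurable_snd (by fun_prop))
  have hc' : Measurable fun z : Plane => ∫⁻ x, (chg Ω x (x + z) : ENNReal) :=
    hc.lintegral_prod_right'
  rw [h, lintegral_polar (by fun_prop)]
  refine setLIntegral_congr_fun measurableSet_Ioi fun r hr => ?_
  have hr0 : 0 < r := hr
  simp only [norm_smul, norm_dir, mul_one, Real.norm_of_nonneg hr0.le]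
  unfold oddMeasure
  rw [← lintegral_const_mul' _ _ (by simp)]
  refine lintegral_congr fun φ => ?_
  rw [← mul_assoc, ← ENNReal.ofReal_mul hr0.le, mul_div_cancel₀ _ hr0.ne']

lemma integrableOn_pow_mul_exp {a : ℝ} (ha : 0 < a) (m : ℕ) :
    IntegrableOn (fun t : ℝ => t ^ m * Real.exp (-(a * t))) (Ioi 0) ∧
      ∫ t in Ioi (0 : ℝ), t ^ m * Real.exp (-(a * t)) = m.factorial / a ^ (m + 1) := by
  have h := Real.integral_rpow_mul_exp_neg_mul_Ioi (a := (m : ℝ) + 1) (r := a) (by positivity) ha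
  have e : ∫ t in Ioi (0 : ℝ), t ^ m * Real.exp (-(a * t)) = m.factorial / a ^ (m + 1) := by
    rw [Real.Gamma_nat_eq_factorial] at h
    simp only [add_sub_cancel_right, Real.rpow_natCast] at h
    rw [h]
    have : ((m : ℝ) + 1) = ((m + 1 : ℕ) : ℝ) := by push_cast; ring
    rw [this, Real.rpow_natCast, one_div, inv_pow, div_eq_inv_mul]
  -- The Bochner integral of a non-integrable function is `0` by default, so a positive value
  -- certifies integrability.
  refine ⟨Integrable.of_integral_ne_zero ?_, e⟩
  rw [e]
  positivity

lemma lintegral_pow_mul_exp {a : ℝ} (ha : 0 < a) (m : ℕ) :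
    ∫⁻ t in Ioi (0 : ℝ), ENNReal.ofReal (t ^ m * Real.exp (-(a * t))) =
      ENNReal.ofReal (m.factorial / a ^ (m + 1)) := by
  obtain ⟨h1, h2⟩ := integrableOn_pow_mul_exp ha m
  rw [← h2, ofReal_integral_eq_lintegral_ofReal h1]
  filter_upwards [ae_restrict_mem measurableSet_Ioi] with t ht
  have : (0 : ℝ) < t := ht
  change 0 ≤ t ^ m * Real.exp (-(a * t))
  positivity

/-- The weighted integral of the defect over all scales. -/
def defectEnergy (Ω : Set Plane) (a : ℝ) : ENNReal :=
  ∫⁻ r in Ioi (0 : ℝ), ENNReal.ofReal (Real.exp (-(a * r))) * totalDefect Ω r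

/-- Integrate the Crofton inequality against `exp (-(a * r))`. The right side gives `4 P / a²`,
halved because the interaction counts each segment in both orientations. -/
lemma interaction_add_defectEnergy_le {Ω : Set Plane} (hΩ : MeasurableSet Ω) {P : ENNReal}
    (hP : ∀ r : ℝ, 0 ≤ r → oddMeasure Ω r ≤ ENNReal.ofReal (4 * r) * P) {a : ℝ} (ha : 0 < a) :
    ENNReal.ofReal (∫ x in Ω, ∫ y in Ωᶜ, Real.exp (-(a * ‖x - y‖)) / ‖x - y‖) +
      defectEnergy Ω a ≤ ENNReal.ofReal (2 / a ^ 2) * P := by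
  -- The Bochner integral never exceeds the Lebesgue integral of the norm, so integrability of the
  -- kernel is not needed.
  have h1 : ENNReal.ofReal (∫ x in Ω, ∫ y in Ωᶜ, Real.exp (-(a * ‖x - y‖)) / ‖x - y‖) ≤
      ∫⁻ x in Ω, ∫⁻ y in Ωᶜ, ENNReal.ofReal (Real.exp (-(a * ‖x - y‖)) / ‖x - y‖) := by
    refine (Real.ofReal_le_enorm _).trans ((enorm_integral_le_lintegral_enorm _).trans ?_)
    refine lintegral_mono fun x => (enorm_integral_le_lintegral_enorm _).trans ?_
    refine lintegral_mono fun y => le_of_eq ?_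
    rw [Real.enorm_of_nonneg (by positivity)]
  have h2 : 2 * (ENNReal.ofReal (∫ x in Ω, ∫ y in Ωᶜ, Real.exp (-(a * ‖x - y‖)) / ‖x - y‖) +
      defectEnergy Ω a) ≤ 2 * (ENNReal.ofReal (2 / a ^ 2) * P) := by
    calc _ ≤ 2 * (∫⁻ x in Ω, ∫⁻ y in Ωᶜ, ENNReal.ofReal (Real.exp (-(a * ‖x - y‖)) / ‖x - y‖))
          + 2 * defectEnergy Ω a := by rw [mul_add]; gcongr
      _ = ∫⁻ r in Ioi (0 : ℝ), ENNReal.ofReal (Real.exp (-(a * r))) *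
            (oddMeasure Ω r + 2 * totalDefect Ω r) := by
          have hm := measurable_oddMeasure hΩ
          rw [lintegral_kernel hΩ, defectEnergy, ← lintegral_const_mul' _ _ (by simp),
            ← lintegral_add_left (by fun_prop)]
          refine lintegral_congr fun r => ?_
          ring
      _ ≤ ∫⁻ r in Ioi (0 : ℝ), ENNReal.ofReal (r ^ 1 * Real.exp (-(a * r))) *
            (ENNReal.ofReal 4 * P) := by
          refine setLIntegral_mono' measurableSet_Ioi fun r hr => ?_
          have hr0 : 0 < r := hr
          calc _ ≤ ENNReal.ofReal (Real.exp (-(a * r))) * (ENNReal.ofReal (4 * r) * P) := by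
                gcongr
                exact oddMeasure_add_totalDefect_le hΩ hP hr0.le
            _ = _ := by
                rw [ENNReal.ofReal_mul (by norm_num), ENNReal.ofReal_mul (by positivity), pow_one]
                ring
      _ = ENNReal.ofReal (1 / a ^ 2) * (ENNReal.ofReal 4 * P) := by
          rw [lintegral_mul_const _ (by fun_prop), lintegral_pow_mul_exp ha]
          norm_num
      _ = _ := by
          rw [← mul_assoc, ← mul_assoc, two_mul_ofReal, ← ENNReal.ofReal_mul (by positivity)]
          congr 2; ring
  exact (ENNReal.mul_le_mul_iff_right (by norm_num) (by norm_num)).1 h2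

/-- The energy bounds a multiple of the perimeter and the defect energy. -/
lemma le_energy {Ω : Set Plane} (hΩ : MeasurableSet Ω) (hfin : perimeter Ω < ⊤)
    (hP : ∀ r : ℝ, 0 ≤ r → oddMeasure Ω r ≤ ENNReal.ofReal (4 * r) * perimeter Ω) {lam α : ℝ}
    (hlam : 0 < lam) (hα : 0 < α) : defectEnergy Ω (lam * α) < ⊤ ∧
    lam ^ 2 * (1 - 1 / (2 * Real.pi * α ^ 2)) * (perimeter Ω).toReal +
      lam ^ 4 / (4 * Real.pi) * (defectEnergy Ω (lam * α)).toReal ≤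
      lam ^ 2 * energy lam α Ω := by
  have h := interaction_add_defectEnergy_le hΩ hP (a := lam * α) (by positivity)
  set N := ∫ x in Ω, ∫ y in Ωᶜ, Real.exp (-(lam * α * ‖x - y‖)) / ‖x - y‖ with hN
  have hN0 : 0 ≤ N := integral_nonneg fun x => integral_nonneg fun y => by positivity
  have htop : ENNReal.ofReal (2 / (lam * α) ^ 2) * perimeter Ω < ⊤ :=
    ENNReal.mul_lt_top (by simp) hfin
  have hD : defectEnergy Ω (lam * α) < ⊤ := lt_of_le_of_lt (le_add_self.trans h) htop
  refine ⟨hD, ?_⟩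
  have h2 := ENNReal.toReal_mono htop.ne h
  rw [ENNReal.toReal_add (by simp) hD.ne, ENNReal.toReal_ofReal hN0, ENNReal.toReal_mul,
    ENNReal.toReal_ofReal (by positivity)] at h2
  unfold energy
  rw [← hN]
  set D := (defectEnergy Ω (lam * α)).toReal
  set p := (perimeter Ω).toReal
  have h3 : lam ^ 4 / (4 * Real.pi) * (N + D) ≤
      lam ^ 4 / (4 * Real.pi) * (2 / (lam * α) ^ 2 * p) := by gcongr
  have h4 : lam ^ 4 / (4 * Real.pi) * (2 / (lam * α) ^ 2 * p) =
      lam ^ 2 * (1 / (2 * Real.pi * α ^ 2)) * p := by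
    field_simp; ring
  have h5 : lam ^ 2 * (p - lam ^ 2 / (4 * Real.pi) * N) =
      lam ^ 2 * p - lam ^ 4 / (4 * Real.pi) * N := by ring
  rw [h5]
  linarith

/-- Substitute `r = s / lam`. The differential uses one power of `lam`; the remaining `lam ^ 3`
compensates the cubic smallness of the defect. -/
lemma defectEnergy_rescale (Ω : Set Plane) {lam α : ℝ} (hlam : 0 < lam) :
    ENNReal.ofReal (lam ^ 4) * defectEnergy Ω (lam * α) =
      ∫⁻ s in Ioi (0 : ℝ), ENNReal.ofReal (Real.exp (-(α * s))) *
        (ENNReal.ofReal (lam ^ 3) * totalDefect Ω (s / lam)) := by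
  have himg : (fun s : ℝ => s / lam) '' Ioi 0 = Ioi 0 := by
    ext x
    constructor
    · rintro ⟨s, hs, rfl⟩
      exact div_pos hs hlam
    · intro hx
      exact ⟨x * lam, mul_pos hx hlam, by field_simp⟩
  have h := lintegral_image_eq_lintegral_abs_deriv_mul (s := Ioi (0 : ℝ))
    (f := fun s => s / lam) (f' := fun _ => 1 / lam) measurableSet_Ioi
    (fun x _ => ((hasDerivAt_id x).div_const lam).hasDerivWithinAt)
    (fun x _ y _ hxy => by
      simp only at hxy
      field_simp at hxy
      exact hxy)
    (fun r => ENNReal.ofReal (Real.exp (-(lam * α * r))) * totalDefect Ω r)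
  rw [himg] at h
  rw [defectEnergy, h, ← lintegral_const_mul' _ _ (by simp)]
  refine lintegral_congr fun s => ?_
  rw [abs_of_pos (by positivity)]
  have e1 : lam * α * (s / lam) = α * s := by field_simp
  have e2 : ENNReal.ofReal (lam ^ 4) * ENNReal.ofReal (1 / lam) = ENNReal.ofReal (lam ^ 3) := by
    rw [← ENNReal.ofReal_mul (by positivity)]; congr 1; field_simp
  rw [e1, ← e2]
  ring

/-! ### The perimeter bounds the measure of the segments with exactly one end point in the set -/

open scoped Manifold in
lemma exists_inner_cutoff {Ω : Set Plane} (hΩ : IsOpen Ω) (hb : Bornology.IsBounded Ω) {ε : ℝ}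
    (hε : 0 < ε) : ∃ G : Plane → ℝ, ContDiff ℝ ∞ G ∧ HasCompactSupport G ∧
      (∀ x, G x ∈ Icc 0 1) ∧ (∀ x ∉ Ω, G x = 0) ∧ ∫ x in Ω, (1 - G x) ≤ ε := by
  have hfin : volume Ω ≠ ⊤ := hb.measure_lt_top.ne
  obtain ⟨K, hKΩ, hKc, hK⟩ := hΩ.measurableSet.exists_isCompact_sdiff_lt hfin
    (ε := ENNReal.ofReal ε) (by simpa using hε)
  obtain ⟨f, hf0, hf1, hf⟩ := exists_contMDiffMap_zero_one_of_isClosed (n := (⊤ : ℕ∞)) 𝓘(ℝ, Plane)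
    hΩ.isClosed_compl hKc.isClosed (disjoint_compl_left_iff_subset.2 hKΩ)
  refine ⟨f, f.contMDiff.contDiff, ?_, hf, fun x hx => hf0 hx, ?_⟩
  · refine HasCompactSupport.of_support_subset_isCompact hb.isCompact_closure ?_
    intro x hx
    by_contra h
    exact hx (hf0 fun h2 => h (subset_closure h2))
  · have hm : Continuous f := f.contMDiff.continuous
    have hKm := hKc.isClosed.measurableSet
    have hInt : IntegrableOn (fun x => 1 - f x) Ω := by
      have : IsFiniteMeasure (volume.restrict Ω) := ⟨by simpa using hfin.lt_top⟩
      refine Integrable.of_bound (by fun_prop) 1 (ae_of_all _ fun x => ?_)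
      rw [Real.norm_eq_abs, abs_le]
      constructor <;> linarith [(hf x).1, (hf x).2]
    rw [← integral_inter_add_sdiff hKm hInt]
    have h1 : ∫ x in Ω ∩ K, (1 - f x) = 0 := by
      refine setIntegral_eq_zero_of_forall_eq_zero fun x hx => ?_
      rw [hf1 hx.2]; simp
    rw [h1, zero_add]
    have h2 : volume (Ω \ K) < ⊤ := lt_of_le_of_lt (measure_mono sdiff_subset) hfin.lt_top
    have h3 := norm_setIntegral_le_of_norm_le_const h2 (f := fun x => 1 - f x) (C := 1)
      fun x _ => by
        rw [Real.norm_eq_abs, abs_le]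
        constructor <;> linarith [(hf x).1, (hf x).2]
    refine (le_abs_self _).trans (h3.trans ?_)
    rw [one_mul]
    exact ENNReal.toReal_le_of_le_ofReal hε.le hK.le

/-- The directions and the positions along a segment of length `r`. -/
def segMeasure (r : ℝ) : Measure (ℝ × ℝ) :=
  (volume.restrict (Ioc (-Real.pi) Real.pi)).prod (volume.restrict (Ioc 0 r))

instance (r : ℝ) : IsFiniteMeasure (segMeasure r) := by
  unfold segMeasure
  have : IsFiniteMeasure (volume.restrict (Ioc (-Real.pi) Real.pi)) := ⟨by simp⟩
  have : IsFiniteMeasure (volume.restrict (Ioc 0 r)) := ⟨by simp⟩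
  infer_instance

/-- The average over all directions of the directional increments of `G`. -/
def segField (G : Plane → ℝ) (r : ℝ) (x : Plane) : Plane :=
  ∫ p, (G (x + (r - p.2) • dir p.1) - G (x - p.2 • dir p.1)) • dir p.1 ∂(segMeasure r)

/-- The derivative of `segField`. -/
def segFieldDeriv (G : Plane → ℝ) (r : ℝ) (x : Plane) (p : ℝ × ℝ) : Plane →L[ℝ] Plane :=
  (fderiv ℝ G (x + (r - p.2) • dir p.1) - fderiv ℝ G (x - p.2 • dir p.1)).smulRight (dir p.1)

lemma continuous_segFieldDeriv {G : Plane → ℝ} (hG : ContDiff ℝ ∞ G) (r : ℝ) :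
    Continuous (Function.uncurry (segFieldDeriv G r)) := by
  have h1 := hG.continuous_fderiv (by simp)
  have h2 := continuous_dir
  unfold segFieldDeriv
  simp only [Function.uncurry_def]
  have h3 : Continuous fun p : Plane × (ℝ × ℝ) =>
      (ContinuousLinearMap.smulRightL ℝ Plane Plane)
        (fderiv ℝ G (p.1 + (r - p.2.2) • dir p.2.1) - fderiv ℝ G (p.1 - p.2.2 • dir p.2.1))
        (dir p.2.1) := by fun_prop
  exact h3

lemma hasFDerivAt_segField {G : Plane → ℝ} (hG : ContDiff ℝ ∞ G) (hc : HasCompactSupport G) (r : ℝ) :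
    ∃ C : ℝ, (∀ x p, ‖segFieldDeriv G r x p‖ ≤ C) ∧ ∀ x,
      HasFDerivAt (segField G r) (∫ p, segFieldDeriv G r x p ∂(segMeasure r)) x := by
  obtain ⟨C, hC⟩ := (hc.fderiv (𝕜 := ℝ)).exists_bound_of_continuous (hG.continuous_fderiv (by simp))
  obtain ⟨B, hB⟩ := hc.exists_bound_of_continuous hG.continuous
  have hGc := hG.continuous
  have hd := continuous_dir
  have hbd : ∀ x p, ‖segFieldDeriv G r x p‖ ≤ C + C := fun x p => by
    unfold segFieldDeriv
    rw [ContinuousLinearMap.norm_smulRight_apply, norm_dir, mul_one]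
    exact (norm_sub_le _ _).trans (add_le_add (hC _) (hC _))
  refine ⟨C + C, hbd, fun x => ?_⟩
  refine hasFDerivAt_integral_of_dominated_of_fderiv_le (bound := fun _ => C + C)
    (F := fun x (p : ℝ × ℝ) => (G (x + (r - p.2) • dir p.1) - G (x - p.2 • dir p.1)) • dir p.1)
    (F' := segFieldDeriv G r) (univ_mem) ?_ ?_ ?_ ?_ (integrable_const _) ?_
  · exact Eventually.of_forall fun x => Continuous.aestronglyMeasurable (by fun_prop)
  · refine Integrable.of_bound (Continuous.aestronglyMeasurable (by fun_prop)) (B + B)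
      (ae_of_all _ fun p => ?_)
    rw [norm_smul, norm_dir, mul_one]
    exact (norm_sub_le _ _).trans (add_le_add (hB _) (hB _))
  · exact ((continuous_segFieldDeriv hG r).comp (Continuous.prodMk_right x)).aestronglyMeasurable
  · exact ae_of_all _ fun p x _ => hbd x p
  · refine ae_of_all _ fun p x _ => ?_
    have h1 : HasFDerivAt (fun x => G (x + (r - p.2) • dir p.1))
        (fderiv ℝ G (x + (r - p.2) • dir p.1)) x :=
      (hG.differentiable (by simp) _).hasFDerivAt.comp x ((hasFDerivAt_id x).add_const _)
    have h2 : HasFDerivAt (fun x => G (x - p.2 • dir p.1)) (fderiv ℝ G (x - p.2 • dir p.1)) x :=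
      (hG.differentiable (by simp) _).hasFDerivAt.comp x ((hasFDerivAt_id x).sub_const _)
    exact (h1.sub h2).smul_const (dir p.1)

lemma isTestField_segField {G : Plane → ℝ} (hG : ContDiff ℝ ∞ G) (hc : HasCompactSupport G) (r : ℝ) :
    IsTestField (segField G r) := by
  obtain ⟨C, hC, hd⟩ := hasFDerivAt_segField hG hc r
  refine ⟨?_, ?_⟩
  · rw [contDiff_one_iff_fderiv]
    refine ⟨fun x => (hd x).differentiableAt, ?_⟩
    have : fderiv ℝ (segField G r) = fun x => ∫ p, segFieldDeriv G r x p ∂(segMeasure r) :=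
      funext fun x => (hd x).fderiv
    rw [this]
    have hcont := continuous_segFieldDeriv hG r
    refine continuous_of_dominated (bound := fun _ => C) (fun x => ?_)
      (fun x => ae_of_all _ fun p => hC x p) (integrable_const _)
      (ae_of_all _ fun p => hcont.comp (Continuous.prodMk_left p))
    exact (hcont.comp (Continuous.prodMk_right x)).aestronglyMeasurable
  · obtain ⟨R, hR⟩ := hc.isCompact.isBounded.subset_closedBall 0
    refine HasCompactSupport.of_support_subset_isCompact
      (isCompact_closedBall (0 : Plane) (R + |r|)) ?_
    intro x hx
    by_contra h
    refine hx ?_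
    have hz : ∀ y : Plane, ‖y‖ ≤ |r| → G (x + y) = 0 := by
      intro y hy
      by_contra h0
      have h1 := hR (subset_tsupport G h0)
      rw [mem_closedBall_zero_iff] at h1 h
      have : ‖x‖ ≤ ‖x + y‖ + ‖y‖ := by
        have := norm_sub_le (x + y) y
        rwa [add_sub_cancel_right] at this
      exact h (by linarith)
    unfold segField
    refine integral_eq_zero_of_ae ?_
    unfold segMeasure
    rw [Measure.prod_restrict]
    filter_upwards [ae_restrict_mem (measurableSet_Ioc.prod measurableSet_Ioc)] with p hp
    have hp2 := hp.2
    have hr0 : 0 < r := hp2.1.trans_le hp2.2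
    rw [hz, sub_eq_add_neg x, hz]
    · simp
    · rw [norm_neg, norm_smul, norm_dir, mul_one, Real.norm_eq_abs, abs_of_pos hp2.1, abs_of_pos hr0]
      exact hp2.2
    · rw [norm_smul, norm_dir, mul_one, Real.norm_eq_abs, abs_of_pos hr0,
        abs_of_nonneg (by linarith [hp2.2])]
      linarith [hp2.1]

/-- Increments of `G` are at most `1` in absolute value, so a component in direction `dir β` is at
most `r` times the integral of `|cos (φ - β)|` over the circle, which is `4`. This is the source of
Crofton's constant. -/
lemma norm_segField_le {G : Plane → ℝ} (hG : ContDiff ℝ ∞ G) (h01 : ∀ x, G x ∈ Icc (0 : ℝ) 1) {r : ℝ}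
    (hr : 0 ≤ r) (x : Plane) : ‖segField G r x‖ ≤ 4 * r := by
  have hGc := hG.continuous
  have hd := continuous_dir
  have hn := continuous_nrm
  obtain ⟨β, hβ⟩ := exists_eq_norm_smul_dir (segField G r x)
  have h1 : ‖segField G r x‖ = inner ℝ (dir β) (segField G r x) := by
    conv_rhs => rw [hβ]
    rw [inner_smul_right, real_inner_self_eq_norm_sq, norm_dir]; ring
  have hab : ∀ p : ℝ × ℝ, |G (x + (r - p.2) • dir p.1) - G (x - p.2 • dir p.1)| ≤ 1 := fun p => by
    rw [abs_le]
    constructor <;> linarith [(h01 (x + (r - p.2) • dir p.1)).1, (h01 (x + (r - p.2) • dir p.1)).2,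
      (h01 (x - p.2 • dir p.1)).1, (h01 (x - p.2 • dir p.1)).2]
  have hInt : Integrable (fun p : ℝ × ℝ => (G (x + (r - p.2) • dir p.1) - G (x - p.2 • dir p.1)) •
      dir p.1) (segMeasure r) := by
    refine Integrable.of_bound (Continuous.aestronglyMeasurable (by fun_prop)) 1
      (ae_of_all _ fun p => ?_)
    rw [norm_smul, norm_dir, mul_one]; exact hab p
  have hkey : ∀ φ, (inner ℝ (dir β) (dir φ) : ℝ) = inner ℝ (nrm β) (nrm φ) := fun φ => by
    rw [inner_dir_dir, inner_nrm, Real.cos_sub]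
    simp [nrm, perp, dir]
  rw [h1, segField, ← integral_inner hInt]
  have hint2 : Integrable (fun p : ℝ × ℝ => |(inner ℝ (nrm β) (nrm p.1) : ℝ)|) (segMeasure r) := by
    refine Integrable.of_bound (Continuous.aestronglyMeasurable (by fun_prop)) 1
      (ae_of_all _ fun p => ?_)
    rw [norm_abs_eq_norm]
    refine (norm_inner_le_norm _ _).trans ?_
    rw [norm_nrm, norm_nrm, one_mul]
  calc _ ≤ ∫ p, |(inner ℝ (nrm β) (nrm p.1) : ℝ)| ∂(segMeasure r) := by
        refine integral_mono (hInt.const_inner _) hint2 fun p => ?_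
        simp only [inner_smul_right]
        refine (le_abs_self _).trans ?_
        rw [abs_mul, hkey]
        exact mul_le_of_le_one_left (abs_nonneg _) (hab p)
    _ = r * ∫ φ in (-Real.pi)..Real.pi, |(inner ℝ (nrm β) (nrm φ) : ℝ)| := by
        unfold segMeasure at hint2 ⊢
        rw [integral_prod _ hint2, intervalIntegral.integral_of_le (by linarith [Real.pi_pos]),
          ← integral_const_mul]
        refine integral_congr_ae (ae_of_all _ fun φ => ?_)
        simp [hr]
    _ = _ := by rw [integral_abs_inner_nrm_circle, norm_nrm]; ring

lemma sum_smulRight (A : Plane →L[ℝ] ℝ) (v : Plane) :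
    ∑ i : Fin 2, (A.smulRight v (EuclideanSpace.single i 1)) i = A v := by
  have hv : v = v 0 • EuclideanSpace.single 0 1 + v 1 • EuclideanSpace.single 1 1 := by
    ext i; fin_cases i <;> simp
  conv_rhs => rw [hv, map_add, map_smul, map_smul]
  simp only [Fin.sum_univ_two, ContinuousLinearMap.smulRight_apply, PiLp.smul_apply, smul_eq_mul]
  ring

/-- For fixed `φ` the divergence of the integrand is a derivative with respect to the position `t`
along the segment, so the integral in `t` collapses to a second difference of `G` at distance `r`.
-/
lemma divergence_segField {G : Plane → ℝ} (hG : ContDiff ℝ ∞ G) (hc : HasCompactSupport G) {r : ℝ}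
    (hr : 0 ≤ r) (x : Plane) : divergence (segField G r) x =
      ∫ φ in Ioc (-Real.pi) Real.pi, (G (x + r • dir φ) + G (x - r • dir φ) - 2 * G x) := by
  obtain ⟨C, hC, hd⟩ := hasFDerivAt_segField hG hc r
  have hcont := continuous_segFieldDeriv hG r
  have hInt : Integrable (fun p => segFieldDeriv G r x p) (segMeasure r) :=
    Integrable.of_bound (hcont.comp (Continuous.prodMk_right x)).aestronglyMeasurable C
      (ae_of_all _ fun p => hC x p)
  unfold divergence
  rw [(hd x).fderiv]
  have e1 : ∀ i : Fin 2, ((∫ p, segFieldDeriv G r x p ∂(segMeasure r)) (EuclideanSpace.single i 1)) i =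
      ∫ p, (segFieldDeriv G r x p (EuclideanSpace.single i 1)) i ∂(segMeasure r) := fun i => by
    rw [ContinuousLinearMap.integral_apply hInt]
    exact ((EuclideanSpace.proj i : Plane →L[ℝ] ℝ).integral_comp_comm
      (hInt.apply_continuousLinearMap _)).symm
  simp_rw [e1]
  rw [← integral_finsetSum]
  swap
  · intro i _
    exact (EuclideanSpace.proj i : Plane →L[ℝ] ℝ).integrable_comp (hInt.apply_continuousLinearMap _)
  simp_rw [segFieldDeriv, sum_smulRight]
  have hd' := continuous_dir
  have hf' := hG.continuous_fderiv (by simp : (∞ : WithTop ℕ∞) ≠ 0)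
  have hint2 : Integrable (fun p : ℝ × ℝ => (fderiv ℝ G (x + (r - p.2) • dir p.1) -
      fderiv ℝ G (x - p.2 • dir p.1)) (dir p.1)) (segMeasure r) := by
    obtain ⟨C, hC⟩ := (hc.fderiv (𝕜 := ℝ)).exists_bound_of_continuous hf'
    refine Integrable.of_bound (Continuous.aestronglyMeasurable (by fun_prop)) (C + C)
      (ae_of_all _ fun p => ?_)
    refine (ContinuousLinearMap.le_opNorm _ _).trans ?_
    rw [norm_dir, mul_one]
    exact (norm_sub_le _ _).trans (add_le_add (hC _) (hC _))
  unfold segMeasure at hint2 ⊢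
  rw [integral_prod _ hint2]
  refine integral_congr_ae (ae_of_all _ fun φ => ?_)
  simp only
  rw [← intervalIntegral.integral_of_le hr]
  have hderiv : ∀ t, HasDerivAt (fun t => -G (x + (r - t) • dir φ) + G (x - t • dir φ))
      ((fderiv ℝ G (x + (r - t) • dir φ) - fderiv ℝ G (x - t • dir φ)) (dir φ)) t := by
    intro t
    have h1 : HasDerivAt (fun t : ℝ => x + (r - t) • dir φ) (-dir φ) t := by
      have := (((hasDerivAt_id t).const_sub r).smul_const (dir φ)).const_add x
      simpa using this
    have h2 : HasDerivAt (fun t : ℝ => x - t • dir φ) (-dir φ) t := by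
      have := ((hasDerivAt_id t).smul_const (dir φ)).const_sub x
      simpa using this
    have h3 := (hG.differentiable (by simp) (x + (r - t) • dir φ)).hasFDerivAt.comp_hasDerivAt t h1
    have h4 := (hG.differentiable (by simp) (x - t • dir φ)).hasFDerivAt.comp_hasDerivAt t h2
    have h5 := h3.neg.add h4
    simp only [map_neg, neg_neg] at h5
    rw [_root_.sub_apply, sub_eq_add_neg]
    exact h5
  rw [intervalIntegral.integral_eq_sub_of_hasDerivAt (fun t _ => hderiv t)
    (Continuous.intervalIntegrable (by fun_prop) _ _)]
  simp only [sub_self, zero_smul, add_zero, sub_zero]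
  ring

/-- Translating by `z` the segments that end in `Ω` makes both kinds of odd segments based at points
of `Ω`. -/
lemma lintegral_chg_eq {Ω : Set Plane} (hΩ : MeasurableSet Ω) (z : Plane) :
    ∫⁻ x, (chg Ω x (x + z) : ENNReal) = ∫⁻ x in Ω,
      ENNReal.ofReal (2 - Ω.indicator 1 (x + z) - Ω.indicator 1 (x - z)) := by
  have hi : Measurable (Ω.indicator (1 : Plane → ENNReal)) := measurable_one.indicator hΩ
  have hi' : Measurable (Ωᶜ.indicator (1 : Plane → ENNReal)) := measurable_one.indicator hΩ.compl
  simp_rw [chg_eq]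
  rw [lintegral_add_left (by fun_prop),
    ← lintegral_sub_right_eq_self (fun x => Ωᶜ.indicator 1 x * Ω.indicator 1 (x + z)) z,
    ← lintegral_add_left (by fun_prop), ← lintegral_indicator hΩ]
  refine lintegral_congr fun x => ?_
  rw [sub_add_cancel]
  by_cases h0 : x ∈ Ω <;> by_cases h1 : x + z ∈ Ω <;> by_cases h2 : x - z ∈ Ω <;>
    simp [h0, h1, h2] <;> norm_num

lemma divergence_const_smul {F : Plane → Plane} (hF : IsTestField F) (a : ℝ) (x : Plane) :
    divergence (fun y => a • F y) x = a * divergence F x := by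
  unfold divergence
  rw [fderiv_fun_const_smul (hF.1.differentiable (by simp) x), Finset.mul_sum]
  rfl

lemma IsTestField.const_smul {F : Plane → Plane} (hF : IsTestField F) (a : ℝ) :
    IsTestField (fun y => a • F y) :=
  ⟨hF.1.const_smul a, hF.2.mono fun x hx h => hx (by simp [h])⟩

/-- The measure of the segments of length `r` with exactly one end point in `Ω` is at most `4 r`
times the perimeter. -/
lemma oddMeasure_le {Ω : Set Plane} (hΩ : IsOpen Ω) (hb : Bornology.IsBounded Ω) {r : ℝ}
    (hr : 0 ≤ r) : oddMeasure Ω r ≤ ENNReal.ofReal (4 * r) * perimeter Ω := by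
  rcases hr.eq_or_lt with rfl | hr0
  · simp [oddMeasure, chg]
  have hΩm := hΩ.measurableSet
  have : IsFiniteMeasure (volume.restrict (Ioc (-Real.pi) Real.pi)) := ⟨by simp⟩
  have : IsFiniteMeasure (volume.restrict Ω) := ⟨by simpa using hb.measure_lt_top⟩
  set μ : Measure (ℝ × Plane) :=
    (volume.restrict (Ioc (-Real.pi) Real.pi)).prod (volume.restrict Ω) with hμ
  set χ : Plane → ℝ := Ω.indicator 1 with hχ
  have hχm : Measurable χ := measurable_one.indicator hΩm
  have hχ1 : ∀ x, χ x ≤ 1 := fun x => indicator_le_self' (by simp) x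
  have hχ0 : ∀ x, 0 ≤ χ x := fun x => indicator_nonneg (by simp) x
  have hd := continuous_dir
  have hdm := measurable_dir
  set a : ℝ × Plane → ℝ := fun p => 2 - χ (p.2 + r • dir p.1) - χ (p.2 - r • dir p.1) with ha
  have ham : Measurable a := by fun_prop
  have ha0 : ∀ p, 0 ≤ a p := fun p => by
    simp only [ha]; linarith [hχ1 (p.2 + r • dir p.1), hχ1 (p.2 - r • dir p.1)]
  have haint : Integrable a μ := by
    refine Integrable.of_bound ham.aestronglyMeasurable 2 (ae_of_all _ fun p => ?_)
    rw [Real.norm_of_nonneg (ha0 p)]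
    simp only [ha]; linarith [hχ0 (p.2 + r • dir p.1), hχ0 (p.2 - r • dir p.1)]
  have hodd : oddMeasure Ω r = ENNReal.ofReal (∫ p, a p ∂μ) := by
    rw [ofReal_integral_eq_lintegral_ofReal haint (ae_of_all _ ha0),
      lintegral_prod _ (by fun_prop)]
    unfold oddMeasure
    exact lintegral_congr fun φ => lintegral_chg_eq hΩm _
  rw [hodd]
  refine ENNReal.le_of_forall_pos_le_add fun ε hε _ => ?_
  -- Replacing the indicator by `G` costs `2 * (1 - G)` over `Ω` for each of the directions of total
  -- measure `2π`, hence `ε` altogether.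
  have hδ : 0 < (ε : ℝ) / (4 * Real.pi) := by positivity
  obtain ⟨G, hG, hGc, hG01, hG0, hGint⟩ := exists_inner_cutoff hΩ hb hδ
  have hGcont := hG.continuous
  have hGχ : ∀ x, G x ≤ χ x := fun x => by
    by_cases hx : x ∈ Ω
    · simpa [hχ, hx] using (hG01 x).2
    · simp [hχ, hx, hG0 x hx]
  set b : ℝ × Plane → ℝ := fun p => 2 * G p.2 - G (p.2 + r • dir p.1) - G (p.2 - r • dir p.1) with hb'
  have hbint : Integrable b μ := by
    refine Integrable.of_bound (Continuous.aestronglyMeasurable (by fun_prop)) 2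
      (ae_of_all _ fun p => ?_)
    rw [Real.norm_eq_abs, abs_le]
    simp only [hb']
    have h1 := hG01 p.2
    have h2 := hG01 (p.2 + r • dir p.1)
    have h3 := hG01 (p.2 - r • dir p.1)
    constructor <;> linarith [h1.1, h1.2, h2.1, h2.2, h3.1, h3.2]
  have hgint : Integrable (fun p : ℝ × Plane => 2 * (1 - G p.2)) μ := by
    refine Integrable.of_bound (Continuous.aestronglyMeasurable (by fun_prop)) 2
      (ae_of_all _ fun p => ?_)
    rw [Real.norm_eq_abs, abs_le]
    constructor <;> linarith [(hG01 p.2).1, (hG01 p.2).2]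
  have hle : ∫ p, a p ∂μ ≤ (∫ p, b p ∂μ) + ε := by
    calc ∫ p, a p ∂μ ≤ ∫ p, (b p + 2 * (1 - G p.2)) ∂μ := by
          refine integral_mono haint (hbint.add hgint) fun p => ?_
          simp only [ha, hb']
          linarith [hGχ (p.2 + r • dir p.1), hGχ (p.2 - r • dir p.1)]
      _ = (∫ p, b p ∂μ) + 2 * Real.pi * (2 * ∫ x in Ω, (1 - G x)) := by
          rw [integral_add hbint hgint, hμ, integral_prod _ hgint]
          simp only [integral_const_mul, integral_const]
          simp [Real.pi_pos.le]
          ring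
      _ ≤ _ := by
          have : 2 * Real.pi * (2 * ∫ x in Ω, (1 - G x)) ≤
              2 * Real.pi * (2 * ((ε : ℝ) / (4 * Real.pi))) := by gcongr
          have e : 2 * Real.pi * (2 * ((ε : ℝ) / (4 * Real.pi))) = ε := by
            field_simp; norm_num
          linarith
  have hF := isTestField_segField hG hGc r
  -- The divergence of `segField` is minus the integral of `b` over the directions, which explains
  -- the sign; the factor `1 / (4 r)` normalizes the field to length at most one.
  have hdiv : ∫ x in Ω, divergence (fun y => (-(4 * r)⁻¹) • segField G r y) x =
      (4 * r)⁻¹ * ∫ p, b p ∂μ := by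
    simp_rw [divergence_const_smul hF, divergence_segField hG hGc hr]
    rw [integral_const_mul, hμ, integral_prod_symm _ hbint, neg_mul, ← mul_neg, ← integral_neg]
    congr 1
    refine integral_congr_ae (ae_of_all _ fun x => ?_)
    simp only
    rw [← integral_neg]
    refine integral_congr_ae (ae_of_all _ fun φ => ?_)
    simp only [hb']
    ring
  have hper : ENNReal.ofReal ((4 * r)⁻¹ * ∫ p, b p ∂μ) ≤ perimeter Ω := by
    rw [← hdiv]
    unfold perimeter
    refine le_iSup_of_le _ (le_iSup_of_le (hF.const_smul (-(4 * r)⁻¹)) (le_iSup_of_le ?_ le_rfl))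
    intro x
    rw [norm_smul, norm_neg, Real.norm_of_nonneg (by positivity), inv_mul_le_iff₀ (by positivity),
      mul_one]
    exact norm_segField_le hG hG01 hr x
  calc ENNReal.ofReal (∫ p, a p ∂μ) ≤ ENNReal.ofReal ((∫ p, b p ∂μ) + ε) :=
        ENNReal.ofReal_le_ofReal hle
    _ ≤ ENNReal.ofReal (∫ p, b p ∂μ) + ε := by
        refine ENNReal.ofReal_add_le.trans ?_
        rw [ENNReal.ofReal_coe_nnreal]
    _ = ENNReal.ofReal (4 * r) * ENNReal.ofReal ((4 * r)⁻¹ * ∫ p, b p ∂μ) + ε := by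
        rw [← ENNReal.ofReal_mul (by positivity), mul_inv_cancel_left₀ (by positivity)]
    _ ≤ _ := by gcongr

/-! ### Convergence of the boundary curves -/

lemma HasWeakDeriv.const_smul {f g : ℝ → Plane} (h : HasWeakDeriv f g) (a : ℝ) :
    HasWeakDeriv (fun t => a • f t) (fun t => a • g t) := by
  refine ⟨h.1.smul a, h.2.1.smul a, fun φ hφ hc => ?_⟩
  have h1 := h.2.2 φ hφ hc
  simp_rw [smul_comm _ a]
  rw [integral_smul, integral_smul, h1, smul_neg]

lemma MemL2Loc.const_smul {f : ℝ → Plane} (h : MemL2Loc f) (a : ℝ) :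
    MemL2Loc (fun t => a • f t) := fun K hK => (h K hK).const_smul a

lemma tendsto_integral_deriv_sub {γ : ℕ → ℝ → Plane} {η : ℝ → Plane}
    (hγ : ∀ n, ContDiff ℝ 1 (γ n)) (hη : ContDiff ℝ 1 η)
    (h : Tendsto (fun n => h1DistSq (γ n) η) atTop (𝓝 0)) :
    Tendsto (fun n => ∫ t in (0 : ℝ)..1, ‖deriv (γ n) t - deriv η t‖ ^ 2) atTop (𝓝 0) := by
  have hη' := hη.continuous_deriv_one
  have h0 : ∀ n, 0 ≤ ∫ t in (0 : ℝ)..1, ‖deriv (γ n) t - deriv η t‖ ^ 2 := fun n =>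
    intervalIntegral.integral_nonneg zero_le_one fun t _ => by positivity
  have key : ∀ n, ENNReal.ofReal (∫ t in (0 : ℝ)..1, ‖deriv (γ n) t - deriv η t‖ ^ 2) ≤
      h1DistSq (γ n) η := fun n => by
    have hγ' := (hγ n).continuous_deriv_one
    have hc : Continuous fun t => ‖deriv (γ n) t - deriv η t‖ ^ 2 := by fun_prop
    rw [intervalIntegral.integral_of_le zero_le_one, ← integral_Icc_eq_integral_Ioc,
      ofReal_integral_eq_lintegral_ofReal (hc.continuousOn.integrableOn_compact isCompact_Icc)
        (ae_of_all _ fun t => by positivity)]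
    unfold h1DistSq
    refine lintegral_mono fun t => ?_
    rw [ENNReal.ofReal_pow (norm_nonneg _), ofReal_norm]
    exact le_add_self
  have h1 := tendsto_of_tendsto_of_tendsto_of_le_of_le tendsto_const_nhds h (fun n => zero_le) key
  have h2 := (ENNReal.tendsto_toReal ENNReal.zero_ne_top).comp h1
  refine h2.congr fun n => ?_
  exact ENNReal.toReal_ofReal (h0 n)

/-- Constant speeds make `|L n - Λ|` a pointwise lower bound for `‖γ n' - η'‖`, so the `L²` distance
controls it. -/
lemma tendsto_speed {γ : ℕ → ℝ → Plane} {η : ℝ → Plane} (hγ : ∀ n, ContDiff ℝ 1 (γ n))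
    (hη : ContDiff ℝ 1 η) {L : ℕ → ℝ} {Λ : ℝ} (hL : ∀ n t, ‖deriv (γ n) t‖ = L n)
    (hΛ : ∀ t, ‖deriv η t‖ = Λ)
    (h : Tendsto (fun n => ∫ t in (0 : ℝ)..1, ‖deriv (γ n) t - deriv η t‖ ^ 2) atTop (𝓝 0)) :
    Tendsto L atTop (𝓝 Λ) := by
  have hη' := hη.continuous_deriv_one
  rw [tendsto_iff_norm_sub_tendsto_zero]
  have h1 : ∀ n, ‖L n - Λ‖ ^ 2 ≤ ∫ t in (0 : ℝ)..1, ‖deriv (γ n) t - deriv η t‖ ^ 2 := fun n => by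
    have hγ' := (hγ n).continuous_deriv_one
    have : ∫ _ in (0 : ℝ)..1, ‖L n - Λ‖ ^ 2 ≤ ∫ t in (0 : ℝ)..1, ‖deriv (γ n) t - deriv η t‖ ^ 2 := by
      refine intervalIntegral.integral_mono_on zero_le_one (by simp)
        (Continuous.intervalIntegrable (by fun_prop) _ _) fun t _ => ?_
      gcongr
      rw [← hL n t, ← hΛ t]
      exact abs_norm_sub_norm_le _ _
    simpa using this
  have h2 : Tendsto (fun n => ‖L n - Λ‖ ^ 2) atTop (𝓝 0) :=
    squeeze_zero (fun n => by positivity) h1 h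
  have h3 := h2.sqrt
  simpa [Real.sqrt_sq_eq_abs] using h3

lemma norm_inv_smul_sub_le {a b : Plane} {s t : ℝ} (hs : 0 < s) (ht : 0 < t) (ha : ‖a‖ = s)
    (hb : ‖b‖ = t) : ‖s⁻¹ • a - t⁻¹ • b‖ ≤ 2 * s⁻¹ * ‖a - b‖ := by
  have e : s⁻¹ • a - t⁻¹ • b = s⁻¹ • (a - b) + (s⁻¹ * (t - s)) • (t⁻¹ • b) := by
    rw [smul_smul, smul_sub]
    have : s⁻¹ * (t - s) * t⁻¹ = s⁻¹ - t⁻¹ := by field_simp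
    rw [this, sub_smul]; abel
  rw [e]
  refine (norm_add_le _ _).trans ?_
  have h1 : ‖t⁻¹ • b‖ = 1 := by
    rw [norm_smul, norm_inv, Real.norm_of_nonneg ht.le, hb, inv_mul_cancel₀ ht.ne']
  rw [norm_smul, norm_smul _ (t⁻¹ • b), h1, mul_one, norm_mul, norm_inv, Real.norm_of_nonneg hs.le]
  have h2 : ‖t - s‖ ≤ ‖a - b‖ := by
    rw [← ha, ← hb, ← norm_neg (a - b), neg_sub]
    exact abs_norm_sub_norm_le _ _
  have h3 : s⁻¹ * ‖t - s‖ ≤ s⁻¹ * ‖a - b‖ := by gcongr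
  linarith

lemma tendsto_tangent {γ : ℕ → ℝ → Plane} {η : ℝ → Plane} (hγ : ∀ n, ContDiff ℝ 1 (γ n))
    (hη : ContDiff ℝ 1 η) {L : ℕ → ℝ} {Λ : ℝ} (hL0 : ∀ n, 0 < L n) (hΛ0 : 0 < Λ)
    (hL : ∀ n t, ‖deriv (γ n) t‖ = L n) (hΛ : ∀ t, ‖deriv η t‖ = Λ)
    (hLΛ : Tendsto L atTop (𝓝 Λ))
    (h : Tendsto (fun n => ∫ t in (0 : ℝ)..1, ‖deriv (γ n) t - deriv η t‖ ^ 2) atTop (𝓝 0)) :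
    Tendsto (fun n => ∫ t in (0 : ℝ)..1, ‖(L n)⁻¹ • deriv (γ n) t - Λ⁻¹ • deriv η t‖ ^ 2)
      atTop (𝓝 0) := by
  have hη' := hη.continuous_deriv_one
  have hlim : Tendsto (fun n => (2 * (L n)⁻¹) ^ 2 *
      ∫ t in (0 : ℝ)..1, ‖deriv (γ n) t - deriv η t‖ ^ 2) atTop (𝓝 ((2 * Λ⁻¹) ^ 2 * 0)) :=
    (((hLΛ.inv₀ hΛ0.ne').const_mul 2).pow 2).mul h
  rw [mul_zero] at hlim
  refine squeeze_zero (fun n => ?_) (fun n => ?_) hlim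
  · exact intervalIntegral.integral_nonneg zero_le_one fun t _ => by positivity
  · have hγ' := (hγ n).continuous_deriv_one
    rw [← intervalIntegral.integral_const_mul]
    refine intervalIntegral.integral_mono_on zero_le_one
      (Continuous.intervalIntegrable (by fun_prop) _ _)
      (Continuous.intervalIntegrable (by fun_prop) _ _) fun t _ => ?_
    rw [← mul_pow]
    gcongr
    exact norm_inv_smul_sub_le (hL0 n) hΛ0 (hL n t) (hΛ t)

/-- The integral of the squared derivative of the unit tangent. -/
def tangentEnergy (γ : ℝ → Plane) : ℝ :=
  ∫ t in (0 : ℝ)..1, ‖(curveLength γ)⁻¹ • weakDeriv (deriv γ) t‖ ^ 2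

lemma norm_perp (y : Plane) : ‖perp y‖ = ‖y‖ := by
  rw [EuclideanSpace.norm_eq, EuclideanSpace.norm_eq]
  simp [perp, Fin.sum_univ_two, add_comm]

lemma curveLength_pos {γ : ℝ → Plane} (hr : IsRegularCurve γ) (hs : HasConstantSpeed γ) :
    0 < curveLength γ := by
  rw [← hs 0]; exact norm_pos_iff.2 (hr 0)

/-- Cauchy–Schwarz in the definition of the curvature, at constant speed. The orthogonality of the
second derivative to the tangent, which would give equality, is not needed in this direction. -/
lemma integral_curvature_sq_le {γ : ℝ → Plane} (hγ : IsH2Curve γ) (hr : IsRegularCurve γ)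
    (hs : HasConstantSpeed γ) :
    ∫ t in (0 : ℝ)..1, curvature γ t ^ 2 * ‖deriv γ t‖ ≤ tangentEnergy γ / curveLength γ := by
  have hΛ := curveLength_pos hr hs
  have h2 := (hγ.contDiff.2.2.const_smul (curveLength γ)⁻¹) (Icc 0 1) isCompact_Icc
  unfold tangentEnergy
  rw [← intervalIntegral.integral_div, intervalIntegral.integral_of_le zero_le_one,
    intervalIntegral.integral_of_le zero_le_one]
  have hInt : IntegrableOn (fun t => ‖(curveLength γ)⁻¹ • weakDeriv (deriv γ) t‖ ^ 2)
      (Ioc (0 : ℝ) 1) := h2.norm.integrable_sq.mono_measure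
        (Measure.restrict_mono Ioc_subset_Icc_self le_rfl)
  refine integral_mono_of_nonneg (ae_of_all _ fun t => by positivity) (hInt.div_const _)
    (ae_of_all _ fun t => ?_)
  simp only [curvature]
  rw [hs t, norm_smul, norm_inv, Real.norm_of_nonneg hΛ.le]
  have h1 : |(inner ℝ (perp (deriv γ t)) (weakDeriv (deriv γ) t) : ℝ)| ≤
      curveLength γ * ‖weakDeriv (deriv γ) t‖ := by
    refine (abs_real_inner_le_norm _ _).trans ?_
    rw [norm_perp, hs t]
  have h3 : (inner ℝ (perp (deriv γ t)) (weakDeriv (deriv γ) t) : ℝ) ^ 2 ≤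
      (curveLength γ * ‖weakDeriv (deriv γ) t‖) ^ 2 := sq_le_sq' (abs_le.1 h1).1 (abs_le.1 h1).2
  calc (inner ℝ (perp (deriv γ t)) (weakDeriv (deriv γ) t) / curveLength γ ^ 3) ^ 2 * curveLength γ
      = (inner ℝ (perp (deriv γ t)) (weakDeriv (deriv γ) t) : ℝ) ^ 2 / curveLength γ ^ 5 := by
        field_simp
    _ ≤ (curveLength γ * ‖weakDeriv (deriv γ) t‖) ^ 2 / curveLength γ ^ 5 := by gcongr
    _ = _ := by field_simp

/-! ### The lower bound for the defect energy -/

lemma eventually_le_arcDefect_of_tendsto {γ : ℕ → ℝ → Plane} {η : ℝ → Plane}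
    (hγ : ∀ n, IsSmoothJordanCurve (γ n)) (hη : IsH2Curve η) (hr : IsRegularCurve η)
    (hs : HasConstantSpeed η) (h : Tendsto (fun n => h1DistSq (γ n) η) atTop (𝓝 0)) :
    Tendsto (fun n => curveLength (γ n)) atTop (𝓝 (curveLength η)) ∧
    ∀ ρ : ℕ → ℝ, (∀ᶠ n in atTop, 0 < ρ n) → Tendsto ρ atTop (𝓝 0) →
      ∀ y < tangentEnergy η / (12 * curveLength η),
        ∀ᶠ n in atTop, ENNReal.ofReal (y * ρ n ^ 3) ≤ arcDefect (γ n) 0 1 (ρ n) := by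
  obtain ⟨hη1, hη2, hη3⟩ := hη.contDiff
  have hγ1 : ∀ n, ContDiff ℝ 1 (γ n) := fun n => (hγ n).1.of_le (by simp)
  have hL0 : ∀ n, 0 < curveLength (γ n) := fun n => curveLength_pos (hγ n).2.2.2.1 (hγ n).2.2.2.2
  have hL : ∀ n t, ‖deriv (γ n) t‖ = curveLength (γ n) := fun n => (hγ n).2.2.2.2
  have hΛ0 := curveLength_pos hr hs
  have hD := tendsto_integral_deriv_sub hγ1 hη1 h
  have hLΛ := tendsto_speed hγ1 hη1 hL hs hD
  refine ⟨hLΛ, fun ρ hρ0 hρ y hy => ?_⟩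
  refine eventually_le_arcDefect_curve hγ1 hL0 hL hΛ0 hLΛ hρ0 hρ
    (v := fun t => (curveLength η)⁻¹ • deriv η t) (w := fun t => (curveLength η)⁻¹ •
      weakDeriv (deriv η) t) ?_ ?_ (hη2.const_smul _) (hη3.const_smul _)
    (tendsto_tangent hγ1 hη1 hL0 hΛ0 hL hs hLΛ hD) hy
  · have := hη1.continuous_deriv_one
    fun_prop
  · intro t
    rw [norm_smul, norm_inv, Real.norm_of_nonneg hΛ0.le, hs t, inv_mul_cancel₀ hΛ0.ne']

section Limit

variable {lam : ℕ → ℝ} {Ω : ℕ → Set Plane} {ι : Type*} [Fintype ι] {η : ι → ℝ → Plane} {N : ℕ → ℕ}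
  {c : ∀ n, Fin (N n) → ℝ → Plane} {q : ∀ n, ι → Fin (N n)}

lemma eventually_le_totalDefect (hlam : Tendsto lam atTop atTop) (hΩ : ∀ n, IsRegularSet (Ω n))
    (hη : ∀ i, IsH2Curve (η i) ∧ IsRegularCurve (η i) ∧ HasConstantSpeed (η i))
    (hc : ∀ n, IsBoundaryDecomposition (Ω n) (c n)) (hq : ∀ n, Function.Injective (q n))
    (hconv : ∀ i, Tendsto (fun n => h1DistSq (c n (q n i)) (η i)) atTop (𝓝 0)) {y : ℝ}
    (hy : y < ∑ i, tangentEnergy (η i) / (12 * curveLength (η i))) {s : ℝ} (hs : 0 < s) :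
    ∀ᶠ n in atTop, ENNReal.ofReal (y * s ^ 3) ≤
      ENNReal.ofReal (lam n ^ 3) * totalDefect (Ω n) (s / lam n) := by
  set Y := ∑ i, tangentEnergy (η i) / (12 * curveLength (η i)) with hY
  -- The slack is spread over the curves; the `+ 1` covers the empty family.
  set δ := (Y - y) / (Fintype.card ι + 1) with hδ
  have hδ0 : 0 < δ := div_pos (by linarith) (by positivity)
  have hpos := hlam.eventually_gt_atTop 0
  have hev : ∀ i, ∀ᶠ n in atTop, ENNReal.ofReal
      ((tangentEnergy (η i) / (12 * curveLength (η i)) - δ) * (s / lam n) ^ 3) ≤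
      arcDefect (c n (q n i)) 0 1 (s / lam n) := fun i =>
    (eventually_le_arcDefect_of_tendsto (fun n => (hc n).1 (q n i)) (hη i).1 (hη i).2.1 (hη i).2.2
      (hconv i)).2 _ (hpos.mono fun n hn => div_pos hs hn) (hlam.const_div_atTop s) _ (by linarith)
  filter_upwards [eventually_all.2 hev, hpos] with n hn hn0
  have hA : ArcFamily ι (q n) (fun _ => 0) (fun _ => 1) :=
    ⟨fun _ => le_rfl, fun _ => le_rfl, fun i j hij h => absurd (hq n h) hij⟩
  have hcard : (Fintype.card ι : ℝ) * δ ≤ Y - y := by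
    rw [hδ, mul_div_assoc', div_le_iff₀ (by positivity)]
    nlinarith
  calc ENNReal.ofReal (y * s ^ 3)
      ≤ ENNReal.ofReal (lam n ^ 3 * ∑ i,
        (tangentEnergy (η i) / (12 * curveLength (η i)) - δ) * (s / lam n) ^ 3) := by
        refine ENNReal.ofReal_le_ofReal ?_
        rw [← Finset.sum_mul, Finset.sum_sub_distrib, Finset.sum_const, Finset.card_univ,
          nsmul_eq_mul, ← hY, div_pow]
        have e : lam n ^ 3 * ((Y - Fintype.card ι * δ) * (s ^ 3 / lam n ^ 3)) =
            (Y - Fintype.card ι * δ) * s ^ 3 := by field_simp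
        rw [e]
        gcongr
        linarith
    _ = ENNReal.ofReal (lam n ^ 3) * ENNReal.ofReal (∑ i,
        (tangentEnergy (η i) / (12 * curveLength (η i)) - δ) * (s / lam n) ^ 3) :=
        ENNReal.ofReal_mul (by positivity)
    _ ≤ ENNReal.ofReal (lam n ^ 3) * ∑ i, ENNReal.ofReal
        ((tangentEnergy (η i) / (12 * curveLength (η i)) - δ) * (s / lam n) ^ 3) := by
        gcongr
        exact Finset.le_sum_of_subadditive ENNReal.ofReal (by simp)
          (fun _ _ => ENNReal.ofReal_add_le) _ _
    _ ≤ _ := by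
        gcongr
        exact (Finset.sum_le_sum fun i _ => hn i).trans (sum_arcDefect_le (hΩ n) (hc n) hA _)

/-- Fatou in the rescaled length `s`, with the cubic bound for each `s`; the factor `6 / α₀ ^ 4` is
the integral of `s ^ 3 * exp (-(α₀ * s))`. A negative `y` makes the left side zero. -/
lemma le_liminf_defectEnergy (hlam : Tendsto lam atTop atTop) {α : ℕ → ℝ} {α₀ : ℝ} (hα₀ : 0 < α₀)
    (hα : Tendsto α atTop (𝓝 α₀)) (hΩ : ∀ n, IsRegularSet (Ω n))
    (hη : ∀ i, IsH2Curve (η i) ∧ IsRegularCurve (η i) ∧ HasConstantSpeed (η i))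
    (hc : ∀ n, IsBoundaryDecomposition (Ω n) (c n)) (hq : ∀ n, Function.Injective (q n))
    (hconv : ∀ i, Tendsto (fun n => h1DistSq (c n (q n i)) (η i)) atTop (𝓝 0)) {y : ℝ}
    (hy : y < ∑ i, tangentEnergy (η i) / (12 * curveLength (η i))) :
    ENNReal.ofReal (y * (6 / α₀ ^ 4)) ≤
      liminf (fun n => ENNReal.ofReal (lam n ^ 4) * defectEnergy (Ω n) (lam n * α n)) atTop := by
  rcases lt_or_ge y 0 with hy0 | hy0
  · rw [ENNReal.ofReal_of_nonpos]
    · exact zero_le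
    · exact mul_nonpos_of_nonpos_of_nonneg hy0.le (by positivity)
  set f : ℕ → ℝ → ENNReal := fun n s => ENNReal.ofReal (Real.exp (-(α n * s))) *
        (ENNReal.ofReal (lam n ^ 3) * totalDefect (Ω n) (s / lam n)) with hf
  have hfm : ∀ n, Measurable (f n) := fun n => by
    have := measurable_totalDefect (hΩ n).2.1.measurableSet
    fun_prop
  have hpt : ∀ s ∈ Ioi (0 : ℝ), ENNReal.ofReal (y * (s ^ 3 * Real.exp (-(α₀ * s)))) ≤
      liminf (fun n => f n s) atTop := by
    intro s hs
    have hlim : Tendsto (fun n => ENNReal.ofReal (Real.exp (-(α n * s)) * (y * s ^ 3))) atTop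
        (𝓝 (ENNReal.ofReal (Real.exp (-(α₀ * s)) * (y * s ^ 3)))) :=
      ENNReal.tendsto_ofReal (((Real.continuous_exp.tendsto _).comp
        (hα.mul_const s).neg).mul_const _)
    have e : y * (s ^ 3 * Real.exp (-(α₀ * s))) = Real.exp (-(α₀ * s)) * (y * s ^ 3) := by ring
    rw [e, ← hlim.liminf_eq]
    refine liminf_le_liminf ?_
    filter_upwards [eventually_le_totalDefect hlam hΩ hη hc hq hconv hy hs] with n hn
    rw [ENNReal.ofReal_mul (Real.exp_pos _).le]
    simp only [hf]
    gcongr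
  calc ENNReal.ofReal (y * (6 / α₀ ^ 4))
      = ∫⁻ s in Ioi (0 : ℝ), ENNReal.ofReal (y * (s ^ 3 * Real.exp (-(α₀ * s)))) := by
        simp_rw [ENNReal.ofReal_mul hy0]
        rw [lintegral_const_mul _ (by fun_prop), lintegral_pow_mul_exp hα₀]
        norm_num [Nat.factorial]
    _ ≤ ∫⁻ s in Ioi (0 : ℝ), liminf (fun n => f n s) atTop := setLIntegral_mono' measurableSet_Ioi hpt
    _ ≤ liminf (fun n => ∫⁻ s in Ioi (0 : ℝ), f n s) atTop := lintegral_liminf_le hfm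
    _ = _ := by
        refine liminf_congr ?_
        filter_upwards [hlam.eventually_gt_atTop 0] with n hn
        rw [defectEnergy_rescale _ hn]

end Limit

/-- The product with `lam n ^ 2 → ∞` converges, so `1 - 1 / (2 π α²)` tends to zero. -/
lemma tendsto_of_tendsto_defect {lam α : ℕ → ℝ} {σ : ℝ} (hlam : Tendsto lam atTop atTop)
    (hα : ∀ n, 0 < α n)
    (hσ : Tendsto (fun n => lam n ^ 2 * (1 - 1 / (2 * Real.pi * α n ^ 2))) atTop (𝓝 σ)) :
    Tendsto α atTop (𝓝 (1 / Real.sqrt (2 * Real.pi))) := by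
  have h1 : Tendsto (fun n => (lam n ^ 2)⁻¹) atTop (𝓝 0) :=
    ((tendsto_pow_atTop two_ne_zero).comp hlam).inv_tendsto_atTop
  have h2 : Tendsto (fun n => 1 - 1 / (2 * Real.pi * α n ^ 2)) atTop (𝓝 0) := by
    have h3 := h1.mul hσ
    rw [zero_mul] at h3
    refine h3.congr' ?_
    filter_upwards [hlam.eventually_gt_atTop 0] with n hn
    rw [inv_mul_cancel_left₀ (by positivity)]
  have h4 : Tendsto (fun n => 1 / (2 * Real.pi * α n ^ 2)) atTop (𝓝 1) := by
    simpa using h2.const_sub 1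
  have h5 := ((h4.inv₀ one_ne_zero).const_mul (1 / (2 * Real.pi))).sqrt
  rw [inv_one, mul_one, Real.sqrt_div zero_le_one, Real.sqrt_one] at h5
  refine h5.congr fun n => ?_
  have e : 1 / (2 * Real.pi) * (1 / (2 * Real.pi * α n ^ 2))⁻¹ = α n ^ 2 := by
    have := hα n
    field_simp
  rw [e, Real.sqrt_sq (hα n).le]

end NonlocalIso

end

/-! ### The lower bound for the energy -/

open NonlocalIso in
theorem proposition5p3
    (lam α : ℕ → ℝ) (σ : ℝ)
    (hlam : Tendsto lam atTop atTop)
    (hα : ∀ n, 1 / Real.sqrt (2 * Real.pi) < α n)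
    (hσ : 0 < σ)
    (hσlim : Tendsto (fun n => lam n ^ 2 * (1 - 1 / (2 * Real.pi * α n ^ 2))) atTop (𝓝 σ))
    (Ω : ℕ → Set Plane) (Ωinf : Set Plane)
    (hΩreg : ∀ n, IsRegularSet (Ω n))
    (hΩadm : ∀ n, Admissible Real.pi (Ω n))
    (hΩinf : Admissible Real.pi Ωinf)
    (hL1 : Tendsto (fun n => eLpNorm
      (fun x => (Ω n).indicator (fun _ => (1 : ℝ)) x - Ωinf.indicator (fun _ => (1 : ℝ)) x)
      1 volume) atTop (𝓝 0))
    (hbdd : limsup (fun n => ((lam n ^ 2 * energy (lam n) (α n) (Ω n) : ℝ) : EReal)) atTop < ⊤)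
    (I : Finset ℕ) (γinf : I → ℝ → Plane)
    (hγinf : IsBoundarySystem Ωinf γinf)
    (N : ℕ → ℕ) (c : ∀ n, Fin (N n) → ℝ → Plane)
    (hc : ∀ n, IsBoundaryDecomposition (Ω n) (c n))
    (e : ∀ n, I → Fin (N n)) (he : ∀ n, Function.Injective (e n))
    (hconv : ∀ i, Tendsto (fun n => h1DistSq (c n (e n i)) (γinf i)) atTop (𝓝 0)) :
    ((limitEnergy σ γinf : ℝ) : EReal) ≤
      liminf (fun n => ((lam n ^ 2 * energy (lam n) (α n) (Ω n) : ℝ) : EReal)) atTop := by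
  have hα0 : ∀ n, 0 < α n := fun n => lt_trans (by positivity) (hα n)
  have hα₀ : 0 < 1 / Real.sqrt (2 * Real.pi) := by positivity
  have hαlim := tendsto_of_tendsto_defect hlam hα0 hσlim
  have hP : ∀ n (r : ℝ), 0 ≤ r →
      oddMeasure (Ω n) r ≤ ENNReal.ofReal (4 * r) * perimeter (Ω n) := fun n r hr =>
    oddMeasure_le (hΩreg n).2.1 (hΩreg n).1 hr
  have hcoef : ∀ n, 0 ≤ lam n ^ 2 * (1 - 1 / (2 * Real.pi * α n ^ 2)) := fun n => by
    have h1 : 1 / (2 * Real.pi) ≤ α n ^ 2 := by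
      have := pow_le_pow_left₀ hα₀.le (hα n).le 2
      rwa [div_pow, Real.sq_sqrt (by positivity), one_pow] at this
    have h2 : 1 / (2 * Real.pi * α n ^ 2) ≤ 1 := by
      rw [div_le_one (mul_pos (by positivity) (pow_pos (hα0 n) 2))]
      rwa [div_le_iff₀' (by positivity)] at h1
    exact mul_nonneg (sq_nonneg _) (by linarith)
  have hlen : Tendsto (fun n => lam n ^ 2 * (1 - 1 / (2 * Real.pi * α n ^ 2)) *
      ∑ i, curveLength (c n (e n i))) atTop (𝓝 (σ * ∑ i, curveLength (γinf i))) := by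
    refine hσlim.mul (tendsto_finsetSum _ fun i _ => ?_)
    exact (eventually_le_arcDefect_of_tendsto (fun n => (hc n).1 (e n i)) (hγinf.1 i).1
      (hγinf.1 i).2.1 (hγinf.1 i).2.2 (hconv i)).1
  set Y := ∑ i, tangentEnergy (γinf i) / (12 * curveLength (γinf i)) with hY
  -- Since `Y` carries the factor `1 / 12`, the bending constant `π / 2` becomes `6 π`.
  have hlimit : limitEnergy σ γinf ≤ σ * ∑ i, curveLength (γinf i) + 6 * Real.pi * Y := by
    unfold limitEnergy
    rw [Finset.sum_add_distrib, ← Finset.mul_sum, hY, Finset.mul_sum (a := 6 * Real.pi)]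
    refine add_le_add le_rfl (Finset.sum_le_sum fun i _ => ?_)
    calc Real.pi / 2 * ∫ t in (0 : ℝ)..1, curvature (γinf i) t ^ 2 * ‖deriv (γinf i) t‖
        ≤ Real.pi / 2 * (tangentEnergy (γinf i) / curveLength (γinf i)) := by
          gcongr
          exact integral_curvature_sq_le (hγinf.1 i).1 (hγinf.1 i).2.1 (hγinf.1 i).2.2
      _ = _ := by
          have := curveLength_pos (hγinf.1 i).2.1 (hγinf.1 i).2.2
          field_simp
          ring
  refine EReal.ge_of_forall_gt_iff_ge.1 fun x hx => ?_
  rw [EReal.coe_lt_coe_iff] at hx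
  set δ := (σ * ∑ i, curveLength (γinf i) + 6 * Real.pi * Y - x) / 2 with hδ
  have hδ0 : 0 < δ := by rw [hδ]; linarith
  set y := Y - δ / (6 * Real.pi) with hy
  have hyY : y < Y := by
    have : 0 < δ / (6 * Real.pi) := by positivity
    rw [hy]; linarith
  have hyval : 6 * Real.pi * y = 6 * Real.pi * Y - δ := by
    rw [hy]; field_simp
  -- At `α₀ = 1 / √(2π)` one has `6 / α₀ ^ 4 = 24 π²`; the factor `4 π` is split off to meet the
  -- prefactor `λ⁴ / (4 π)`.
  have hconst : y * (6 / (1 / Real.sqrt (2 * Real.pi)) ^ 4) = 4 * Real.pi * (6 * Real.pi * y) := by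
    have : Real.sqrt (2 * Real.pi) ^ 4 = (2 * Real.pi) ^ 2 := by
      rw [show 4 = 2 * 2 by norm_num, pow_mul, Real.sq_sqrt (by positivity)]
    rw [div_pow, one_pow, this]
    field_simp
    norm_num
  -- A value strictly between `y` and `Y` makes the lower limit exceed the bound for `y` strictly,
  -- so that this bound holds eventually.
  have hliminf := le_liminf_defectEnergy hlam hα₀ hαlim hΩreg hγinf.1 hc he hconv (y := (y + Y) / 2)
    (by linarith)
  have hdef : ∀ᶠ n in atTop, 6 * Real.pi * y ≤
      lam n ^ 4 / (4 * Real.pi) * (defectEnergy (Ω n) (lam n * α n)).toReal := by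
    rcases le_or_gt y 0 with hy0 | hy0
    · filter_upwards [] with n
      exact (mul_nonpos_of_nonneg_of_nonpos (by positivity) hy0).trans (by positivity)
    · have hlt : ENNReal.ofReal (y * (6 / (1 / Real.sqrt (2 * Real.pi)) ^ 4)) <
          ENNReal.ofReal ((y + Y) / 2 * (6 / (1 / Real.sqrt (2 * Real.pi)) ^ 4)) := by
        rw [ENNReal.ofReal_lt_ofReal_iff (mul_pos (by linarith) (by positivity))]
        gcongr
        linarith
      filter_upwards [eventually_lt_of_lt_liminf (hlt.trans_le hliminf),
        hlam.eventually_gt_atTop 0] with n hn hn0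
      obtain ⟨hfin, -⟩ := le_energy (hΩreg n).2.1.measurableSet (hΩadm n).2.2 (hP n) hn0 (hα0 n)
      rw [hconst] at hn
      have h1 := ENNReal.toReal_mono (ENNReal.mul_ne_top (by simp) hfin.ne) hn.le
      rw [ENNReal.toReal_ofReal (by positivity), ENNReal.toReal_mul,
        ENNReal.toReal_ofReal (by positivity)] at h1
      rw [div_mul_eq_mul_div, le_div_iff₀ (by positivity)]
      linarith
  refine le_liminf_of_le (by isBoundedDefault) ?_
  filter_upwards [hdef, hlen.eventually_const_lt (sub_lt_self _ hδ0), hlam.eventually_gt_atTop 0]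
    with n hn1 hn2 hn0
  obtain ⟨-, hen⟩ := le_energy (hΩreg n).2.1.measurableSet (hΩadm n).2.2 (hP n) hn0 (hα0 n)
  have hper : ∑ i, curveLength (c n (e n i)) ≤ (perimeter (Ω n)).toReal :=
    (ENNReal.ofReal_le_iff_le_toReal (hΩadm n).2.2.ne).1
      (sum_curveLength_le (hΩreg n) (hP n) (hc n) (he n))
  -- The lower bound on `α n` enters here: the coefficient of the perimeter is non-negative, so the
  -- perimeter may be replaced by the total length.
  have hmul := mul_le_mul_of_nonneg_left hper (hcoef n)
  rw [EReal.coe_le_coe_iff]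
  linarith
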